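/- For $n\ge 2$ put $C=(n+1)^{n+1}$, $\rho_k=\frac{k}{n+1}$ $(1\le k\le n)$ and $\theta=t\frac{d}{dt}$. Consider the mirror family of Calabi--Yau $(n-1)$-folds, in the rescaled parameter $t$ (i.e. $Y^{(n-1)}_{Ct}$ in the usual normalisation), $$x_1\cdots x_n\,(x_1+\dots+x_n+1)+(-1)^{n+1}\,t=0 ,$$ that is, for $n=2,3,4,5$, the mirror families of elliptic curves, K3 surfaces, quintic Calabi--Yau threefolds, and Calabi--Yau fourfolds. Denote the left-hand side by $f$. For $m=0,\dots,n-1$ define $\tilde f_m(t)$, with the principal branch of $t^{\epsilon}$, by $$\tilde f_m(t)=\frac{1}{(2\pi i)^m m!}\,\frac{\partial^m}{\partial\epsilon^m}\Big|_{\epsilon=0}\ \sum_{k\ge 0}\frac{(\rho_1+\epsilon)_k\cdots(\rho_n+\epsilon)_k}{(1+\epsilon)_k^{\,n}}\,C^k\,t^{k+\epsilon},$$ and let $\tilde{\pmb f}=(\tilde f_{n-1},\dots,\tilde f_1,\tilde f_0)^t$. Put $$B_k(\epsilon)=e^{-\pi i\epsilon}\Big[\prod_{i=1}^n\frac{\Gamma(\rho_i)\Gamma(1+\epsilon)}{\Gamma(\rho_i+\epsilon)}\Big]\frac{\sin(\pi\rho_k)}{\sin(\pi\rho_k+\pi\epsilon)},\qquad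 \tilde{\mathsf P}_{n-j,\,n+1-k}=\frac{1}{(2\pi i)^j j!}\frac{\partial^j}{\partial\epsilon^j}\Big|_{\epsilon=0}\big[C^{-\epsilon}B_k(\epsilon)\big]$$ for $0\le j\le n-1$, $1\le k\le n$, $\mathsf M_\infty=\operatorname{diag}(e^{-2\pi i\rho_n},\dots,e^{-2\pi i\rho_1})$, and let $\mathsf m_0$ be the upper triangular matrix with entries $\frac1{(j-i)!}$ for $i\le j$. Then for $2\le n\le 5$ the following hold. (a) For $|t|<1/C$ the holomorphic period of the family is $$\frac{1}{2\pi i}\oint_{|x_1|=\frac1{n+1}}\!\!\cdots\oint_{|x_n|=\frac1{n+1}}\frac{dx_1\cdots dx_n}{f}=(2\pi i)^{n-1}\tilde f_0(t)$$ (the integrand being integrable on the torus), and on the disc $|t|<1/C$ cut along $(-1/C,0]$ the functions $\tilde f_{n-1},\dots,\tilde f_0$ are holomorphic and form a basis of the holomorphic solutions of the Picard--Fuchs equation $$\big[\theta^n-C\,t\,(\theta+\rho_1)\cdots(\theta+\rho_n)\big]F=0 .$$ (b) $\tilde{\mathsf P}$ is invertible, and with $\mathsf m_\infty=\tilde{\mathsf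 P}\,\mathsf M_\infty\,\tilde{\mathsf P}^{-1}$ and $\mathsf m_{1/C}=\mathsf m_\infty\mathsf m_0^{-1}$ the matrices $\mathsf m_0,\mathsf m_{1/C},\mathsf m_\infty$ are the ones listed below. (c) For every $t_0\in(0,1/C)$, analytic continuation of $\tilde{\pmb f}$ from $t_0$ along the following loops gives $\mathsf m_0\tilde{\pmb f}$, $\mathsf m_{1/C}\tilde{\pmb f}$, $\mathsf m_\infty\tilde{\pmb f}$, respectively: the counterclockwise circle through $t_0$ centred at $0$; the counterclockwise circle through $t_0$ centred at $1/C$; and the loop that goes from $t_0$ to $2/C-t_0$ along the half circle centred at $1/C$ in the lower half plane, then once counterclockwise around $|t|=2/C-t_0$, then back along the same half circle. With $\kappa_4=-200\frac{\zeta(3)}{(2\pi i)^3}$ and $\kappa_5=420\frac{\zeta(3)}{(2\pi i)^3}$ the matrices are: $n=2$: $$\mathsf m_0=\begin{pmatrix}1&1\\0&1\end{pmatrix},\quad \mathsf m_{1/C}=\begin{pmatrix}1&0\\-3&1\end{pmatrix},\quad \mathsf m_\infty=\begin{pmatrix}1&1\\-3&-2\end{pmatrix}.$$ $n=3$: $$\mathsf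 m_0=\begin{pmatrix}1&1&\frac12\\0&1&1\\0&0&1\end{pmatrix},\quad \mathsf m_{1/C}=\begin{pmatrix}0&0&-\frac14\\0&1&0\\-4&0&0\end{pmatrix},\quad \mathsf m_\infty=\begin{pmatrix}0&0&-\frac14\\0&1&1\\-4&-4&-2\end{pmatrix}.$$ $n=4$: $$\mathsf m_0=\begin{pmatrix}1&1&\frac12&\frac16\\0&1&1&\frac12\\0&0&1&1\\0&0&0&1\end{pmatrix},\quad \mathsf m_{1/C}=\begin{pmatrix}1+\kappa_4&0&\frac{5\kappa_4}{12}&\frac{\kappa_4^2}{5}\\-\frac{25}{12}&1&-\frac{125}{144}&-\frac{5\kappa_4}{12}\\0&0&1&0\\-5&0&-\frac{25}{12}&1-\kappa_4\end{pmatrix},$$ $$\mathsf m_\infty=\begin{pmatrix}1+\kappa_4&1+\kappa_4&\frac12+\frac{11\kappa_4}{12}&\frac16+\frac{7\kappa_4}{12}+\frac{\kappa_4^2}{5}\\-\frac{25}{12}&-\frac{13}{12}&-\frac{131}{144}&-\frac{103}{144}-\frac{5\kappa_4}{12}\\0&0&1&1\\-5&-5&-\frac{55}{12}&-\frac{23}{12}-\kappa_4\end{pmatrix}.$$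 $n=5$: $$\mathsf m_0=\begin{pmatrix}1&1&\frac12&\frac16&\frac1{24}\\0&1&1&\frac12&\frac16\\0&0&1&1&\frac12\\0&0&0&1&1\\0&0&0&0&1\end{pmatrix},\quad \mathsf m_{1/C}=\begin{pmatrix}\frac{75}{64}&0&\frac{55}{512}&-\frac{11\kappa_5}{384}&-\frac{121}{24576}\\-\kappa_5&1&-\frac{5\kappa_5}{8}&\frac{\kappa_5^2}{6}&\frac{11\kappa_5}{384}\\-\frac{15}{4}&0&-\frac{43}{32}&\frac{5\kappa_5}{8}&\frac{55}{512}\\0&0&0&1&0\\-6&0&-\frac{15}{4}&\kappa_5&\frac{75}{64}\end{pmatrix},$$ $$\mathsf m_\infty=\begin{pmatrix}\frac{75}{64}&\frac{75}{64}&\frac{355}{512}&-\frac{11\kappa_5}{384}+\frac{155}{512}&-\frac{11\kappa_5}{384}+\frac{2399}{24576}\\-\kappa_5&-\kappa_5+1&-\frac{9\kappa_5}{8}+1&\frac{(4\kappa_5-3)(\kappa_5-4)}{24}&\frac{\kappa_5^2}{6}-\frac{125\kappa_5}{384}+\frac16\\-\frac{15}{4}&-\frac{15}{4}&-\frac{103}{32}&\frac{5\kappa_5}{8}-\frac{63}{32}&\frac{5\kappa_5}{8}-\frac{369}{512}\\0&0&0&1&1\\-6&-6&-\frac{27}{4}&\kappa_5-\frac{19}{4}&\kappa_5-\frac{61}{64}\end{pmatrix}.$$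 -/

import Mathlib

open Topology

noncomputable section

namespace FermatMirror

/-! ### The mirror family and its holomorphic period -/

/-- The number `2 π i`. -/
def twoPiI : ℂ := 2 * (Real.pi : ℂ) * Complex.I

/-- The rescaling constant `C = (n+1)^(n+1)`. -/
def scale (n : ℕ) : ℝ := ((n : ℝ) + 1) ^ (n + 1)

/-- The polynomial `x₁ ⋯ xₙ (x₁ + ⋯ + xₙ + 1) + (-1)^(n+1) t / (n+1)^(n+1)`; its zero locus is
the affine part of the mirror Calabi-Yau variety `Y_t` of dimension `n - 1`. -/
def mirrorPoly (n : ℕ) (t : ℂ) (x : Fin n → ℂ) : ℂ :=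
  (∏ i, x i) * ((∑ i, x i) + 1) + (-1) ^ (n + 1) * t / (scale n : ℂ)

/-- The radii of the torus `|x₁| = ⋯ = |xₙ| = 1 / (n+1)`. -/
def torusRadius (n : ℕ) : Fin n → ℝ := fun _ => 1 / ((n : ℝ) + 1)

/-- The holomorphic period of `Y_t`: the integral of the holomorphic `(n-1)`-form
`dx₂ ∧ ⋯ ∧ dxₙ / ∂₁ f`, i.e. of the residue of `dx₁ ∧ ⋯ ∧ dxₙ / f` along `f = 0`, over the
cycle whose tube is the torus `|xᵢ| = 1 / (n+1)`. -/
def period (n : ℕ) (t : ℂ) : ℂ :=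
  twoPiI⁻¹ * torusIntegral (fun x => (mirrorPoly n t x)⁻¹) 0 (torusRadius n)

/-! ### The rescaled Picard-Fuchs equation and its Frobenius basis at `t = 0` -/

/-- The exponents at infinity `k / (n+1)`, `1 ≤ k ≤ n` (the index starts at `0`). -/
def rho (n : ℕ) (k : Fin n) : ℂ := (((k : ℕ) : ℂ) + 1) / ((n : ℂ) + 1)

/-- The operator `θ = t d/dt`. -/
def theta (F : ℂ → ℂ) : ℂ → ℂ := fun t => t * deriv F t

/-- The function `(θ + ρ₁) ⋯ (θ + ρₙ) F`. -/
def thetaShiftProd (n : ℕ) (F : ℂ → ℂ) : ℂ → ℂ :=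
  (List.ofFn (rho n)).foldr (fun r G => fun t => theta G t + r * G t) F

/-- The Picard-Fuchs operator `θⁿ - C t (θ + ρ₁) ⋯ (θ + ρₙ)`. -/
def picardFuchs (n : ℕ) (F : ℂ → ℂ) : ℂ → ℂ :=
  fun t => theta^[n] F t - (scale n : ℂ) * t * thetaShiftProd n F t

/-- The generating function
`∑ₖ (ρ₁+ε)ₖ ⋯ (ρₙ+ε)ₖ / ((1+ε)ₖ)ⁿ · Cᵏ t^(k+ε)`, with the principal branch of `t^ε`. -/
def frobeniusGen (n : ℕ) (ε t : ℂ) : ℂ :=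
  t ^ ε * ∑' k : ℕ,
    (∏ j, (ascPochhammer ℂ k).eval (rho n j + ε)) / ((ascPochhammer ℂ k).eval (1 + ε)) ^ n
      * ((scale n : ℂ) * t) ^ k

/-- The coefficient of `(2 π i ε)^m` in the generating function. -/
def frobenius (n m : ℕ) (t : ℂ) : ℂ :=
  iteratedDeriv m (fun ε => frobeniusGen n ε t) 0 / (twoPiI ^ m * (m.factorial : ℂ))

/-- The Frobenius basis in the order `f_{n-1}, …, f_1, f_0`. -/
def frobeniusBasis (n : ℕ) (i : Fin n) : ℂ → ℂ := frobenius n (i.rev : ℕ)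

/-- The punctured disc `0 < |t| < 1/C`, cut along the negative real axis. -/
def slitDisc (n : ℕ) : Set ℂ := Metric.ball 0 (1 / scale n) ∩ Complex.slitPlane

/-! ### The matrices built from the Mellin-Barnes transition functions -/

/-- The function
`B_k(ε) = e^(-π i ε) ∏ᵢ (Γ(ρᵢ) Γ(1+ε) / Γ(ρᵢ+ε)) · sin(π ρ_k) / sin(π ρ_k + π ε)`. -/
def transitionFun (n : ℕ) (k : Fin n) (ε : ℂ) : ℂ :=
  Complex.exp (-((Real.pi : ℂ) * Complex.I * ε)) *
    (∏ i, Complex.Gamma (rho n i) * Complex.Gamma (1 + ε) / Complex.Gamma (rho n i + ε)) *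
    (Complex.sin (Real.pi * rho n k) / Complex.sin (Real.pi * rho n k + Real.pi * ε))

/-- The transition matrix: the entry in row `n-j`, column `n+1-k` (both counted from `1`) is the
coefficient of `(2 π i ε)^j` in `C^(-ε) B_k(ε)`. -/
def transitionMatrix (n : ℕ) : Matrix (Fin n) (Fin n) ℂ :=
  Matrix.of fun i c =>
    iteratedDeriv (i.rev : ℕ) (fun ε => (scale n : ℂ) ^ (-ε) * transitionFun n c.rev ε) 0 /
      (twoPiI ^ (i.rev : ℕ) * ((i.rev : ℕ).factorial : ℂ))

/-- The diagonal matrix with entries `e^(-2 π i ρₙ), …, e^(-2 π i ρ₁)`. -/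
def localInfinity (n : ℕ) : Matrix (Fin n) (Fin n) ℂ :=
  Matrix.diagonal fun c => Complex.exp (-(twoPiI * rho n c.rev))

/-- The unipotent upper triangular matrix with entries `1 / (j-i)!` for `i ≤ j`. -/
def monodromyZero (n : ℕ) : Matrix (Fin n) (Fin n) ℂ :=
  Matrix.of fun i j => if i ≤ j then 1 / (((j : ℕ) - (i : ℕ)).factorial : ℂ) else 0

/-- The matrix `P M_∞ P⁻¹`. -/
def monodromyInfinity (n : ℕ) : Matrix (Fin n) (Fin n) ℂ :=
  transitionMatrix n * localInfinity n * (transitionMatrix n)⁻¹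

/-- The matrix `m_∞ m_0⁻¹`. -/
def monodromyConifold (n : ℕ) : Matrix (Fin n) (Fin n) ℂ :=
  monodromyInfinity n * (monodromyZero n)⁻¹

/-! ### Analytic continuation and monodromy -/

/-- The germ of `F` at `a` has an analytic continuation along `γ` that ends in the germ of `G`
at `b`. -/
def ContinuesAlong {a b : ℂ} (γ : Path a b) (F G : ℂ → ℂ) : Prop :=
  ∃ Φ : unitInterval → ℂ → ℂ,
    (∀ s, AnalyticAt ℂ (Φ s) (γ s)) ∧
    (∀ s, ∀ᶠ s' in 𝓝 s, Φ s' =ᶠ[𝓝 (γ s')] Φ s) ∧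
    Φ 0 =ᶠ[𝓝 a] F ∧ Φ 1 =ᶠ[𝓝 b] G

/-- Analytic continuation along the loop `γ` turns the column vector `F` into `M F`. -/
def HasMonodromy {n : ℕ} {a : ℂ} (γ : Path a a) (F : Fin n → ℂ → ℂ)
    (M : Matrix (Fin n) (Fin n) ℂ) : Prop :=
  ∀ i, ContinuesAlong γ (F i) (fun t => ∑ j, M i j * F j t)

/-- The circle with centre `c` through `a`, run through once counterclockwise from `a`. -/
def circleLoop (c a : ℂ) : Path a a where
  toFun s := c + (a - c) * Complex.exp (2 * Real.pi * Complex.I * ((s : ℝ) : ℂ))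
  continuous_toFun := by fun_prop
  source' := by simp
  target' := by simp

/-- The counterclockwise half circle with centre `c` from `a` to the opposite point. -/
def halfCircle (c a : ℂ) : Path a (2 * c - a) where
  toFun s := c + (a - c) * Complex.exp (Real.pi * Complex.I * ((s : ℝ) : ℂ))
  continuous_toFun := by fun_prop
  source' := by simp
  target' := by simp; ring

/-- The singular point `1/C`. -/
def conifold (n : ℕ) : ℂ := ((1 / scale n : ℝ) : ℂ)

/-- The counterclockwise circle around `0` through `t₀`. -/
def loopZero (t₀ : ℂ) : Path t₀ t₀ := circleLoop 0 t₀

/-- The counterclockwise circle around `1/C` through `t₀`. -/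
def loopConifold (n : ℕ) (t₀ : ℂ) : Path t₀ t₀ := circleLoop (conifold n) t₀

/-- The loop around infinity: for `0 < t₀ < 1/C`, go from `t₀` to `2/C - t₀ > 1/C` along a half
circle in the lower half plane, then once counterclockwise around the circle
`|t| = 2/C - t₀`, and return along the same half circle. -/
def loopInfinity (n : ℕ) (t₀ : ℂ) : Path t₀ t₀ :=
  ((halfCircle (conifold n) t₀).trans (circleLoop 0 (2 * conifold n - t₀))).trans
    (halfCircle (conifold n) t₀).symm

/-- `m₀`, `m₁`, `mInf` are the monodromy matrices around `0`, `1/C`, `∞` of the mirror family of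
`(n-1)`-folds. -/
structure IsMonodromyTriple (n : ℕ) (m₀ m₁ mInf : Matrix (Fin n) (Fin n) ℂ) : Prop where
  /-- The holomorphic period of the family, in the rescaled parameter, is `(2 π i)^(n-1) f_0`. -/
  period_eq : ∀ t : ℂ, ‖t‖ < 1 / scale n →
    TorusIntegrable (fun x => (mirrorPoly n (scale n * t) x)⁻¹) 0 (torusRadius n) ∧
      period n (scale n * t) = twoPiI ^ (n - 1) * frobenius n 0 t
  /-- The functions `f_{n-1}, …, f_0` are holomorphic on the slit disc. -/
  holomorphic : ∀ i, DifferentiableOn ℂ (frobeniusBasis n i) (slitDisc n)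
  /-- They form a basis of the solutions of the Picard-Fuchs equation on the slit disc. -/
  basis : ∀ F : ℂ → ℂ, DifferentiableOn ℂ F (slitDisc n) →
    ((∀ t ∈ slitDisc n, picardFuchs n F t = 0) ↔
      ∃! c : Fin n → ℂ, ∀ t ∈ slitDisc n, F t = ∑ i, c i * frobeniusBasis n i t)
  /-- The transition matrix is invertible. -/
  transition_invertible : IsUnit (transitionMatrix n).det
  zero_eq : monodromyZero n = m₀
  conifold_eq : monodromyConifold n = m₁
  infinity_eq : monodromyInfinity n = mInf
  hasMonodromy_zero : ∀ t₀ : ℝ, 0 < t₀ → t₀ < 1 / scale n →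
    HasMonodromy (loopZero t₀) (frobeniusBasis n) m₀
  hasMonodromy_conifold : ∀ t₀ : ℝ, 0 < t₀ → t₀ < 1 / scale n →
    HasMonodromy (loopConifold n t₀) (frobeniusBasis n) m₁
  hasMonodromy_infinity : ∀ t₀ : ℝ, 0 < t₀ → t₀ < 1 / scale n →
    HasMonodromy (loopInfinity n t₀) (frobeniusBasis n) mInf

end FermatMirror

end

/-! The theorem rests on one integral formula. With `moment n s = ∏ Γ(ρⱼ+s) / (Γ(ρⱼ) Γ(1+s))`, the
Pochhammer quotient in the generating function is `moment n (ε+k) / moment n ε`, and `moment n s` is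
the moment `∫ u^s dμ(u)` of the law `μ` of a product of independent `Beta(ρⱼ, 1-ρⱼ)` variables
(`eulerMeasure_moment`). Summing a geometric series gives the generating function as `t^ε ·
moment(ε)⁻¹ · ∫ u^ε / (1 - C t u) dμ(u)`. The integral is holomorphic for `t` off `[1/C, ∞)`, so the
whole Frobenius basis continues at once to the doubly slit plane. All statements about the basis are
read off from Taylor coefficients in `ε` modulo `ε^n`, that is, from power series.

Local theory. A solution of the equation with vanishing Cauchy data is zero, because the leading
coefficient of the operator is `1 - C t` (`picardFuchs_unique`). Hence `n` independent solutions
span (`picardFuchs_span`), and independence follows from comparing growth: powers of `log t` at `0`,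
the powers `t^(-ρ_k)` at infinity.

Connection with infinity, without Mellin-Barnes contours. On the plane cut along the positive axis
the `ε`-series of solutions is a combination of the solutions at infinity, with unknown series
`a_k(ε)` as coefficients (`exists_connection`). The coefficients of positive degree of `(C t)^ε ∫
u^ε / (1 - C t u) dμ` are integrals of `log(Ctu)^m / (1 - Ctu)` with `m > 0`. There the zero of the
logarithm cancels the pole, so these coefficients do not jump across `(1/C, ∞)`. Comparing the
expansions from the two sides forces `C^ε sin(π(ρ_k+ε)) a_k(ε)` to be constant modulo `ε^n`
(`coeff_connection_mul_sin`). This is exactly the shape of the columns of the transition matrix, up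
to one constant per column; such constants commute with the diagonal matrix `M_∞` and play no role.

Monodromy. With `f` the Frobenius vector and `g` the rescaled vector at infinity, `f = P g` below
the real axis and `f = m₀ P M_∞⁻¹ g` above it, outside the disc (`exists_infVector`). Each loop is
cut into arcs on which one of these descriptions is valid, and the germs are glued.

Explicit matrices. Gauss' multiplication theorem turns the Gamma factors into `Γ(1+ε)^(n+1) /
Γ(1+(n+1)ε)`, whose logarithm has zeta values as Taylor coefficients (`connectionSeries_eq`). The
column for `ω = e^(2πiρ_k)` then satisfies a recursion with polynomial dependence on `u = 1/(1-ω)`,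
and the claimed `m_∞` is checked from the single relation `u^(n+1) = (u-1)^(n+1)`.

The period is computed separately: expand `1/f` geometrically on the torus and integrate one
variable at a time (`torusIntegral_residue`). -/

noncomputable section

namespace FermatMirror

open Filter MeasureTheory

/-! ### Taylor series in `ε` as elements of a power series ring. -/

/-- The Taylor series at `0` of a function of one complex variable. -/
def jet (f : ℂ → ℂ) : PowerSeries ℂ :=
  PowerSeries.mk fun i => iteratedDeriv i f 0 / (i.factorial : ℂ)

lemma coeff_jet (f : ℂ → ℂ) (i : ℕ) :
    PowerSeries.coeff i (jet f) = iteratedDeriv i f 0 / (i.factorial : ℂ) := by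
  simp [jet]

lemma jet_congr {f g : ℂ → ℂ} (h : f =ᶠ[𝓝 0] g) : jet f = jet g := by
  ext i
  rw [coeff_jet, coeff_jet, h.iteratedDeriv_eq]

/-- Leibniz' rule divided by `i!`. Multiplicativity lets identities between functions near `0` be
used in the ring of power series, where inverses and truncation are available. -/
lemma jet_mul {f g : ℂ → ℂ} (hf : AnalyticAt ℂ f 0) (hg : AnalyticAt ℂ g 0) :
    jet (fun z => f z * g z) = jet f * jet g := by
  ext i
  rw [PowerSeries.coeff_mul, coeff_jet, iteratedDeriv_fun_mul hf.contDiffAt hg.contDiffAt,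
    Finset.Nat.sum_antidiagonal_eq_sum_range_succ_mk, Finset.sum_div]
  refine Finset.sum_congr rfl fun j hj => ?_
  have hj' : j ≤ i := Nat.lt_succ_iff.mp (Finset.mem_range.mp hj)
  simp only [coeff_jet]
  rw [Nat.cast_choose ℂ hj']
  have h1 : (i.factorial : ℂ) ≠ 0 := by exact_mod_cast i.factorial_ne_zero
  have h2 : (j.factorial : ℂ) ≠ 0 := by exact_mod_cast j.factorial_ne_zero
  have h3 : ((i - j).factorial : ℂ) ≠ 0 := by exact_mod_cast (i - j).factorial_ne_zero
  field_simp

lemma jet_const (c : ℂ) : jet (fun _ => c) = PowerSeries.C c := by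
  ext i
  rw [coeff_jet, iteratedDeriv_const, PowerSeries.coeff_C]
  split_ifs with h <;> simp [h]

lemma jet_one : jet (fun _ => 1) = 1 := by
  rw [jet_const, map_one]

lemma jet_prod {ι : Type*} (s : Finset ι) {f : ι → ℂ → ℂ} (hf : ∀ i ∈ s, AnalyticAt ℂ (f i) 0) :
    jet (fun z => ∏ i ∈ s, f i z) = ∏ i ∈ s, jet (f i) := by
  classical
  induction s using Finset.induction_on with
  | empty => simpa using jet_one
  | insert a s ha ih =>
    simp only [Finset.prod_insert ha]
    rw [jet_mul (hf a (by simp)) (Finset.analyticAt_fun_prod s fun i hi => hf i (by simp [hi])),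
      ih fun i hi => hf i (by simp [hi])]

lemma jet_pow {f : ℂ → ℂ} (hf : AnalyticAt ℂ f 0) (k : ℕ) :
    jet (fun z => f z ^ k) = jet f ^ k := by
  have := jet_prod (Finset.range k) (f := fun _ => f) (fun _ _ => hf)
  simpa using this

lemma jet_const_add_id (c : ℂ) : jet (fun z => c + z) = PowerSeries.C c + PowerSeries.X := by
  ext i
  rw [coeff_jet]
  rcases i with _ | _ | i
  · simp
  · simp [iteratedDeriv_succ]
  · have : deriv (fun z : ℂ => c + z) = fun _ => 1 := by ext z; simp
    rw [iteratedDeriv_succ', this, iteratedDeriv_const]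
    simp [PowerSeries.coeff_X]

/-- Uniqueness of the power series of an analytic function. It computes the jets of parameter
integrals and of `log Γ` from convergent expansions. -/
lemma hasSum_analyticAt_jet {f : ℂ → ℂ} {a : ℕ → ℂ} {r : ℝ} (hr : 0 < r)
    (h : ∀ z : ℂ, ‖z‖ < r → HasSum (fun i => a i * z ^ i) (f z)) :
    AnalyticAt ℂ f 0 ∧ jet f = PowerSeries.mk a := by
  have hp : HasFPowerSeriesOnBall f (FormalMultilinearSeries.ofScalars ℂ a) 0
      (ENNReal.ofReal r) := by
    refine ⟨?_, by simpa using hr, ?_⟩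
    · refine ENNReal.le_of_forall_nnreal_lt fun s hs => ?_
      have hs' : (s : ℝ) < r := by
        rw [← ENNReal.ofReal_coe_nnreal] at hs
        exact (ENNReal.ofReal_lt_ofReal_iff hr).mp hs
      have hsum := (h (s : ℂ) (by simpa using hs')).summable.norm
      refine FormalMultilinearSeries.le_radius_of_summable_norm _ ?_
      refine hsum.congr fun i => ?_
      simp
    · intro y hy
      have hy' : ‖y‖ < r := by
        simpa [Metric.eball_ofReal, edist_zero_right] using hy
      have := h y hy'
      simpa [FormalMultilinearSeries.ofScalars_apply_eq, smul_eq_mul, mul_comm] using this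
  refine ⟨hp.analyticAt, ?_⟩
  ext i
  rw [coeff_jet, PowerSeries.coeff_mk]
  have h2 := hp.hasFPowerSeriesAt.eq_formalMultilinearSeries hp.analyticAt.hasFPowerSeriesAt
  have h3 := congrArg (fun q => FormalMultilinearSeries.coeff q i) h2
  simpa [FormalMultilinearSeries.coeff_ofScalars] using h3.symm

/-- The power series of `ε ↦ exp (c ε)`. -/
def expSeries (c : ℂ) : PowerSeries ℂ := PowerSeries.rescale c (PowerSeries.exp ℂ)

lemma coeff_expSeries (c : ℂ) (i : ℕ) :
    PowerSeries.coeff i (expSeries c) = c ^ i / (i.factorial : ℂ) := by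
  simp [expSeries, PowerSeries.coeff_exp, div_eq_mul_inv]

lemma jet_exp (c : ℂ) : jet (fun z => Complex.exp (c * z)) = expSeries c := by
  ext i
  rw [coeff_jet, coeff_expSeries, iteratedDeriv_cexp_const_mul]
  simp

lemma expSeries_add (a b : ℂ) : expSeries (a + b) = expSeries a * expSeries b := by
  rw [← jet_exp, ← jet_exp, ← jet_exp, ← jet_mul (by fun_prop) (by fun_prop)]
  congr 1; ext z; rw [← Complex.exp_add]; ring_nf

lemma expSeries_zero : expSeries 0 = 1 := by
  rw [← jet_exp, ← jet_one]; simp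

lemma constantCoeff_expSeries (c : ℂ) : PowerSeries.constantCoeff (expSeries c) = 1 := by
  rw [← PowerSeries.coeff_zero_eq_constantCoeff_apply, coeff_expSeries]; simp

/-! ### The law of a product of independent beta variables -/

lemma betaMeasure_ae_mem_Ioo (α β : ℝ) :
    ∀ᵐ x ∂ProbabilityTheory.betaMeasure α β, x ∈ Set.Ioo (0 : ℝ) 1 := by
  rw [ProbabilityTheory.betaMeasure, ae_withDensity_iff (by
    unfold ProbabilityTheory.betaPDF; fun_prop)]
  refine Eventually.of_forall fun x hx => ?_
  by_contra h
  refine hx ?_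
  rw [ProbabilityTheory.betaPDF_eq, if_neg (show ¬(0 < x ∧ x < 1) from h), ENNReal.ofReal_zero]

/-- Euler's beta integral. With `β = 1 - α` the parameters add up to `1`, so the normalisation is
`Γ(α) Γ(1-α)` and the factor `Γ(1-α)` cancels. Powers are written `exp (s log x)` because they are
expanded in `s` later. -/
lemma betaMeasure_moment {α : ℝ} (h0 : 0 < α) (h1 : α < 1) {s : ℂ} (hs : -α < s.re) :
    Integrable (fun x : ℝ => Complex.exp (s * Real.log x))
        (ProbabilityTheory.betaMeasure α (1 - α)) ∧
      ∫ x : ℝ, Complex.exp (s * Real.log x) ∂ProbabilityTheory.betaMeasure α (1 - α) =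
        Complex.Gamma (α + s) / (Complex.Gamma α * Complex.Gamma (1 + s)) := by
  have hmeas : Measurable (ProbabilityTheory.betaPDF α (1 - α)) := by
    unfold ProbabilityTheory.betaPDF; fun_prop
  have hfin : ∀ᵐ x : ℝ, ProbabilityTheory.betaPDF α (1 - α) x < ⊤ :=
    Eventually.of_forall fun x => ENNReal.ofReal_lt_top
  have h1α : 0 < 1 - α := by linarith
  have hβ : 0 < ProbabilityTheory.beta α (1 - α) := ProbabilityTheory.beta_pos h0 h1α
  set g : ℝ → ℂ := fun x => ((ProbabilityTheory.beta α (1 - α))⁻¹ : ℝ) *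
    ((x : ℂ) ^ ((α + s) - 1) * (1 - (x : ℂ)) ^ (((1 - α : ℝ) : ℂ) - 1)) with hg
  have hfun : (fun x : ℝ => (ProbabilityTheory.betaPDF α (1 - α) x).toReal •
      Complex.exp (s * Real.log x)) = (Set.Ioo (0 : ℝ) 1).indicator g := by
    funext x
    by_cases hx : x ∈ Set.Ioo (0 : ℝ) 1
    · have hx0 : (x : ℂ) ≠ 0 := by exact_mod_cast hx.1.ne'
      rw [Set.indicator_of_mem hx, ProbabilityTheory.betaPDF_of_pos_lt_one hx.1 hx.2,
        ENNReal.toReal_ofReal, hg]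
      · simp only [Complex.real_smul]
        have e1 : (x : ℂ) ^ ((α + s) - 1) = ((x ^ (α - 1) : ℝ) : ℂ) *
            Complex.exp (s * Real.log x) := by
          rw [show (α : ℂ) + s - 1 = ((α - 1 : ℝ) : ℂ) + s by push_cast; ring,
            Complex.cpow_add _ _ hx0, ← Complex.ofReal_cpow hx.1.le,
            Complex.cpow_def_of_ne_zero hx0 s, ← Complex.ofReal_log hx.1.le, mul_comm s]
        have e2 : (1 - (x : ℂ)) ^ (((1 - α : ℝ) : ℂ) - 1) =
            (((1 - x) ^ (1 - α - 1) : ℝ) : ℂ) := by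
          rw [Complex.ofReal_cpow (by linarith [hx.2])]; push_cast; ring_nf
        rw [e1, e2]
        push_cast
        ring
      · have := hx.1.le
        have := hx.2.le
        exact mul_nonneg (mul_nonneg (by positivity) (by positivity))
          (Real.rpow_nonneg (by linarith) _)
    · rw [Set.indicator_of_notMem hx, ProbabilityTheory.betaPDF_eq,
        if_neg (show ¬(0 < x ∧ x < 1) from hx)]
      simp
  have hre : 0 < ((α : ℂ) + s).re := by simp; linarith
  have hre' : 0 < ((1 - α : ℝ) : ℂ).re := by simp; linarith
  have hint : IntegrableOn g (Set.Ioo 0 1) := by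
    have := Complex.betaIntegral_convergent hre hre'
    rw [intervalIntegrable_iff_integrableOn_Ioo_of_le (by norm_num)] at this
    exact this.const_mul _
  rw [ProbabilityTheory.betaMeasure, integrable_withDensity_iff_integrable_smul' hmeas hfin,
    integral_withDensity_eq_integral_toReal_smul hmeas hfin, hfun]
  refine ⟨(integrable_indicator_iff measurableSet_Ioo).mpr hint, ?_⟩
  rw [integral_indicator measurableSet_Ioo, hg, integral_const_mul, ← integral_Ioc_eq_integral_Ioo,
    ← intervalIntegral.integral_of_le (by norm_num)]
  change _ * Complex.betaIntegral (α + s) ((1 - α : ℝ) : ℂ) = _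
  rw [Complex.betaIntegral_eq_Gamma_mul_div _ _ hre hre', ProbabilityTheory.beta]
  have hΓ1 : Complex.Gamma α ≠ 0 := Complex.Gamma_ne_zero_of_re_pos (by simpa using h0)
  have hΓ2 : Complex.Gamma ((1 - α : ℝ) : ℂ) ≠ 0 := Complex.Gamma_ne_zero_of_re_pos hre'
  have hΓ3 : Complex.Gamma (1 + s) ≠ 0 :=
    Complex.Gamma_ne_zero_of_re_pos (by simp; linarith)
  have e3 : (α : ℂ) + s + ((1 - α : ℝ) : ℂ) = 1 + s := by push_cast; ring
  rw [e3]
  have e4 : α + (1 - α) = 1 := by ring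
  rw [e4, Real.Gamma_one, div_one, Complex.ofReal_inv, Complex.ofReal_mul,
    ← Complex.Gamma_ofReal, ← Complex.Gamma_ofReal]
  field_simp

/-- The real number `k / (n+1)`. -/
def rhoReal (n : ℕ) (k : Fin n) : ℝ := (((k : ℕ) : ℝ) + 1) / ((n : ℝ) + 1)

lemma rho_eq_ofReal (n : ℕ) (k : Fin n) : rho n k = (rhoReal n k : ℂ) := by
  simp [rho, rhoReal]

lemma rhoReal_pos (n : ℕ) (k : Fin n) : 0 < rhoReal n k := by unfold rhoReal; positivity

lemma rhoReal_lt_one (n : ℕ) (k : Fin n) : rhoReal n k < 1 := by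
  unfold rhoReal
  rw [div_lt_one (by positivity)]
  have : ((k : ℕ) : ℝ) < n := by exact_mod_cast k.2
  linarith

lemma le_rhoReal (n : ℕ) (k : Fin n) : 1 / ((n : ℝ) + 1) ≤ rhoReal n k := by
  unfold rhoReal
  gcongr
  simp

/-- The law of a product of independent variables with distributions `Beta (ρⱼ, 1 - ρⱼ)`. -/
def eulerMeasure (n : ℕ) : Measure ℝ :=
  (Measure.pi fun j : Fin n =>
    ProbabilityTheory.betaMeasure (rhoReal n j) (1 - rhoReal n j)).map fun x => ∏ j, x j

instance isProbabilityMeasure_beta_rho (n : ℕ) (j : Fin n) : IsProbabilityMeasure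
    (ProbabilityTheory.betaMeasure (rhoReal n j) (1 - rhoReal n j)) :=
  ProbabilityTheory.isProbabilityMeasureBeta (rhoReal_pos n j)
    (by linarith [rhoReal_lt_one n j])

lemma measurable_prodMap (n : ℕ) : Measurable fun x : Fin n → ℝ => ∏ j, x j := by fun_prop

instance isProbabilityMeasure_eulerMeasure (n : ℕ) : IsProbabilityMeasure (eulerMeasure n) :=
  Measure.isProbabilityMeasure_map (measurable_prodMap n).aemeasurable

lemma pi_ae_mem_Ioo (n : ℕ) : ∀ᵐ x ∂(Measure.pi fun j : Fin n =>
    ProbabilityTheory.betaMeasure (rhoReal n j) (1 - rhoReal n j)),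
    ∀ j, x j ∈ Set.Ioo (0 : ℝ) 1 := by
  rw [eventually_all]
  exact fun j => Measure.tendsto_eval_ae_ae.eventually (betaMeasure_ae_mem_Ioo _ _)

lemma eulerMeasure_ae_mem_Ioo {n : ℕ} (hn : n ≠ 0) :
    ∀ᵐ u ∂eulerMeasure n, u ∈ Set.Ioo (0 : ℝ) 1 := by
  refine (ae_map_iff (measurable_prodMap n).aemeasurable measurableSet_Ioo).mpr ?_
  filter_upwards [pi_ae_mem_Ioo n] with x hx
  refine ⟨Finset.prod_pos fun j _ => (hx j).1, ?_⟩
  -- For `n = 0` the empty product is `1`, which is not in the open interval.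
  have : Nonempty (Fin n) := ⟨⟨0, Nat.pos_of_ne_zero hn⟩⟩
  calc ∏ j, x j < ∏ _j : Fin n, (1 : ℝ) :=
        Finset.prod_lt_prod_of_nonempty (fun j _ => (hx j).1) (fun j _ => (hx j).2)
          Finset.univ_nonempty
    _ = 1 := by simp

/-- The moment `∫ u^s` of the Euler measure. -/
def moment (n : ℕ) (s : ℂ) : ℂ :=
  ∏ j, Complex.Gamma (rho n j + s) / (Complex.Gamma (rho n j) * Complex.Gamma (1 + s))

/-- By independence the expectation of a product of powers factors. The bound on `s` comes from the
smallest exponent `1/(n+1)`. -/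
lemma eulerMeasure_moment (n : ℕ) {s : ℂ} (hs : -(1 / ((n : ℝ) + 1)) < s.re) :
    Integrable (fun u : ℝ => Complex.exp (s * Real.log u)) (eulerMeasure n) ∧
      ∫ u : ℝ, Complex.exp (s * Real.log u) ∂eulerMeasure n = moment n s := by
  have hm : Measurable fun u : ℝ => Complex.exp (s * Real.log u) := by fun_prop
  have hb := fun j : Fin n => betaMeasure_moment (rhoReal_pos n j) (rhoReal_lt_one n j) (s := s)
    (by linarith [le_rhoReal n j])
  have hae : (fun x : Fin n → ℝ => ∏ j, Complex.exp (s * Real.log (x j))) =ᵐ[Measure.pi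
      fun j : Fin n => ProbabilityTheory.betaMeasure (rhoReal n j) (1 - rhoReal n j)]
      fun x => Complex.exp (s * Real.log (∏ j, x j)) := by
    filter_upwards [pi_ae_mem_Ioo n] with x hx
    rw [Real.log_prod fun j _ => (hx j).1.ne', ← Complex.exp_sum]
    push_cast
    rw [Finset.mul_sum]
  rw [eulerMeasure, integrable_map_measure hm.aestronglyMeasurable
    (measurable_prodMap n).aemeasurable, integral_map (measurable_prodMap n).aemeasurable
    hm.aestronglyMeasurable]
  refine ⟨(Integrable.fintype_prod fun j => (hb j).1).congr hae, ?_⟩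
  rw [← integral_congr_ae hae, integral_fintype_prod_eq_prod
    (fun (_ : Fin n) (y : ℝ) => Complex.exp (s * Real.log y)), moment]
  exact Finset.prod_congr rfl fun j _ => by rw [(hb j).2, rho_eq_ofReal]

/-! ### Logarithmic moments -/

/-- The function `(log u)^i / i!`. -/
def logPow (i : ℕ) (u : ℝ) : ℂ := (Real.log u : ℂ) ^ i / (i.factorial : ℂ)

lemma measurable_logPow (i : ℕ) : Measurable (logPow i) := by unfold logPow; fun_prop

/-- A radius for which `u^(-r)` is integrable. -/
def expRadius (n : ℕ) : ℝ := 1 / (2 * ((n : ℝ) + 1))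

lemma expRadius_pos (n : ℕ) : 0 < expRadius n := by unfold expRadius; positivity

/-- The moment `∫ u^(-r)`. -/
def negMoment (n : ℕ) : ℝ := ∫ u : ℝ, Real.exp (-expRadius n * Real.log u) ∂eulerMeasure n

lemma integrable_negMoment (n : ℕ) :
    Integrable (fun u : ℝ => Real.exp (-expRadius n * Real.log u)) (eulerMeasure n) := by
  have h : -(1 / ((n : ℝ) + 1)) < ((-expRadius n : ℝ) : ℂ).re := by
    rw [Complex.ofReal_re, neg_lt_neg_iff, expRadius]
    apply one_div_lt_one_div_of_lt <;> [positivity; skip]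
    have : (0 : ℝ) ≤ n := by positivity
    linarith
  refine (eulerMeasure_moment n h).1.norm.congr (Eventually.of_forall fun u => ?_)
  simp [Complex.norm_exp]

/-- This is `x^i / i! ≤ e^x` at `x = r |log u|`. The loss `r^(-i)` is what makes the expansions in
`ε` converge for `|ε| < r`. -/
lemma norm_logPow_le (n i : ℕ) {u : ℝ} (hu : u ∈ Set.Ioo (0 : ℝ) 1) :
    ‖logPow i u‖ ≤ (expRadius n)⁻¹ ^ i * Real.exp (-expRadius n * Real.log u) := by
  have hr := expRadius_pos n
  have hl : Real.log u ≤ 0 := Real.log_nonpos hu.1.le hu.2.le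
  have := Real.pow_div_factorial_le_exp (-expRadius n * Real.log u)
    (by nlinarith) i
  rw [logPow, norm_div, norm_pow, Complex.norm_natCast, Complex.norm_real, Real.norm_eq_abs,
    abs_of_nonpos hl]
  calc (-Real.log u) ^ i / (i.factorial : ℝ)
      = (expRadius n)⁻¹ ^ i * ((-expRadius n * Real.log u) ^ i / (i.factorial : ℝ)) := by
        rw [show -expRadius n * Real.log u = expRadius n * (-Real.log u) by ring, mul_pow,
          inv_pow]
        field_simp
    _ ≤ _ := by gcongr

lemma integrable_logPow_mul {n : ℕ} (hn : n ≠ 0) (i : ℕ) {q : ℝ → ℂ} {B : ℝ}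
    (hq : AEStronglyMeasurable q (eulerMeasure n)) (hB : ∀ u ∈ Set.Ioo (0 : ℝ) 1, ‖q u‖ ≤ B) :
    Integrable (fun u => logPow i u * q u) (eulerMeasure n) := by
  refine Integrable.mono' (((integrable_negMoment n).const_mul ((expRadius n)⁻¹ ^ i)).mul_const B)
    ((measurable_logPow i).aestronglyMeasurable.mul hq) ?_
  filter_upwards [eulerMeasure_ae_mem_Ioo hn] with u hu
  rw [norm_mul]
  have := expRadius_pos n
  exact mul_le_mul (norm_logPow_le n i hu) (hB u hu) (norm_nonneg _) (by positivity)

lemma integral_norm_logPow_mul_le {n : ℕ} (hn : n ≠ 0) (i : ℕ) {q : ℝ → ℂ} {B : ℝ}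
    (hq : AEStronglyMeasurable q (eulerMeasure n)) (hB : ∀ u ∈ Set.Ioo (0 : ℝ) 1, ‖q u‖ ≤ B) :
    ∫ u, ‖logPow i u * q u‖ ∂eulerMeasure n ≤ (expRadius n)⁻¹ ^ i * negMoment n * B := by
  rw [negMoment, ← integral_const_mul, ← integral_mul_const]
  refine integral_mono_ae (integrable_logPow_mul hn i hq hB).norm
    (((integrable_negMoment n).const_mul ((expRadius n)⁻¹ ^ i)).mul_const B) ?_
  filter_upwards [eulerMeasure_ae_mem_Ioo hn] with u hu
  rw [norm_mul]
  have := expRadius_pos n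
  exact mul_le_mul (norm_logPow_le n i hu) (hB u hu) (norm_nonneg _) (by positivity)

lemma hasSum_integral_exp_mul {n : ℕ} (hn : n ≠ 0) {q : ℝ → ℂ} {B : ℝ}
    (hq : AEStronglyMeasurable q (eulerMeasure n)) (hB : ∀ u ∈ Set.Ioo (0 : ℝ) 1, ‖q u‖ ≤ B)
    {z : ℂ} (hz : ‖z‖ < expRadius n) :
    HasSum (fun i => (∫ u, logPow i u * q u ∂eulerMeasure n) * z ^ i)
      (∫ u : ℝ, Complex.exp (z * Real.log u) * q u ∂eulerMeasure n) := by
  have hr := expRadius_pos n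
  have h1 := hasSum_integral_of_summable_integral_norm (μ := eulerMeasure n)
    (F := fun i u => logPow i u * q u * z ^ i)
    (fun i => (integrable_logPow_mul hn i hq hB).mul_const _) (by
      have hg : Summable fun i : ℕ => negMoment n * B * (‖z‖ * (expRadius n)⁻¹) ^ i := by
        refine (summable_geometric_of_lt_one (by positivity) ?_).mul_left _
        rw [← div_eq_mul_inv, div_lt_one hr]
        exact hz
      refine hg.of_nonneg_of_le (fun i => integral_nonneg fun u => norm_nonneg _) fun i => ?_
      simp_rw [norm_mul _ (z ^ i)]
      rw [integral_mul_const, norm_pow, mul_pow]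
      calc _ ≤ (expRadius n)⁻¹ ^ i * negMoment n * B * ‖z‖ ^ i :=
            mul_le_mul_of_nonneg_right (integral_norm_logPow_mul_le hn i hq hB) (by positivity)
        _ = _ := by ring)
  simp_rw [integral_mul_const] at h1
  suffices h5 : ∀ u : ℝ, Complex.exp (z * Real.log u) * q u =
      ∑' i : ℕ, logPow i u * q u * z ^ i by
    simpa only [h5] using h1
  intro u
  have h2 : HasSum (fun i : ℕ => (z * Real.log u) ^ i / (i.factorial : ℂ))
      (Complex.exp (z * Real.log u)) := by
    rw [Complex.exp_eq_exp_ℂ]; exact NormedSpace.expSeries_div_hasSum_exp _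
  have h3 := h2.mul_right (q u)
  rw [← h3.tsum_eq]
  refine tsum_congr fun i => ?_
  rw [logPow, mul_pow]; ring

lemma jet_integral_exp_mul {n : ℕ} (hn : n ≠ 0) {q : ℝ → ℂ} {B : ℝ}
    (hq : AEStronglyMeasurable q (eulerMeasure n)) (hB : ∀ u ∈ Set.Ioo (0 : ℝ) 1, ‖q u‖ ≤ B) :
    AnalyticAt ℂ (fun z : ℂ => ∫ u : ℝ, Complex.exp (z * Real.log u) * q u ∂eulerMeasure n) 0 ∧
      jet (fun z : ℂ => ∫ u : ℝ, Complex.exp (z * Real.log u) * q u ∂eulerMeasure n) =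
        PowerSeries.mk fun i => ∫ u, logPow i u * q u ∂eulerMeasure n :=
  hasSum_analyticAt_jet (expRadius_pos n) fun _ hz => hasSum_integral_exp_mul hn hq hB hz

/-! ### Integrals depending holomorphically on a parameter -/

/-- For holomorphic integrands it suffices to dominate the integrand itself: Cauchy's estimate then
dominates the derivative. -/
lemma differentiableOn_integral_of_dominated {α : Type*} [MeasurableSpace α] {μ : Measure α}
    {U : Set ℂ} {F : ℂ → α → ℂ}
    (hmeas : ∀ z ∈ U, AEStronglyMeasurable (F z) μ)
    (hdiff : ∀ᵐ u ∂μ, DifferentiableOn ℂ (fun z => F z u) U)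
    (hbound : ∀ z₀ ∈ U, ∃ δ > 0, Metric.ball z₀ δ ⊆ U ∧ ∃ g : α → ℝ, Integrable g μ ∧
      ∀ᵐ u ∂μ, ∀ z ∈ Metric.ball z₀ δ, ‖F z u‖ ≤ g u) :
    DifferentiableOn ℂ (fun z => ∫ u, F z u ∂μ) U := by
  intro z₀ hz₀
  obtain ⟨δ, hδ, hsub, g, hg, hle⟩ := hbound z₀ hz₀
  have hδ2 : 0 < δ / 2 := half_pos hδ
  -- Centres within `δ/2` leave room for circles of radius `δ/4`, on which Cauchy's estimate bounds
  -- the derivative by `g / (δ/4)`.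
  have hball : ∀ z ∈ Metric.ball z₀ (δ / 2), Metric.closedBall z (δ / 4) ⊆ Metric.ball z₀ δ := by
    intro z hz w hw
    rw [Metric.mem_ball] at hz ⊢
    rw [Metric.mem_closedBall] at hw
    linarith [dist_triangle w z z₀]
  have hda : ∀ᵐ u ∂μ, ∀ z ∈ Metric.ball z₀ (δ / 2),
      HasDerivAt (fun z => F z u) (deriv (fun z => F z u) z) z := by
    filter_upwards [hdiff] with u hu z hz
    refine ((hu.mono hsub).differentiableAt (Metric.isOpen_ball.mem_nhds ?_)).hasDerivAt
    exact hball z hz (Metric.mem_closedBall_self (by positivity))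
  have hmem : z₀ ∈ Metric.ball z₀ (δ / 2) := Metric.mem_ball_self hδ2
  refine (hasDerivAt_integral_of_dominated_loc_of_deriv_le (bound := fun u => g u / (δ / 4))
    (F' := fun z u => deriv (fun z => F z u) z) (Metric.ball_mem_nhds z₀ hδ2)
    ?_ ?_ ?_ ?_ (hg.div_const _) hda).2.differentiableAt.differentiableWithinAt
  · filter_upwards [Metric.ball_mem_nhds z₀ hδ] with z hz using hmeas z (hsub hz)
  · refine hg.mono' (hmeas z₀ hz₀) ?_
    filter_upwards [hle] with u hu using hu z₀ (Metric.mem_ball_self hδ)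
  -- The derivative is measurable in `u` as the limit of difference quotients along a sequence of
  -- steps tending to `0`.
  · set s : ℕ → ℂ := fun k => ((δ / 4 / ((k : ℝ) + 1) : ℝ) : ℂ) with hs
    have hs0 : Tendsto s atTop (𝓝 0) := by
      have h1 : Tendsto (fun k : ℕ => δ / 4 / ((k : ℝ) + 1)) atTop (𝓝 0) :=
        tendsto_const_nhds.div_atTop
          (tendsto_atTop_add_const_right _ _ tendsto_natCast_atTop_atTop)
      rw [hs, ← Complex.ofReal_zero]
      exact (Complex.continuous_ofReal.tendsto 0).comp h1
    have hsne : ∀ k, s k ≠ 0 := fun k => by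
      rw [hs]; exact Complex.ofReal_ne_zero.mpr (by positivity)
    have hsle : ∀ k, z₀ + s k ∈ U := fun k => by
      refine hsub (hball z₀ hmem ?_)
      rw [Metric.mem_closedBall, dist_eq_norm, add_sub_cancel_left, hs, Complex.norm_real,
        Real.norm_of_nonneg (by positivity)]
      refine div_le_self (by positivity) ?_
      have : (0 : ℝ) ≤ k := by positivity
      linarith
    refine aestronglyMeasurable_of_tendsto_ae atTop
      (f := fun k u => (s k)⁻¹ • (F (z₀ + s k) u - F z₀ u)) (fun k =>
        ((hmeas _ (hsle k)).sub (hmeas z₀ hz₀)).const_smul (s k)⁻¹) ?_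
    filter_upwards [hda] with u hu
    refine (hu z₀ hmem).tendsto_slope_zero.comp (tendsto_nhdsWithin_iff.mpr ⟨hs0, ?_⟩)
    exact Eventually.of_forall hsne
  · filter_upwards [hle, hdiff] with u hu hdu z hz
    refine Complex.norm_deriv_le_of_forall_mem_sphere_norm_le (by positivity) ?_ ?_
    · refine DifferentiableOn.diffContOnCl_ball ((hdu.mono hsub).mono (hball z hz)) subset_rfl
    · exact fun w hw => hu w (hball z hz (Metric.sphere_subset_closedBall hw))

/-! ### The Stieltjes transforms of the Euler measure -/

/-- The domain `ℂ \ [1, ∞)`. -/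
def cutPlane : Set ℂ := {w | 1 - w ∈ Complex.slitPlane}

lemma isOpen_cutPlane : IsOpen cutPlane :=
  Complex.isOpen_slitPlane.preimage (by fun_prop)

lemma mem_cutPlane_of_norm_lt {w : ℂ} (hw : ‖w‖ < 1) : w ∈ cutPlane := by
  refine Complex.mem_slitPlane_iff.mpr (Or.inl ?_)
  have := (Complex.abs_re_le_norm w).trans_lt hw
  rw [abs_lt] at this
  simp; linarith

lemma mem_cutPlane_of_im_ne_zero {w : ℂ} (hw : w.im ≠ 0) : w ∈ cutPlane :=
  Complex.mem_slitPlane_iff.mpr (Or.inr (by simpa using hw))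

/-- The slit plane is star-shaped about `1`, and `1 - w u` lies on the segment from `1` to `1 - w`.
-/
lemma one_sub_mul_ne_zero {w : ℂ} (hw : w ∈ cutPlane) {u : ℝ} (hu : u ∈ Set.Icc (0 : ℝ) 1) :
    1 - w * u ≠ 0 := by
  have h := Complex.starConvex_one_slitPlane hw (a := 1 - u) (b := u) (by linarith [hu.2]) hu.1
    (by ring)
  have e : (1 - u) • (1 : ℂ) + u • (1 - w) = 1 - w * u := by
    simp only [Complex.real_smul]; push_cast; ring
  rw [e] at h
  exact Complex.slitPlane_ne_zero h

/-- The integral `∫ (log u)^i / i! / (1 - w u)`. -/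
def psi (n i : ℕ) (w : ℂ) : ℂ := ∫ u : ℝ, logPow i u * (1 - w * u)⁻¹ ∂eulerMeasure n

/-- The generating series of `psi n i w` in `i`. -/
def psiSeries (n : ℕ) (w : ℂ) : PowerSeries ℂ := PowerSeries.mk fun i => psi n i w

/-- The Taylor series of `moment n (k + ε)` in `ε`. -/
def momentSeries (n k : ℕ) : PowerSeries ℂ :=
  PowerSeries.mk fun i => ∫ u : ℝ, logPow i u * (u : ℂ) ^ k ∂eulerMeasure n

lemma exists_bound_kernel {w₀ : ℂ} (hw : w₀ ∈ cutPlane) : ∃ δ > 0, Metric.ball w₀ δ ⊆ cutPlane ∧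
    ∃ B : ℝ, ∀ u ∈ Set.Icc (0 : ℝ) 1, ∀ w ∈ Metric.ball w₀ δ, ‖(1 - w * u)⁻¹‖ ≤ B := by
  obtain ⟨δ, hδ, hsub⟩ := Metric.nhds_basis_closedBall.mem_iff.mp
    (isOpen_cutPlane.mem_nhds hw)
  have hK : IsCompact (Metric.closedBall w₀ δ ×ˢ Set.Icc (0 : ℝ) 1) :=
    (isCompact_closedBall _ _).prod isCompact_Icc
  have hc : ContinuousOn (fun p : ℂ × ℝ => (1 - p.1 * p.2)⁻¹)
      (Metric.closedBall w₀ δ ×ˢ Set.Icc (0 : ℝ) 1) :=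
    ContinuousOn.inv₀ (by fun_prop) fun p hp => one_sub_mul_ne_zero (hsub hp.1) hp.2
  obtain ⟨B, hB⟩ := hK.exists_bound_of_continuousOn hc
  exact ⟨δ, hδ, Metric.ball_subset_closedBall.trans hsub, B, fun u hu w hw =>
    hB (w, u) ⟨Metric.ball_subset_closedBall hw, hu⟩⟩

lemma measurable_kernel (w : ℂ) : Measurable fun u : ℝ => (1 - w * u)⁻¹ := by fun_prop

lemma differentiableOn_psi {n : ℕ} (hn : n ≠ 0) (i : ℕ) :
    DifferentiableOn ℂ (psi n i) cutPlane := by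
  refine differentiableOn_integral_of_dominated (fun z _ =>
    ((measurable_logPow i).mul (measurable_kernel z)).aestronglyMeasurable) ?_ ?_
  · filter_upwards [eulerMeasure_ae_mem_Ioo hn] with u hu z hz
    have := one_sub_mul_ne_zero hz (Set.Ioo_subset_Icc_self hu)
    exact (DifferentiableAt.const_mul (DifferentiableAt.fun_inv
      (𝕜 := ℂ) (h := fun z : ℂ => 1 - z * u) (by fun_prop) this) _).differentiableWithinAt
  · intro w₀ hw₀
    obtain ⟨δ, hδ, hsub, B, hB⟩ := exists_bound_kernel hw₀
    refine ⟨δ, hδ, hsub, fun u => ‖logPow i u * (B : ℂ)‖,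
      (integrable_logPow_mul hn i (q := fun _ => (B : ℂ)) (B := |B|)
        aestronglyMeasurable_const (by simp)).norm, ?_⟩
    filter_upwards [eulerMeasure_ae_mem_Ioo hn] with u hu z hz
    rw [norm_mul, norm_mul]
    refine mul_le_mul_of_nonneg_left ?_ (norm_nonneg _)
    rw [Complex.norm_real]
    exact (hB u (Set.Ioo_subset_Icc_self hu) z hz).trans (le_abs_self B)

lemma hasSum_integral_geometric {n : ℕ} (hn : n ≠ 0) {p : ℝ → ℂ}
    (hp : Integrable p (eulerMeasure n)) {w : ℂ} (hw : ‖w‖ < 1) :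
    HasSum (fun k => (∫ u : ℝ, p u * (u : ℂ) ^ k ∂eulerMeasure n) * w ^ k)
      (∫ u : ℝ, p u * (1 - w * u)⁻¹ ∂eulerMeasure n) := by
  have hm : ∀ k : ℕ, Measurable fun u : ℝ => (u : ℂ) ^ k := fun k => by fun_prop
  have hle : ∀ k : ℕ, ∀ᵐ u : ℝ ∂eulerMeasure n, ‖p u * (u : ℂ) ^ k‖ ≤ ‖p u‖ := fun k => by
    filter_upwards [eulerMeasure_ae_mem_Ioo hn] with u hu
    rw [norm_mul, norm_pow, Complex.norm_real, Real.norm_of_nonneg hu.1.le]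
    exact mul_le_of_le_one_right (norm_nonneg _) (pow_le_one₀ hu.1.le hu.2.le)
  have hi : ∀ k : ℕ, Integrable (fun u : ℝ => p u * (u : ℂ) ^ k) (eulerMeasure n) := fun k =>
    hp.norm.mono' (hp.1.mul (hm k).aestronglyMeasurable) (hle k)
  have h1 := hasSum_integral_of_summable_integral_norm (μ := eulerMeasure n)
    (F := fun (k : ℕ) (u : ℝ) => p u * (u : ℂ) ^ k * w ^ k) (fun k => (hi k).mul_const _) (by
      have hg : Summable fun k : ℕ => (∫ u, ‖p u‖ ∂eulerMeasure n) * ‖w‖ ^ k :=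
        (summable_geometric_of_lt_one (norm_nonneg _) hw).mul_left _
      refine hg.of_nonneg_of_le (fun i => integral_nonneg fun u => norm_nonneg _) fun k => ?_
      simp_rw [norm_mul _ (w ^ k)]
      rw [integral_mul_const, norm_pow]
      exact mul_le_mul_of_nonneg_right (integral_mono_ae (hi k).norm hp.norm (hle k))
        (by positivity))
  simp_rw [integral_mul_const] at h1
  have h2 : ∫ u : ℝ, p u * (1 - w * u)⁻¹ ∂eulerMeasure n =
      ∫ u : ℝ, ∑' k : ℕ, p u * (u : ℂ) ^ k * w ^ k ∂eulerMeasure n := by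
    refine integral_congr_ae ?_
    filter_upwards [eulerMeasure_ae_mem_Ioo hn] with u hu
    have : ‖w * u‖ < 1 := by
      rw [norm_mul, Complex.norm_real, Real.norm_of_nonneg hu.1.le]
      nlinarith [norm_nonneg w, hu.1, hu.2]
    rw [← tsum_geometric_of_norm_lt_one this, ← tsum_mul_left]
    exact tsum_congr fun k => by rw [mul_pow]; ring
  rw [h2]; exact h1

lemma integrable_logPow {n : ℕ} (hn : n ≠ 0) (i : ℕ) : Integrable (logPow i) (eulerMeasure n) := by
  simpa using integrable_logPow_mul hn i (q := fun _ => 1) (B := 1)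
    aestronglyMeasurable_const (by simp)

lemma hasSum_psi {n : ℕ} (hn : n ≠ 0) (i : ℕ) {w : ℂ} (hw : ‖w‖ < 1) :
    HasSum (fun k => PowerSeries.coeff i (momentSeries n k) * w ^ k) (psi n i w) := by
  simpa [momentSeries, psi] using hasSum_integral_geometric hn (integrable_logPow hn i) hw

lemma norm_coeff_momentSeries_le {n : ℕ} (hn : n ≠ 0) (i k : ℕ) :
    ‖PowerSeries.coeff i (momentSeries n k)‖ ≤ (expRadius n)⁻¹ ^ i * negMoment n := by
  rw [momentSeries, PowerSeries.coeff_mk]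
  refine (norm_integral_le_integral_norm _).trans ?_
  have := integral_norm_logPow_mul_le hn i (q := fun u : ℝ => (u : ℂ) ^ k) (B := 1)
    (by fun_prop) (fun u hu => by
      rw [norm_pow, Complex.norm_real, Real.norm_of_nonneg hu.1.le]
      exact pow_le_one₀ hu.1.le hu.2.le)
  simpa using this

/-! ### The moments at `ε + k` and the integral form of the Frobenius generating function. -/

lemma re_gt_of_norm_lt {n k : ℕ} {z : ℂ} (hz : ‖z‖ < expRadius n) :
    -(1 / ((n : ℝ) + 1)) < (z + k).re := by
  have h1 := (Complex.abs_re_le_norm z).trans_lt hz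
  rw [abs_lt, expRadius] at h1
  have h2 : 1 / (2 * ((n : ℝ) + 1)) = 1 / ((n : ℝ) + 1) / 2 := by field_simp
  have h3 : (0 : ℝ) < 1 / ((n : ℝ) + 1) := by positivity
  have h4 : (0 : ℝ) ≤ k := by positivity
  simp only [Complex.add_re, Complex.natCast_re]
  linarith [h1.1]

lemma eventually_norm_lt_expRadius (n : ℕ) : ∀ᶠ z : ℂ in 𝓝 0, ‖z‖ < expRadius n := by
  filter_upwards [Metric.ball_mem_nhds (0 : ℂ) (expRadius_pos n)] with z hz
  simpa using hz

lemma integral_exp_mul_pow {n : ℕ} (hn : n ≠ 0) (k : ℕ) {z : ℂ} (hz : ‖z‖ < expRadius n) :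
    ∫ u : ℝ, Complex.exp (z * Real.log u) * (u : ℂ) ^ k ∂eulerMeasure n = moment n (z + k) := by
  rw [← (eulerMeasure_moment n (re_gt_of_norm_lt hz)).2]
  refine integral_congr_ae ?_
  filter_upwards [eulerMeasure_ae_mem_Ioo hn] with u hu
  rw [add_mul, Complex.exp_add, Complex.exp_nat_mul, ← Complex.ofReal_exp, Real.exp_log hu.1]

lemma analyticAt_jet_moment {n : ℕ} (hn : n ≠ 0) (k : ℕ) :
    AnalyticAt ℂ (fun z => moment n (z + k)) 0 ∧
      jet (fun z => moment n (z + k)) = momentSeries n k := by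
  have h := jet_integral_exp_mul hn (q := fun u : ℝ => (u : ℂ) ^ k) (B := 1)
    (by fun_prop) (fun u hu => by
      rw [norm_pow, Complex.norm_real, Real.norm_of_nonneg hu.1.le]
      exact pow_le_one₀ hu.1.le hu.2.le)
  have he : (fun z : ℂ => ∫ u : ℝ, Complex.exp (z * Real.log u) * (u : ℂ) ^ k ∂eulerMeasure n)
      =ᶠ[𝓝 0] fun z => moment n (z + k) := by
    filter_upwards [eventually_norm_lt_expRadius n] with z hz using integral_exp_mul_pow hn k hz
  exact ⟨h.1.congr he, (jet_congr he).symm.trans h.2⟩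

/-- The functional equation of `Γ` in each factor. This is the coefficient recursion of the
Picard-Fuchs equation, with the integer index replaced by `s`. -/
lemma moment_succ {n : ℕ} {s : ℂ} (hs : -(1 / ((n : ℝ) + 1)) < s.re) :
    (1 + s) ^ n * moment n (s + 1) = (∏ j, (rho n j + s)) * moment n s := by
  have h1 : (1 + s) ^ n = ∏ _j : Fin n, (1 + s) := by simp
  have h4 : 1 / ((n : ℝ) + 1) ≤ 1 := by
    rw [div_le_one (by positivity)]
    have : (0 : ℝ) ≤ n := by positivity
    linarith
  have h1s : 1 + s ≠ 0 := fun h => by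
    have := congrArg Complex.re h; simp at this; linarith
  have hΓ : Complex.Gamma (1 + s) ≠ 0 := Complex.Gamma_ne_zero_of_re_pos (by simp; linarith)
  rw [h1, moment, moment, ← Finset.prod_mul_distrib, ← Finset.prod_mul_distrib]
  refine Finset.prod_congr rfl fun j _ => ?_
  have h2 : rho n j + s ≠ 0 := fun h => by
    have := congrArg Complex.re h
    rw [rho_eq_ofReal] at this
    simp at this
    linarith [le_rhoReal n j]
  have h3 : Complex.Gamma (rho n j) ≠ 0 := by
    rw [rho_eq_ofReal]
    exact Complex.Gamma_ne_zero_of_re_pos (by simpa using rhoReal_pos n j)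
  rw [← add_assoc, Complex.Gamma_add_one _ h2, ← add_assoc, Complex.Gamma_add_one _ h1s]
  field_simp

lemma moment_ne_zero {n : ℕ} {s : ℂ} (hs : -(1 / ((n : ℝ) + 1)) < s.re) : moment n s ≠ 0 := by
  refine Finset.prod_ne_zero_iff.mpr fun j _ => ?_
  have h4 : 1 / ((n : ℝ) + 1) ≤ 1 := by
    rw [div_le_one (by positivity)]
    have : (0 : ℝ) ≤ n := by positivity
    linarith
  have := le_rhoReal n j
  rw [rho_eq_ofReal]
  refine div_ne_zero (Complex.Gamma_ne_zero_of_re_pos (by simp; linarith)) (mul_ne_zero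
    (Complex.Gamma_ne_zero_of_re_pos (by simpa using rhoReal_pos n j))
    (Complex.Gamma_ne_zero_of_re_pos (by simp; linarith)))

/-- The same recursion expanded in `ε`, so that it governs all logarithmic solutions together. -/
lemma momentSeries_succ {n : ℕ} (hn : n ≠ 0) (k : ℕ) :
    (PowerSeries.C ((k : ℂ) + 1) + PowerSeries.X) ^ n * momentSeries n (k + 1) =
      (∏ j, (PowerSeries.C (k + rho n j) + PowerSeries.X)) * momentSeries n k := by
  rw [← (analyticAt_jet_moment hn k).2, ← (analyticAt_jet_moment hn (k + 1)).2,
    ← jet_const_add_id, ← jet_pow (by fun_prop)]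
  simp_rw [← jet_const_add_id]
  rw [← jet_prod _ (fun j _ => by fun_prop),
    ← jet_mul (by fun_prop) (analyticAt_jet_moment hn (k + 1)).1,
    ← jet_mul (Finset.analyticAt_fun_prod _ fun j _ => by fun_prop)
      (analyticAt_jet_moment hn k).1]
  refine jet_congr ?_
  filter_upwards [eventually_norm_lt_expRadius n] with z hz
  have := moment_succ (re_gt_of_norm_lt (k := k) hz)
  push_cast
  rw [← add_assoc z, show (k : ℂ) + 1 + z = 1 + (z + k) by ring, this]
  congr 1
  exact Finset.prod_congr rfl fun j _ => by ring

lemma moment_zero (n : ℕ) : moment n 0 = 1 := by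
  refine Finset.prod_eq_one fun j _ => ?_
  have h3 : Complex.Gamma (rho n j) ≠ 0 := by
    rw [rho_eq_ofReal]
    exact Complex.Gamma_ne_zero_of_re_pos (by simpa using rhoReal_pos n j)
  simp [h3]

/-- The Taylor series of `∏ Γ(ρⱼ) Γ(1+ε) / Γ(ρⱼ+ε)`. -/
def normSeries (n : ℕ) : PowerSeries ℂ := jet fun z => (moment n z)⁻¹

lemma analyticAt_moment {n : ℕ} (hn : n ≠ 0) : AnalyticAt ℂ (moment n) 0 := by
  simpa using (analyticAt_jet_moment hn 0).1

lemma analyticAt_inv_moment {n : ℕ} (hn : n ≠ 0) : AnalyticAt ℂ (fun z => (moment n z)⁻¹) 0 :=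
  (analyticAt_moment hn).inv (by simp [moment_zero])

lemma constantCoeff_normSeries (n : ℕ) : PowerSeries.constantCoeff (normSeries n) = 1 := by
  rw [← PowerSeries.coeff_zero_eq_constantCoeff_apply, normSeries, coeff_jet]
  simp [moment_zero]

/-- Both sides satisfy the recursion of `moment_succ` in `k` and agree at `k = 0`. -/
lemma ascPochhammer_ratio {n : ℕ} (k : ℕ) {s : ℂ} (hs : -(1 / ((n : ℝ) + 1)) < s.re) :
    (∏ j, (ascPochhammer ℂ k).eval (rho n j + s)) / ((ascPochhammer ℂ k).eval (1 + s)) ^ n =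
      moment n (s + k) * (moment n s)⁻¹ := by
  induction k with
  | zero => simp [moment_ne_zero hs]
  | succ k ih =>
    have hk : -(1 / ((n : ℝ) + 1)) < (s + k).re := by
      have h4 : (0 : ℝ) ≤ k := by positivity
      simp only [Complex.add_re, Complex.natCast_re]; linarith
    have h4 : 1 / ((n : ℝ) + 1) ≤ 1 := by
      rw [div_le_one (by positivity)]
      have : (0 : ℝ) ≤ n := by positivity
      linarith
    have h1s : 1 + (s + k) ≠ 0 := fun h => by
      have := congrArg Complex.re h
      rw [Complex.add_re, Complex.one_re, Complex.zero_re] at this; linarith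
    simp only [ascPochhammer_succ_right, Polynomial.eval_mul, Polynomial.eval_add,
      Polynomial.eval_X, Polynomial.eval_natCast]
    have h5 := moment_succ hk
    rw [Finset.prod_mul_distrib, mul_pow, mul_div_mul_comm, ih]
    have h6 : moment n (s + (k + 1 : ℕ)) = (∏ j, (rho n j + (s + k))) * moment n (s + k) /
        (1 + (s + k)) ^ n := by
      rw [eq_div_iff (pow_ne_zero _ h1s), ← h5]; push_cast; rw [add_assoc s]; ring
    rw [h6]
    simp_rw [← add_assoc]
    ring

/-- The right side still makes sense when `C t` is merely off `[1, ∞)`; it is the analytic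
continuation of the series beyond its disc of convergence. -/
lemma frobeniusGen_eq {n : ℕ} (hn : n ≠ 0) {t z : ℂ} (ht : t ≠ 0) (htC : ‖(scale n : ℂ) * t‖ < 1)
    (hz : ‖z‖ < expRadius n) :
    frobeniusGen n z t = Complex.exp (Complex.log t * z) * ((moment n z)⁻¹ *
      ∫ u : ℝ, Complex.exp (z * Real.log u) * (1 - scale n * t * u)⁻¹ ∂eulerMeasure n) := by
  have hz0 : -(1 / ((n : ℝ) + 1)) < z.re := by simpa using re_gt_of_norm_lt (k := 0) hz
  have h := hasSum_integral_geometric hn (eulerMeasure_moment n hz0).1 htC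
  simp_rw [integral_exp_mul_pow hn _ hz] at h
  rw [frobeniusGen, Complex.cpow_def_of_ne_zero ht, ← h.tsum_eq]
  simp_rw [ascPochhammer_ratio _ hz0]
  rw [← tsum_mul_left (a := (moment n z)⁻¹)]
  congr 1
  exact tsum_congr fun k => by ring

/-- The generating series of the Frobenius basis, up to powers of `2 π i`. -/
def frobSeries (n : ℕ) (t : ℂ) : PowerSeries ℂ :=
  normSeries n * (expSeries (Complex.log t) * psiSeries n (scale n * t))

lemma scale_pos (n : ℕ) : 0 < scale n := by unfold scale; positivity

lemma norm_scale_mul_lt {n : ℕ} {t : ℂ} (ht : ‖t‖ < 1 / scale n) : ‖(scale n : ℂ) * t‖ < 1 := by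
  rw [norm_mul, Complex.norm_real, Real.norm_of_nonneg (scale_pos n).le]
  rwa [lt_div_iff₀ (scale_pos n), mul_comm] at ht

lemma jet_frobeniusGen {n : ℕ} (hn : n ≠ 0) {t : ℂ} (ht : t ≠ 0) (htC : ‖t‖ < 1 / scale n) :
    jet (fun z => frobeniusGen n z t) = frobSeries n t := by
  have hw := norm_scale_mul_lt htC
  obtain ⟨δ, hδ, -, B, hB⟩ := exists_bound_kernel (mem_cutPlane_of_norm_lt hw)
  have h := jet_integral_exp_mul hn (q := fun u : ℝ => (1 - scale n * t * u)⁻¹) (B := B)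
    (measurable_kernel _).aestronglyMeasurable
    (fun u hu => hB u (Set.Ioo_subset_Icc_self hu) _ (Metric.mem_ball_self hδ))
  have e : (fun z => frobeniusGen n z t) =ᶠ[𝓝 0] fun z =>
      Complex.exp (Complex.log t * z) * ((moment n z)⁻¹ *
      ∫ u : ℝ, Complex.exp (z * Real.log u) * (1 - scale n * t * u)⁻¹ ∂eulerMeasure n) := by
    filter_upwards [eventually_norm_lt_expRadius n] with z hz using frobeniusGen_eq hn ht hw hz
  rw [jet_congr e, jet_mul (by fun_prop) ((analyticAt_inv_moment hn).fun_mul h.1),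
    jet_mul (analyticAt_inv_moment hn) h.1, jet_exp, h.2, frobSeries, normSeries]
  rw [show psiSeries n (scale n * t) = PowerSeries.mk fun i =>
    ∫ u : ℝ, logPow i u * (1 - scale n * t * u)⁻¹ ∂eulerMeasure n from rfl]
  ring

lemma frobenius_eq {n : ℕ} (hn : n ≠ 0) (m : ℕ) {t : ℂ} (ht : t ≠ 0) (htC : ‖t‖ < 1 / scale n) :
    frobenius n m t = PowerSeries.coeff m (frobSeries n t) / twoPiI ^ m := by
  rw [← jet_frobeniusGen hn ht htC, coeff_jet, frobenius, div_div, mul_comm]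

/-! ### Logarithmic power series -/

/-- Coefficientwise differentiability of a family of power series. -/
def HasSeriesDerivAt (F : ℂ → PowerSeries ℂ) (F' : PowerSeries ℂ) (t : ℂ) : Prop :=
  ∀ m, HasDerivAt (fun s => PowerSeries.coeff m (F s)) (PowerSeries.coeff m F') t

lemma HasSeriesDerivAt.mul {F G : ℂ → PowerSeries ℂ} {F' G' : PowerSeries ℂ} {t : ℂ}
    (hF : HasSeriesDerivAt F F' t) (hG : HasSeriesDerivAt G G' t) :
    HasSeriesDerivAt (fun s => F s * G s) (F' * G t + F t * G') t := by
  intro m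
  simp only [PowerSeries.coeff_mul, map_add]
  rw [← Finset.sum_add_distrib]
  exact HasDerivAt.fun_sum fun p _ => (hF p.1).mul (hG p.2)

lemma hasSeriesDerivAt_C {f : ℂ → ℂ} {f' t : ℂ} (hf : HasDerivAt f f' t) :
    HasSeriesDerivAt (fun s => PowerSeries.C (f s)) (PowerSeries.C f') t := by
  intro m
  simp only [PowerSeries.coeff_C]
  split_ifs
  · exact hf
  · exact hasDerivAt_const _ _

lemma hasSeriesDerivAt_expSeries {L : ℂ → ℂ} {L' t : ℂ} (hL : HasDerivAt L L' t) :
    HasSeriesDerivAt (fun s => expSeries (L s))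
      (PowerSeries.C L' * (PowerSeries.X * expSeries (L t))) t := by
  intro m
  simp only [coeff_expSeries, PowerSeries.coeff_C_mul]
  rcases m with _ | m
  · simpa using hasDerivAt_const t (1 : ℂ)
  · rw [PowerSeries.coeff_succ_X_mul, coeff_expSeries]
    have h1 := (hL.fun_pow (m + 1)).div_const ((m + 1).factorial : ℂ)
    convert! h1 using 1
    have h2 : (m.factorial : ℂ) ≠ 0 := by exact_mod_cast m.factorial_ne_zero
    have h3 : (m : ℂ) + 1 ≠ 0 := by exact_mod_cast m.succ_ne_zero
    rw [Nat.factorial_succ]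
    push_cast
    field_simp

/-- The coefficients grow at most polynomially. -/
def PolyGrowth (d : ℕ → PowerSeries ℂ) : Prop :=
  ∀ i, ∃ (B : ℝ) (p : ℕ), ∀ k : ℕ, ‖PowerSeries.coeff i (d k)‖ ≤ B * ((k : ℝ) + 1) ^ p

/-- These linear factors are what `θ` produces, so the class of polynomially growing coefficients is
stable under the operators in the equation. -/
lemma PolyGrowth.mul_linear {d : ℕ → PowerSeries ℂ} (hd : PolyGrowth d) (a b : ℂ) :
    PolyGrowth fun k => (PowerSeries.C (a + b * k) + PowerSeries.X) * d k := by
  have key : ∀ i, ∃ (B : ℝ) (p : ℕ), ∀ k : ℕ,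
      ‖PowerSeries.coeff i (PowerSeries.C (a + b * k) * d k)‖ ≤ B * ((k : ℝ) + 1) ^ p := by
    intro i
    obtain ⟨B, p, h⟩ := hd i
    refine ⟨(‖a‖ + ‖b‖) * B, p + 1, fun k => ?_⟩
    rw [PowerSeries.coeff_C_mul, norm_mul, pow_succ]
    have h1 : ‖a + b * k‖ ≤ (‖a‖ + ‖b‖) * ((k : ℝ) + 1) := by
      refine (norm_add_le _ _).trans ?_
      rw [norm_mul, Complex.norm_natCast]
      nlinarith [norm_nonneg a, norm_nonneg b, (Nat.cast_nonneg k : (0 : ℝ) ≤ k),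
        mul_nonneg (norm_nonneg a) (Nat.cast_nonneg k : (0 : ℝ) ≤ k)]
    calc _ ≤ ((‖a‖ + ‖b‖) * ((k : ℝ) + 1)) * (B * ((k : ℝ) + 1) ^ p) :=
          mul_le_mul h1 (h k) (norm_nonneg _) ((norm_nonneg _).trans h1)
      _ = _ := by ring
  intro i
  obtain ⟨B₁, p₁, h₁⟩ := key i
  obtain ⟨B₂, p₂, h₂⟩ : ∃ (B : ℝ) (p : ℕ), ∀ k : ℕ,
      ‖PowerSeries.coeff i (PowerSeries.X * d k)‖ ≤ B * ((k : ℝ) + 1) ^ p := by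
    rcases i with _ | i
    · exact ⟨0, 0, fun k => by simp⟩
    · obtain ⟨B, p, h⟩ := hd i
      exact ⟨B, p, fun k => by rw [PowerSeries.coeff_succ_X_mul]; exact h k⟩
  refine ⟨|B₁| + |B₂|, p₁ + p₂, fun k => ?_⟩
  simp only [add_mul, map_add]
  have h0 : (1 : ℝ) ≤ (k : ℝ) + 1 := by simp
  have e1 : ((k : ℝ) + 1) ^ p₁ ≤ ((k : ℝ) + 1) ^ (p₁ + p₂) := pow_le_pow_right₀ h0 (by omega)
  have e2 : ((k : ℝ) + 1) ^ p₂ ≤ ((k : ℝ) + 1) ^ (p₁ + p₂) := pow_le_pow_right₀ h0 (by omega)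
  have e3 := h₁ k
  have e4 := h₂ k
  simp only [map_add, add_mul] at e3
  calc _ ≤ B₁ * ((k : ℝ) + 1) ^ p₁ + B₂ * ((k : ℝ) + 1) ^ p₂ :=
        (norm_add_le _ _).trans (add_le_add e3 e4)
    _ ≤ |B₁| * ((k : ℝ) + 1) ^ (p₁ + p₂) + |B₂| * ((k : ℝ) + 1) ^ (p₁ + p₂) := by
        refine add_le_add ?_ ?_
        · exact mul_le_mul (le_abs_self _) e1 (by positivity) (abs_nonneg _)
        · exact mul_le_mul (le_abs_self _) e2 (by positivity) (abs_nonneg _)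
    _ = _ := by ring

lemma PolyGrowth.list_prod {d : ℕ → PowerSeries ℂ} (hd : PolyGrowth d) (a b : ℂ) (l : List ℂ) :
    PolyGrowth fun k =>
      (l.map fun r => PowerSeries.C (a + b * k + r) + PowerSeries.X).prod * d k := by
  induction l with
  | nil => simpa using hd
  | cons r l ih =>
    have := ih.mul_linear (a + r) b
    refine fun i => ?_
    obtain ⟨B, p, h⟩ := this i
    refine ⟨B, p, fun k => ?_⟩
    have e : ((r :: l).map fun r => PowerSeries.C (a + b * k + r) + PowerSeries.X).prod * d k =
        (PowerSeries.C (a + r + b * k) + PowerSeries.X) *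
          ((l.map fun r => PowerSeries.C (a + b * k + r) + PowerSeries.X).prod * d k) := by
      rw [List.map_cons, List.prod_cons, mul_assoc, show a + b * k + r = a + r + b * k by ring]
    beta_reduce
    rw [e]
    exact h k

lemma summable_succ_pow_mul_geometric (p : ℕ) {x : ℝ} (h0 : 0 ≤ x) (h1 : x < 1) :
    Summable fun k : ℕ => ((k : ℝ) + 1) ^ p * x ^ k := by
  rcases eq_or_ne x 0 with rfl | hx
  · refine summable_of_ne_finset_zero (s := {0}) fun k hk => ?_
    simp only [Finset.mem_singleton] at hk
    simp [hk]
  · have h2 : Summable fun k : ℕ => (k : ℝ) ^ p * x ^ k :=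
      summable_pow_mul_geometric_of_norm_lt_one p (by rwa [Real.norm_of_nonneg h0])
    have h3 := ((summable_nat_add_iff 1).mpr h2).mul_right x⁻¹
    refine h3.congr fun k => ?_
    push_cast
    rw [pow_succ x k, mul_assoc, mul_assoc, mul_inv_cancel₀ hx, mul_one]

lemma PolyGrowth.summable {d : ℕ → PowerSeries ℂ} (hd : PolyGrowth d) (i : ℕ) {w : ℂ}
    (hw : ‖w‖ < 1) : Summable fun k => PowerSeries.coeff i (d k) * w ^ k := by
  obtain ⟨B, p, h⟩ := hd i
  have h1 : Summable fun k : ℕ => ((k : ℝ) + 1) ^ p * ‖w‖ ^ k :=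
    summable_succ_pow_mul_geometric p (norm_nonneg w) hw
  refine Summable.of_norm_bounded (h1.mul_left B) fun k => ?_
  rw [norm_mul, norm_pow, ← mul_assoc]
  exact mul_le_mul_of_nonneg_right (h k) (by positivity)

/-- The sum `∑ₖ dₖ wᵏ`, coefficientwise. -/
def evalSeries (d : ℕ → PowerSeries ℂ) (w : ℂ) : PowerSeries ℂ :=
  PowerSeries.mk fun i => ∑' k, PowerSeries.coeff i (d k) * w ^ k

lemma hasSum_evalSeries {d : ℕ → PowerSeries ℂ} (hd : PolyGrowth d) (i : ℕ) {w : ℂ}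
    (hw : ‖w‖ < 1) : HasSum (fun k => PowerSeries.coeff i (d k) * w ^ k)
      (PowerSeries.coeff i (evalSeries d w)) := by
  rw [evalSeries, PowerSeries.coeff_mk]
  exact (hd.summable i hw).hasSum

lemma hasDerivAt_evalSeries {d : ℕ → PowerSeries ℂ} (hd : PolyGrowth d) (i : ℕ) {w : ℂ}
    (hw : ‖w‖ < 1) :
    ∃ D : ℂ, HasDerivAt (fun z => PowerSeries.coeff i (evalSeries d z)) D w ∧
      HasSum (fun k : ℕ => (k : ℂ) * PowerSeries.coeff i (d k) * w ^ k) (w * D) := by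
  obtain ⟨r, hwr, hr1⟩ := exists_between hw
  have hr0 : 0 ≤ r := (norm_nonneg _).trans hwr.le
  have hU : IsOpen (Metric.ball (0 : ℂ) r) := Metric.isOpen_ball
  have hsum : Summable fun k => ‖PowerSeries.coeff i (d k)‖ * r ^ k := by
    have := (hd.summable i (w := (r : ℂ)) (by simpa [abs_of_nonneg hr0] using hr1)).norm
    refine this.congr fun k => ?_
    simp [abs_of_nonneg hr0]
  have hdf : ∀ k : ℕ, DifferentiableOn ℂ (fun z => PowerSeries.coeff i (d k) * z ^ k)
      (Metric.ball (0 : ℂ) r) := fun k => by fun_prop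
  have hle : ∀ (k : ℕ) (z : ℂ), z ∈ Metric.ball (0 : ℂ) r →
      ‖PowerSeries.coeff i (d k) * z ^ k‖ ≤ ‖PowerSeries.coeff i (d k)‖ * r ^ k := by
    intro k z hz
    rw [mem_ball_zero_iff] at hz
    rw [norm_mul, norm_pow]
    gcongr
  have hwm : w ∈ Metric.ball (0 : ℂ) r := by simpa using hwr
  have h1 := Complex.hasSum_deriv_of_summable_norm hsum hdf hU hle hwm
  have h2 := (Complex.differentiableOn_tsum_of_summable_norm hsum hdf hU hle).differentiableAt
    (hU.mem_nhds hwm)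
  refine ⟨_, ?_, (h1.mul_left w).congr_fun ?_⟩
  · simp only [evalSeries, PowerSeries.coeff_mk]
    exact h2.hasDerivAt
  · intro k
    have : deriv (fun z : ℂ => PowerSeries.coeff i (d k) * z ^ k) w =
        PowerSeries.coeff i (d k) * (k * w ^ (k - 1)) := by simp
    rw [this]
    rcases k with _ | k
    · simp
    · rw [Nat.add_sub_cancel, pow_succ]; ring

/-- The logarithmic power series `e^((α + X) L(t)) ∑ₖ dₖ w(t)ᵏ`. -/
def logSeries (α : ℂ) (L w : ℂ → ℂ) (d : ℕ → PowerSeries ℂ) (t : ℂ) : PowerSeries ℂ :=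
  PowerSeries.C (Complex.exp (α * L t)) * (expSeries (L t) * evalSeries d (w t))

/-- The data of a local logarithm and a local parameter on an open set. -/
structure IsLogChart (σ : ℂ) (L w : ℂ → ℂ) (U : Set ℂ) : Prop where
  isOpen : IsOpen U
  ne_zero : ∀ t ∈ U, t ≠ 0
  hasDerivAt_log : ∀ t ∈ U, HasDerivAt L t⁻¹ t
  hasDerivAt_param : ∀ t ∈ U, HasDerivAt w (σ * w t / t) t
  norm_lt : ∀ t ∈ U, ‖w t‖ < 1

/-- Since `θ L = 1` and `θ w = σ w`, the operator `θ` multiplies `e^((α+X)L) w^k` by `α + σ k + X`.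
Taking `σ = 1` at the origin and `σ = -1` at infinity, one calculus serves both points. -/
lemma IsLogChart.hasSeriesDerivAt {σ : ℂ} {L w : ℂ → ℂ} {U : Set ℂ} (h : IsLogChart σ L w U)
    (α : ℂ) {d : ℕ → PowerSeries ℂ} (hd : PolyGrowth d) {t : ℂ} (ht : t ∈ U) :
    HasSeriesDerivAt (logSeries α L w d) (PowerSeries.C t⁻¹ * logSeries α L w
      (fun k => (PowerSeries.C (α + σ * k) + PowerSeries.X) * d k) t) t := by
  have hw := h.norm_lt t ht
  have hmul := hd.mul_linear α σ
  have hE : HasSeriesDerivAt (fun s => evalSeries d (w s)) (PowerSeries.C t⁻¹ *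
      (evalSeries (fun k => (PowerSeries.C (α + σ * k) + PowerSeries.X) * d k) (w t) -
        (PowerSeries.C α + PowerSeries.X) * evalSeries d (w t))) t := by
    intro i
    obtain ⟨D, hD, hDs⟩ := hasDerivAt_evalSeries hd i hw
    have h1 := hD.comp t (h.hasDerivAt_param t ht)
    convert! h1 using 1
    have h2 := hasSum_evalSeries hmul i hw
    have h4 : HasSum (fun k => PowerSeries.coeff i ((PowerSeries.C α + PowerSeries.X) * d k) *
        w t ^ k) (PowerSeries.coeff i ((PowerSeries.C α + PowerSeries.X) *
          evalSeries d (w t))) := by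
      simp only [add_mul, map_add, PowerSeries.coeff_C_mul]
      refine HasSum.add ?_ ?_
      · simpa only [mul_assoc] using (hasSum_evalSeries hd i hw).mul_left α
      · rcases i with _ | i
        · simp
        · simpa only [PowerSeries.coeff_succ_X_mul] using hasSum_evalSeries hd i hw
    -- Removing the part `α + X`, which comes from the exponential prefactor, leaves `σ k`, the
    -- effect of `θ` on `w^k`.
    have h5 := (h2.sub h4).unique ((hDs.mul_left σ).congr_fun fun k => by
      simp only [add_mul, map_add, PowerSeries.coeff_C_mul]; ring)
    rw [PowerSeries.coeff_C_mul, map_sub, h5]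
    ring
  have hα : HasDerivAt (fun s => Complex.exp (α * L s))
      (Complex.exp (α * L t) * (α * t⁻¹)) t := ((h.hasDerivAt_log t ht).const_mul α).cexp
  have := (hasSeriesDerivAt_C hα).mul ((hasSeriesDerivAt_expSeries
    (h.hasDerivAt_log t ht)).mul hE)
  convert! this using 1
  simp only [logSeries, map_mul]
  ring

lemma IsLogChart.differentiableOn {σ : ℂ} {L w : ℂ → ℂ} {U : Set ℂ} (h : IsLogChart σ L w U)
    (α : ℂ) {d : ℕ → PowerSeries ℂ} (hd : PolyGrowth d) (m : ℕ) :
    DifferentiableOn ℂ (fun t => PowerSeries.coeff m (logSeries α L w d t)) U :=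
  fun _ ht => (h.hasSeriesDerivAt α hd ht m).differentiableAt.differentiableWithinAt

lemma IsLogChart.theta_eq {σ : ℂ} {L w : ℂ → ℂ} {U : Set ℂ} (h : IsLogChart σ L w U)
    (α : ℂ) {d : ℕ → PowerSeries ℂ} (hd : PolyGrowth d) (m : ℕ) {F : ℂ → ℂ}
    (hF : ∀ t ∈ U, F t = PowerSeries.coeff m (logSeries α L w d t)) :
    ∀ t ∈ U, theta F t = PowerSeries.coeff m (logSeries α L w
      (fun k => (PowerSeries.C (α + σ * k) + PowerSeries.X) * d k) t) := by
  intro t ht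
  have he : F =ᶠ[𝓝 t] fun t => PowerSeries.coeff m (logSeries α L w d t) := by
    filter_upwards [h.isOpen.mem_nhds ht] with s hs using hF s hs
  rw [theta, he.deriv_eq, (h.hasSeriesDerivAt α hd ht m).deriv, PowerSeries.coeff_C_mul,
    mul_inv_cancel_left₀ (h.ne_zero t ht)]

lemma IsLogChart.theta_iterate_eq {σ : ℂ} {L w : ℂ → ℂ} {U : Set ℂ} (h : IsLogChart σ L w U)
    (α : ℂ) {d : ℕ → PowerSeries ℂ} (hd : PolyGrowth d) (m r : ℕ) {F : ℂ → ℂ}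
    (hF : ∀ t ∈ U, F t = PowerSeries.coeff m (logSeries α L w d t)) :
    ∀ t ∈ U, theta^[r] F t = PowerSeries.coeff m (logSeries α L w
      (fun k => (PowerSeries.C (α + σ * k) + PowerSeries.X) ^ r * d k) t) := by
  induction r generalizing F d with
  | zero => simpa using hF
  | succ r ih =>
    intro t ht
    rw [Function.iterate_succ_apply, ih (hd.mul_linear α σ) (h.theta_eq α hd m hF) t ht]
    simp only [pow_succ, mul_assoc]

lemma logSeries_add {α : ℂ} {L w : ℂ → ℂ} {d e : ℕ → PowerSeries ℂ} {t : ℂ} (hw : ‖w t‖ < 1)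
    (hd : PolyGrowth d) (he : PolyGrowth e) :
    logSeries α L w (fun k => d k + e k) t = logSeries α L w d t + logSeries α L w e t := by
  have : evalSeries (fun k => d k + e k) (w t) = evalSeries d (w t) + evalSeries e (w t) := by
    ext i
    have h1 := (hasSum_evalSeries hd i hw).add (hasSum_evalSeries he i hw)
    rw [map_add, ← h1.tsum_eq, evalSeries, PowerSeries.coeff_mk]
    exact tsum_congr fun k => by rw [map_add, add_mul]
  rw [logSeries, this, logSeries, logSeries]; ring

lemma logSeries_C_mul {α : ℂ} {L w : ℂ → ℂ} {d : ℕ → PowerSeries ℂ} {t : ℂ} (c : ℂ) :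
    logSeries α L w (fun k => PowerSeries.C c * d k) t =
      PowerSeries.C c * logSeries α L w d t := by
  have : evalSeries (fun k => PowerSeries.C c * d k) (w t) =
      PowerSeries.C c * evalSeries d (w t) := by
    ext i
    simp only [evalSeries, PowerSeries.coeff_mk, PowerSeries.coeff_C_mul, ← tsum_mul_left,
      mul_assoc]
  rw [logSeries, this, logSeries]; ring

lemma PolyGrowth.C_mul {d : ℕ → PowerSeries ℂ} (hd : PolyGrowth d) (c : ℂ) :
    PolyGrowth fun k => PowerSeries.C c * d k := by
  intro i
  obtain ⟨B, p, h⟩ := hd i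
  refine ⟨‖c‖ * B, p, fun k => ?_⟩
  rw [PowerSeries.coeff_C_mul, norm_mul, mul_assoc]
  exact mul_le_mul_of_nonneg_left (h k) (norm_nonneg _)

lemma IsLogChart.thetaShift_eq {σ : ℂ} {L w : ℂ → ℂ} {U : Set ℂ} (h : IsLogChart σ L w U)
    (α : ℂ) {d : ℕ → PowerSeries ℂ} (hd : PolyGrowth d) (m : ℕ) (l : List ℂ) {F : ℂ → ℂ}
    (hF : ∀ t ∈ U, F t = PowerSeries.coeff m (logSeries α L w d t)) :
    ∀ t ∈ U, l.foldr (fun r G => fun t => theta G t + r * G t) F t =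
      PowerSeries.coeff m (logSeries α L w (fun k =>
        (l.map fun r => PowerSeries.C (α + σ * k + r) + PowerSeries.X).prod * d k) t) := by
  induction l with
  | nil => simpa using hF
  | cons r l ih =>
    intro t ht
    have hl := hd.list_prod α σ l
    rw [List.foldr_cons, h.theta_eq α hl m ih t ht, ih t ht, ← PowerSeries.coeff_C_mul, ← map_add,
      ← logSeries_C_mul, ← logSeries_add (h.norm_lt t ht) (hl.mul_linear α σ) (hl.C_mul r)]
    congr 2
    funext k
    rw [List.map_cons, List.prod_cons, map_add _ _ r]
    ring

/-- The prefactor `C t` is `w` at the origin and `w⁻¹` at infinity. It shifts one series by one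
index against the other, which turns the equation into a recursion. -/
lemma IsLogChart.picardFuchs_eq {σ : ℂ} {L w : ℂ → ℂ} {U : Set ℂ} (h : IsLogChart σ L w U)
    (α : ℂ) {d : ℕ → PowerSeries ℂ} (hd : PolyGrowth d) (n m : ℕ) {F : ℂ → ℂ}
    (hF : ∀ t ∈ U, F t = PowerSeries.coeff m (logSeries α L w d t)) {t : ℂ} (ht : t ∈ U) :
    picardFuchs n F t =
      PowerSeries.coeff m (logSeries α L w
        (fun k => (PowerSeries.C (α + σ * k) + PowerSeries.X) ^ n * d k) t) -
      scale n * t * PowerSeries.coeff m (logSeries α L w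
        (fun k => (∏ j, (PowerSeries.C (α + σ * k + rho n j) + PowerSeries.X)) * d k) t) := by
  rw [picardFuchs, h.theta_iterate_eq α hd m n hF t ht, thetaShiftProd,
    h.thetaShift_eq α hd m (List.ofFn (rho n)) hF t ht]
  simp only [List.map_ofFn, List.prod_ofFn, Function.comp_apply]

/-! ### Uniqueness for the Picard-Fuchs equation -/

/-- Near `t₁`, the function `F` is `(t - t₁)^N` times an analytic function with value `c`. -/
def HasLeadingTerm (t₁ : ℂ) (F : ℂ → ℂ) (N : ℕ) (c : ℂ) : Prop :=
  ∃ g : ℂ → ℂ, AnalyticAt ℂ g t₁ ∧ g t₁ = c ∧ ∀ᶠ t in 𝓝 t₁, F t = (t - t₁) ^ N * g t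

/-- The term `r F` vanishes to higher order than `θ F`, so the shift `r` does not affect the leading
coefficient. Hence `θⁿ` and `∏ (θ + ρⱼ)` have the same effect on leading terms. -/
lemma HasLeadingTerm.theta_add {t₁ : ℂ} {F : ℂ → ℂ} {N : ℕ} {c : ℂ}
    (h : HasLeadingTerm t₁ F (N + 1) c) (r : ℂ) :
    HasLeadingTerm t₁ (fun t => theta F t + r * F t) N (t₁ * ((N + 1) * c)) := by
  obtain ⟨g, hg, hc, hF⟩ := h
  refine ⟨fun t => t * ((N + 1) * g t + (t - t₁) * deriv g t) + r * ((t - t₁) * g t),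
    by have := hg.deriv; fun_prop, by simp [hc], ?_⟩
  filter_upwards [hF.eventually_nhds, hg.eventually_analyticAt] with t ht hgt
  have hd : HasDerivAt F ((((N + 1 : ℕ) : ℂ) * (t - t₁) ^ N) * g t +
      (t - t₁) ^ (N + 1) * deriv g t) t := by
    refine HasDerivAt.congr_of_eventuallyEq (f := fun t => (t - t₁) ^ (N + 1) * g t) ?_ ht
    have := (((hasDerivAt_id t).sub_const t₁).fun_pow (N + 1)).fun_mul
      hgt.differentiableAt.hasDerivAt
    simpa using this
  rw [theta, hd.deriv, ht.self_of_nhds]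
  push_cast
  ring

lemma HasLeadingTerm.theta {t₁ : ℂ} {F : ℂ → ℂ} {N : ℕ} {c : ℂ}
    (h : HasLeadingTerm t₁ F (N + 1) c) :
    HasLeadingTerm t₁ (theta F) N (t₁ * ((N + 1) * c)) := by
  simpa using h.theta_add 0

/-- The leading coefficient of `θʳ F` when that of `F` is `c`. -/
def leadingFactor (t₁ : ℂ) (N r : ℕ) (c : ℂ) : ℂ := t₁ ^ r * (∏ i ∈ Finset.range r, ((N + i + 1 : ℕ) : ℂ)) * c

lemma leadingFactor_succ (t₁ : ℂ) (N r : ℕ) (c : ℂ) :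
    leadingFactor t₁ N (r + 1) c = t₁ * ((N + 1) * leadingFactor t₁ (N + 1) r c) := by
  rw [leadingFactor, leadingFactor, Finset.prod_range_succ', pow_succ]
  have : ∀ i, N + (i + 1) + 1 = N + 1 + i + 1 := fun i => by ring
  simp only [this]
  push_cast
  ring

lemma leadingFactor_ne_zero {t₁ c : ℂ} (ht : t₁ ≠ 0) (hc : c ≠ 0) (N r : ℕ) :
    leadingFactor t₁ N r c ≠ 0 :=
  mul_ne_zero (mul_ne_zero (pow_ne_zero _ ht) (Finset.prod_ne_zero_iff.mpr fun i _ => by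
    exact_mod_cast (N + i).succ_ne_zero)) hc

lemma HasLeadingTerm.foldr {t₁ : ℂ} {F : ℂ → ℂ} {c : ℂ} (l : List ℂ) {N : ℕ}
    (h : HasLeadingTerm t₁ F (N + l.length) c) :
    HasLeadingTerm t₁ (l.foldr (fun r G => fun t => FermatMirror.theta G t + r * G t) F) N
      (leadingFactor t₁ N l.length c) := by
  induction l generalizing N with
  | nil => simpa [leadingFactor] using h
  | cons r l ih =>
    rw [List.foldr_cons, List.length_cons, leadingFactor_succ]
    refine (ih (N := N + 1) ?_).theta_add r
    rwa [add_assoc, add_comm 1, ← List.length_cons (a := r)]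

lemma HasLeadingTerm.iterate {t₁ : ℂ} {F : ℂ → ℂ} {c : ℂ} (r : ℕ) {N : ℕ}
    (h : HasLeadingTerm t₁ F (N + r) c) :
    HasLeadingTerm t₁ (FermatMirror.theta^[r] F) N (leadingFactor t₁ N r c) := by
  induction r generalizing N with
  | zero => simpa [leadingFactor] using h
  | succ r ih =>
    rw [Function.iterate_succ_apply', leadingFactor_succ]
    refine (ih (N := N + 1) ?_).theta
    rwa [add_assoc, add_comm 1]

lemma HasLeadingTerm.apply {t₁ : ℂ} {F : ℂ → ℂ} {c : ℂ} (h : HasLeadingTerm t₁ F 0 c) :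
    F t₁ = c := by
  obtain ⟨g, -, hc, hF⟩ := h
  simpa [hc] using hF.self_of_nhds

/-- A solution of the Picard-Fuchs equation with vanishing initial values vanishes. -/
theorem picardFuchs_unique {n : ℕ} {U : Set ℂ} (hU : IsOpen U) (hUc : IsPreconnected U)
    (h0 : ∀ t ∈ U, t ≠ 0) (hC : ∀ t ∈ U, (scale n : ℂ) * t ≠ 1) {F : ℂ → ℂ}
    (hF : DifferentiableOn ℂ F U) (hPF : ∀ t ∈ U, picardFuchs n F t = 0) {t₁ : ℂ} (ht₁ : t₁ ∈ U)
    (hinit : ∀ i < n, theta^[i] F t₁ = 0) : ∀ t ∈ U, F t = 0 := by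
  have han : AnalyticOnNhd ℂ F U := hF.analyticOnNhd hU
  have key : ∀ᶠ t in 𝓝 t₁, F t = 0 := by
    by_contra hne
    obtain ⟨N, g, hg, hgne, hFg⟩ :=
      ((han t₁ ht₁).exists_eventuallyEq_pow_smul_nonzero_iff).mpr hne
    have hV : HasLeadingTerm t₁ F N (g t₁) := ⟨g, hg, rfl, hFg⟩
    -- If the order `N` of the zero were less than `n`, then `θ^N F` would be nonzero at `t₁`,
    -- against the initial conditions.
    have hN : n ≤ N := by
      by_contra hlt
      have h1 := hinit N (by omega)
      have h2 := (HasLeadingTerm.iterate N (N := 0) (by simpa using hV)).apply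
      exact leadingFactor_ne_zero (h0 t₁ ht₁) hgne 0 N (h2.symm.trans h1)
    obtain ⟨K, rfl⟩ := Nat.exists_eq_add_of_le' hN
    have h3 : HasLeadingTerm t₁ (thetaShiftProd n F) K (leadingFactor t₁ K n (g t₁)) := by
      have := HasLeadingTerm.foldr (List.ofFn (rho n)) (N := K) (F := F) (c := g t₁) (t₁ := t₁)
        (by simpa using hV)
      simpa [thetaShiftProd] using this
    obtain ⟨g₁, hg₁, hc₁, e₁⟩ := HasLeadingTerm.iterate n hV
    obtain ⟨g₂, hg₂, hc₂, e₂⟩ := h3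
    -- The common factor `(t - t₁)^K` can be divided out only away from `t₁`; the value at `t₁` is
    -- recovered by continuity.
    have h4 : ∀ᶠ t in 𝓝[≠] t₁, g₁ t - scale n * t * g₂ t = 0 := by
      have hUm := hU.mem_nhds ht₁
      filter_upwards [nhdsWithin_le_nhds e₁, nhdsWithin_le_nhds e₂, nhdsWithin_le_nhds hUm,
        self_mem_nhdsWithin] with t h1 h2 hu hne
      have := hPF t hu
      rw [picardFuchs, h1, h2] at this
      have hp : (t - t₁) ^ K ≠ 0 := pow_ne_zero _ (sub_ne_zero.mpr hne)
      refine (mul_eq_zero.mp (?_ : (t - t₁) ^ K * _ = 0)).resolve_left hp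
      linear_combination this
    have h5 : g₁ t₁ - scale n * t₁ * g₂ t₁ = 0 := by
      have hc : Tendsto (fun t => g₁ t - scale n * t * g₂ t) (𝓝[≠] t₁)
          (𝓝 (g₁ t₁ - scale n * t₁ * g₂ t₁)) := by
        have h6 := hg₁.continuousAt
        have h7 := hg₂.continuousAt
        have : ContinuousAt (fun t => g₁ t - scale n * t * g₂ t) t₁ := by fun_prop
        exact this.tendsto.mono_left nhdsWithin_le_nhds
      exact tendsto_nhds_unique hc ((tendsto_congr' h4).mpr tendsto_const_nhds)
    rw [hc₁, hc₂] at h5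
    -- The factor `1 - C t₁` is the leading coefficient of the operator, up to a power of `t₁`; it
    -- vanishes only at the conifold point.
    have h6 : leadingFactor t₁ K n (g t₁) * (1 - scale n * t₁) = 0 := by linear_combination h5
    rcases mul_eq_zero.mp h6 with h7 | h7
    · exact leadingFactor_ne_zero (h0 t₁ ht₁) hgne _ _ h7
    · exact hC t₁ ht₁ (sub_eq_zero.mp h7).symm
  exact fun t ht => han.eqOn_zero_of_preconnected_of_eventuallyEq_zero hUc ht₁ key ht

/-! ### Linearity -/

lemma differentiableOn_theta {U : Set ℂ} (hU : IsOpen U) {F : ℂ → ℂ}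
    (hF : DifferentiableOn ℂ F U) : DifferentiableOn ℂ (theta F) U :=
  differentiableOn_id.mul (hF.deriv hU)

lemma theta_sum {ι : Type*} [Fintype ι] {U : Set ℂ} (hU : IsOpen U) {G : ι → ℂ → ℂ}
    (hG : ∀ i, DifferentiableOn ℂ (G i) U) (c : ι → ℂ) {F : ℂ → ℂ}
    (hF : ∀ t ∈ U, F t = ∑ i, c i * G i t) :
    ∀ t ∈ U, theta F t = ∑ i, c i * theta (G i) t := by
  intro t ht
  have he : F =ᶠ[𝓝 t] fun t => ∑ i, c i * G i t := by
    filter_upwards [hU.mem_nhds ht] with s hs using hF s hs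
  have hd : HasDerivAt (fun t => ∑ i, c i * G i t) (∑ i, c i * deriv (G i) t) t :=
    HasDerivAt.fun_sum fun i _ =>
      (((hG i).differentiableAt (hU.mem_nhds ht)).hasDerivAt).const_mul (c i)
  rw [theta, he.deriv_eq, hd.deriv, Finset.mul_sum]
  exact Finset.sum_congr rfl fun i _ => by rw [theta]; ring

lemma theta_iterate_sum {ι : Type*} [Fintype ι] {U : Set ℂ} (hU : IsOpen U) {G : ι → ℂ → ℂ}
    (hG : ∀ i, DifferentiableOn ℂ (G i) U) (c : ι → ℂ) {F : ℂ → ℂ}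
    (hF : ∀ t ∈ U, F t = ∑ i, c i * G i t) (r : ℕ) :
    ∀ t ∈ U, theta^[r] F t = ∑ i, c i * theta^[r] (G i) t := by
  induction r generalizing F G with
  | zero => simpa using hF
  | succ r ih =>
    simp only [Function.iterate_succ_apply]
    exact ih (fun i => differentiableOn_theta hU (hG i)) (theta_sum hU hG c hF)

lemma differentiableOn_foldr {U : Set ℂ} (hU : IsOpen U) {F : ℂ → ℂ}
    (hF : DifferentiableOn ℂ F U) (l : List ℂ) :
    DifferentiableOn ℂ (l.foldr (fun r G => fun t => theta G t + r * G t) F) U := by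
  induction l with
  | nil => simpa using hF
  | cons r l ih => exact (differentiableOn_theta hU ih).add (ih.const_mul r)

lemma foldr_sum {ι : Type*} [Fintype ι] {U : Set ℂ} (hU : IsOpen U) {G : ι → ℂ → ℂ}
    (hG : ∀ i, DifferentiableOn ℂ (G i) U) (c : ι → ℂ) {F : ℂ → ℂ}
    (hF : ∀ t ∈ U, F t = ∑ i, c i * G i t) (l : List ℂ) :
    ∀ t ∈ U, l.foldr (fun r G => fun t => theta G t + r * G t) F t =
      ∑ i, c i * l.foldr (fun r G => fun t => theta G t + r * G t) (G i) t := by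
  induction l with
  | nil => simpa using hF
  | cons r l ih =>
    intro t ht
    simp only [List.foldr_cons]
    rw [theta_sum hU (fun i => differentiableOn_foldr hU (hG i) l) c ih t ht, ih t ht,
      Finset.mul_sum, ← Finset.sum_add_distrib]
    exact Finset.sum_congr rfl fun i _ => by ring

lemma picardFuchs_sum {ι : Type*} [Fintype ι] (n : ℕ) {U : Set ℂ} (hU : IsOpen U)
    {G : ι → ℂ → ℂ} (hG : ∀ i, DifferentiableOn ℂ (G i) U) (c : ι → ℂ) {F : ℂ → ℂ}
    (hF : ∀ t ∈ U, F t = ∑ i, c i * G i t) :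
    ∀ t ∈ U, picardFuchs n F t = ∑ i, c i * picardFuchs n (G i) t := by
  intro t ht
  simp only [picardFuchs, mul_sub, Finset.sum_sub_distrib]
  rw [theta_iterate_sum hU hG c hF n t ht, thetaShiftProd, foldr_sum hU hG c hF _ t ht,
    Finset.mul_sum]
  congr 1
  exact Finset.sum_congr rfl fun i _ => by rw [thetaShiftProd]; ring

/-- Independent solutions in the right number span all solutions. -/
theorem picardFuchs_span {n : ℕ} {U : Set ℂ} (hU : IsOpen U) (hUc : IsPreconnected U)
    (h0 : ∀ t ∈ U, t ≠ 0) (hC : ∀ t ∈ U, (scale n : ℂ) * t ≠ 1) (hne : U.Nonempty)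
    {G : Fin n → ℂ → ℂ}
    (hG : ∀ i, DifferentiableOn ℂ (G i) U) (hPG : ∀ i, ∀ t ∈ U, picardFuchs n (G i) t = 0)
    (hind : ∀ c : Fin n → ℂ, (∀ t ∈ U, ∑ i, c i * G i t = 0) → c = 0) {F : ℂ → ℂ}
    (hF : DifferentiableOn ℂ F U) (hPF : ∀ t ∈ U, picardFuchs n F t = 0) :
    ∃ c : Fin n → ℂ, ∀ t ∈ U, F t = ∑ i, c i * G i t := by
  obtain ⟨t₁, ht₁⟩ := hne
  set T : (Fin n → ℂ) →ₗ[ℂ] (Fin n → ℂ) :=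
    Matrix.mulVecLin (Matrix.of fun i j : Fin n => theta^[(i : ℕ)] (G j) t₁) with hT
  have hTa : ∀ c i, T c i = ∑ j, c j * theta^[(i : ℕ)] (G j) t₁ := fun c i => by
    simp [hT, Matrix.mulVec, dotProduct, mul_comm]
  -- Uniqueness makes the map to initial values injective, hence bijective between spaces of
  -- dimension `n`. Spanning therefore needs no existence theorem for differential equations.
  have hinj : Function.Injective T := by
    refine (injective_iff_map_eq_zero T).mpr fun c hc => hind c ?_
    refine picardFuchs_unique hU hUc h0 hC (DifferentiableOn.fun_sum fun i _ =>
      (hG i).const_mul _) ?_ ht₁ ?_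
    · intro t ht
      rw [picardFuchs_sum n hU hG c (fun _ _ => rfl) t ht]
      exact Finset.sum_eq_zero fun i _ => by rw [hPG i t ht, mul_zero]
    · intro i hi
      rw [theta_iterate_sum hU hG c (fun _ _ => rfl) i t₁ ht₁]
      have := congrFun hc ⟨i, hi⟩
      rwa [hTa] at this
  obtain ⟨c, hc⟩ := LinearMap.injective_iff_surjective.mp hinj
    fun i => theta^[(i : ℕ)] F t₁
  refine ⟨c, fun t ht => sub_eq_zero.mp ?_⟩
  -- Adjoining `F` to the family as an extra member lets the linearity lemmas treat the difference
  -- as one linear combination.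
  set G' : Option (Fin n) → ℂ → ℂ := fun o => o.elim F G with hG'
  set c' : Option (Fin n) → ℂ := fun o => o.elim 1 fun i => -c i with hc'
  have hdG' : ∀ o, DifferentiableOn ℂ (G' o) U := fun o => by
    cases o with
    | none => exact hF
    | some i => exact hG i
  have hsum : ∀ s, F s - ∑ i, c i * G i s = ∑ o, c' o * G' o s := fun s => by
    simp [Fintype.sum_option, hG', hc', sub_eq_add_neg]
  refine picardFuchs_unique hU hUc h0 hC (F := fun s => F s - ∑ i, c i * G i s) (hF.sub
    (DifferentiableOn.fun_sum fun i _ => (hG i).const_mul _)) ?_ ht₁ ?_ t ht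
  · intro s hs
    rw [picardFuchs_sum n hU hdG' c' (fun s _ => hsum s) s hs]
    refine Finset.sum_eq_zero fun o _ => ?_
    cases o with
    | none => exact mul_eq_zero_of_right _ (hPF s hs)
    | some i => exact mul_eq_zero_of_right _ (hPG i s hs)
  · intro i hi
    rw [theta_iterate_sum hU hdG' c' (fun s _ => hsum s) i t₁ ht₁]
    have := congrFun hc ⟨i, hi⟩
    rw [hTa] at this
    simp only [Fintype.sum_option, hG', hc', Option.elim_none, Option.elim_some, one_mul, neg_mul,
      Finset.sum_neg_distrib]
    rw [this]
    ring

/-- Functions of strictly comparable growth are linearly independent. -/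
lemma eq_zero_of_comparable_growth {ι α : Type*} [Fintype ι] {l : Filter α} [l.NeBot]
    {r : ι → ℕ} (hr : Function.Injective r) {F w : ι → α → ℂ}
    (hlt : ∀ i j, r i < r j → Tendsto (fun x => F i x / w j x) l (𝓝 0))
    (hself : ∀ j, ∃ a ≠ 0, Tendsto (fun x => F j x / w j x) l (𝓝 a))
    {c : ι → ℂ} (h : ∀ᶠ x in l, ∑ i, c i * F i x = 0) : c = 0 := by
  classical
  by_contra hc
  obtain ⟨i₀, hi₀⟩ := Function.ne_iff.mp hc
  -- Among the functions that occur, divide by the growth rate of the fastest. In the limit only its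
  -- own coefficient survives.
  obtain ⟨j, hj, hmax⟩ := Finset.exists_max_image (Finset.univ.filter fun i => c i ≠ 0) r
    ⟨i₀, by simpa using hi₀⟩
  obtain ⟨a, ha, hta⟩ := hself j
  have h1 : Tendsto (fun x => ∑ i, c i * (F i x / w j x)) l
      (𝓝 (∑ i, if i = j then c j * a else 0)) := by
    refine tendsto_finsetSum _ fun i _ => ?_
    split_ifs with hij
    · subst hij; exact hta.const_mul _
    · by_cases hci : c i = 0
      · simp [hci]
      · have h2 := hmax i (by simpa using hci)
        have h3 : r i < r j := lt_of_le_of_ne h2 fun h => hij (hr h)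
        simpa using (hlt i j h3).const_mul (c i)
  have h2 : Tendsto (fun x => ∑ i, c i * (F i x / w j x)) l (𝓝 0) := by
    refine (tendsto_congr' ?_).mpr tendsto_const_nhds
    filter_upwards [h] with x hx
    rw [show ∑ i, c i * (F i x / w j x) = (∑ i, c i * F i x) / w j x by
      rw [Finset.sum_div]; exact Finset.sum_congr rfl fun i _ => by ring, hx, zero_div]
  have h3 := tendsto_nhds_unique h1 h2
  simp at h3
  simp at hj
  exact h3.elim hj ha

/-! ### Multiplication by a power series as a matrix -/

/-- The lower triangular Toeplitz matrix of a power series. -/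
def toeplitz (n : ℕ) (A : PowerSeries ℂ) : Matrix (Fin n) (Fin n) ℂ :=
  Matrix.of fun m j => if (j : ℕ) ≤ m then PowerSeries.coeff ((m : ℕ) - j) A else 0

lemma coeff_mul_eq_sum {n : ℕ} (A G : PowerSeries ℂ) (m : Fin n) :
    PowerSeries.coeff (m : ℕ) (A * G) = ∑ j : Fin n, toeplitz n A m j *
      PowerSeries.coeff (j : ℕ) G := by
  rw [mul_comm, PowerSeries.coeff_mul, Finset.Nat.sum_antidiagonal_eq_sum_range_succ_mk]
  simp only [toeplitz, Matrix.of_apply, ite_mul, zero_mul]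
  rw [Fin.sum_univ_eq_sum_range (fun j => if j ≤ (m : ℕ) then
    PowerSeries.coeff ((m : ℕ) - j) A * PowerSeries.coeff j G else 0) n, ← Finset.sum_filter]
  refine Finset.sum_congr ?_ fun j _ => mul_comm _ _
  ext j
  simp only [Finset.mem_range, Finset.mem_filter]
  omega

lemma coeff_mul_congr {A G G' : PowerSeries ℂ} {n : ℕ}
    (h : ∀ i < n, PowerSeries.coeff i G = PowerSeries.coeff i G') {m : ℕ} (hm : m < n) :
    PowerSeries.coeff m (A * G) = PowerSeries.coeff m (A * G') := by
  rw [PowerSeries.coeff_mul, PowerSeries.coeff_mul]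
  refine Finset.sum_congr rfl fun p hp => ?_
  rw [Finset.HasAntidiagonal.mem_antidiagonal] at hp
  rw [h p.2 (by omega)]

/-! ### Charts -/

lemma re_log_lt_iff {t : ℂ} (ht : t ≠ 0) {r : ℝ} (hr : 0 < r) :
    (Complex.log t).re < Real.log r ↔ ‖t‖ < r := by
  rw [Complex.log_re, Real.log_lt_log_iff (norm_pos_iff.mpr ht) hr]

lemma lt_re_log_iff {t : ℂ} (ht : t ≠ 0) {r : ℝ} (hr : 0 < r) :
    Real.log r < (Complex.log t).re ↔ r < ‖t‖ := by
  rw [Complex.log_re, Real.log_lt_log_iff hr (norm_pos_iff.mpr ht)]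

/-- In logarithmic coordinates discs and exteriors cut along the negative axis become convex strips,
which gives their connectedness. -/
lemma slitPlane_inter_eq_exp_image (S : Set ℝ) :
    Complex.slitPlane ∩ {t | (Complex.log t).re ∈ S} =
      Complex.exp '' (S ×ℂ Set.Ioo (-Real.pi) Real.pi) := by
  ext t
  constructor
  · rintro ⟨ht, hS⟩
    refine ⟨Complex.log t, ⟨hS, ?_⟩, Complex.exp_log (Complex.slitPlane_ne_zero ht)⟩
    rw [Set.mem_preimage, Complex.log_im]
    exact ⟨Complex.neg_pi_lt_arg t, lt_of_le_of_ne (Complex.arg_le_pi t)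
      (Complex.mem_slitPlane_iff_arg.mp ht).1⟩
  · rintro ⟨z, ⟨hz1, hz2⟩, rfl⟩
    have hl : Complex.log (Complex.exp z) = z := Complex.log_exp hz2.1 (le_of_lt hz2.2)
    refine ⟨Complex.mem_slitPlane_iff_arg.mpr ⟨?_, Complex.exp_ne_zero z⟩, ?_⟩
    · rw [← Complex.log_im, hl]; exact hz2.2.ne
    · rw [Set.mem_ofPred_eq, hl]; exact hz1

lemma isPreconnected_slitPlane_inter {S : Set ℝ} (hS : Convex ℝ S) :
    IsPreconnected (Complex.slitPlane ∩ {t | (Complex.log t).re ∈ S}) := by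
  rw [slitPlane_inter_eq_exp_image]
  exact (((hS.linear_preimage Complex.reLm).inter
    ((convex_Ioo _ _).linear_preimage Complex.imLm)).isPreconnected).image _ Complex.continuous_exp.continuousOn

lemma inv_scale_pos (n : ℕ) : 0 < 1 / scale n := one_div_pos.mpr (scale_pos n)

lemma isPreconnected_slitDisc (n : ℕ) : IsPreconnected (slitDisc n) := by
  have h := isPreconnected_slitPlane_inter (convex_Iio (Real.log (1 / scale n)))
  convert h using 1
  ext t
  simp only [slitDisc, Set.mem_inter_iff, mem_ball_zero_iff, Set.mem_ofPred_eq, Set.mem_Iio]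
  rw [and_comm]
  refine and_congr_right fun ht => ?_
  rw [re_log_lt_iff (Complex.slitPlane_ne_zero ht) (inv_scale_pos n)]

lemma isOpen_slitDisc (n : ℕ) : IsOpen (slitDisc n) :=
  Metric.isOpen_ball.inter Complex.isOpen_slitPlane

/-- The exterior of the disc `|t| ≤ 1/C`, cut along the negative real axis. -/
def slitExterior (n : ℕ) : Set ℂ := {t | 1 / scale n < ‖t‖} ∩ Complex.slitPlane

lemma isOpen_slitExterior (n : ℕ) : IsOpen (slitExterior n) :=
  (isOpen_lt continuous_const continuous_norm).inter Complex.isOpen_slitPlane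

lemma isPreconnected_slitExterior (n : ℕ) : IsPreconnected (slitExterior n) := by
  have h := isPreconnected_slitPlane_inter (convex_Ioi (Real.log (1 / scale n)))
  convert h using 1
  ext t
  simp only [slitExterior, Set.mem_inter_iff, Set.mem_ofPred_eq, Set.mem_Ioi]
  rw [and_comm]
  refine and_congr_right fun ht => ?_
  rw [lt_re_log_iff (Complex.slitPlane_ne_zero ht) (inv_scale_pos n)]

lemma isPreconnected_neg_slitExterior (n : ℕ) : IsPreconnected {t : ℂ | -t ∈ slitExterior n} := by
  have h := (isPreconnected_slitExterior n).image (fun t => -t) continuous_neg.continuousOn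
  convert h using 1
  ext t
  simp

lemma scale_ne_zero (n : ℕ) : (scale n : ℂ) ≠ 0 := by exact_mod_cast (scale_pos n).ne'

lemma scale_mul_ne_one_of_norm {n : ℕ} {t : ℂ} (h : ‖t‖ ≠ 1 / scale n) :
    (scale n : ℂ) * t ≠ 1 := fun h1 => h (by
  have h2 := congrArg norm h1
  rw [norm_mul, Complex.norm_real, Real.norm_of_nonneg (scale_pos n).le, norm_one] at h2
  rw [eq_div_iff (scale_pos n).ne', mul_comm]; exact h2)

lemma hasDerivAt_log_neg {t : ℂ} (ht : -t ∈ Complex.slitPlane) :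
    HasDerivAt (fun s => Complex.log (-s)) t⁻¹ t := by
  have h0 := Complex.slitPlane_ne_zero ht
  have := (hasDerivAt_neg t).clog ht
  convert! this using 1
  field_simp [neg_ne_zero.mp h0]

lemma isLogChart_zero {n : ℕ} {L : ℂ → ℂ} {U : Set ℂ} (hU : IsOpen U)
    (h0 : ∀ t ∈ U, t ≠ 0) (hL : ∀ t ∈ U, HasDerivAt L t⁻¹ t) (hn : ∀ t ∈ U, ‖t‖ < 1 / scale n) :
    IsLogChart 1 L (fun t => scale n * t) U where
  isOpen := hU
  ne_zero := h0
  hasDerivAt_log := hL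
  hasDerivAt_param t ht := by
    have := (hasDerivAt_id t).const_mul (scale n : ℂ)
    convert! this using 1
    field_simp [h0 t ht]
  norm_lt t ht := norm_scale_mul_lt (hn t ht)

lemma isLogChart_infinity {n : ℕ} {L : ℂ → ℂ} {U : Set ℂ} (hU : IsOpen U)
    (h0 : ∀ t ∈ U, t ≠ 0) (hL : ∀ t ∈ U, HasDerivAt L t⁻¹ t) (hn : ∀ t ∈ U, 1 / scale n < ‖t‖) :
    IsLogChart (-1) L (fun t => (scale n * t)⁻¹) U where
  isOpen := hU
  ne_zero := h0
  hasDerivAt_log := hL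
  hasDerivAt_param t ht := by
    have h1 := scale_ne_zero n
    have h2 := h0 t ht
    have := ((hasDerivAt_id t).const_mul (scale n : ℂ)).fun_inv (mul_ne_zero h1 h2)
    convert! this using 1
    simp only [id]
    field_simp
  norm_lt t ht := by
    have := hn t ht
    rw [norm_inv, norm_mul, Complex.norm_real, Real.norm_of_nonneg (scale_pos n).le]
    rw [div_lt_iff₀ (scale_pos n), mul_comm] at this
    exact inv_lt_one_of_one_lt₀ this

/-! ### Solutions at zero -/

lemma polyGrowth_momentSeries {n : ℕ} (hn : n ≠ 0) : PolyGrowth (momentSeries n) := fun i =>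
  ⟨_, 0, fun k => by simpa using norm_coeff_momentSeries_le hn i k⟩

lemma evalSeries_momentSeries {n : ℕ} (hn : n ≠ 0) {w : ℂ} (hw : ‖w‖ < 1) :
    evalSeries (momentSeries n) w = psiSeries n w := by
  ext i
  rw [evalSeries, PowerSeries.coeff_mk, (hasSum_psi hn i hw).tsum_eq, psiSeries,
    PowerSeries.coeff_mk]

/-- The recursion cancels every term but the one with `k = 0`, where `θⁿ` leaves the factor `Xⁿ`.
This is invisible in degrees below `n`, whence the bound on `m`. -/
lemma picardFuchs_zero_solution {n : ℕ} (hn : n ≠ 0) {L : ℂ → ℂ} {U : Set ℂ}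
    (h : IsLogChart 1 L (fun t => scale n * t) U) {m : ℕ} (hm : m < n) :
    ∀ t ∈ U, picardFuchs n
      (fun t => PowerSeries.coeff m (expSeries (L t) * psiSeries n (scale n * t))) t = 0 := by
  intro t ht
  have hd := polyGrowth_momentSeries hn
  have hw := h.norm_lt t ht
  rw [h.picardFuchs_eq 0 hd n m (fun s hs => by
    rw [logSeries, evalSeries_momentSeries hn (h.norm_lt s hs)]; simp) ht]
  set a : ℕ → PowerSeries ℂ := fun k =>
    (PowerSeries.C (0 + 1 * (k : ℂ)) + PowerSeries.X) ^ n * momentSeries n k with ha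
  set b : ℕ → PowerSeries ℂ := fun k =>
    (∏ j, (PowerSeries.C (0 + 1 * (k : ℂ) + rho n j) + PowerSeries.X)) * momentSeries n k with hb
  have hab : ∀ k, a (k + 1) = b k := fun k => by
    have := momentSeries_succ hn k
    simp only [ha, hb, zero_add, one_mul]
    push_cast
    exact this
  have hga : PolyGrowth a := by
    have hk : ∀ r : ℕ, PolyGrowth fun k =>
        (PowerSeries.C (0 + 1 * (k : ℂ)) + PowerSeries.X) ^ r * momentSeries n k := fun r => by
      induction r with
      | zero => simpa using hd
      | succ r ih => simpa only [pow_succ', mul_assoc] using ih.mul_linear 0 1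
    exact hk n
  have hcoef : ∀ i < n, PowerSeries.coeff i (evalSeries a (scale n * t)) =
      PowerSeries.coeff i (PowerSeries.C ((scale n : ℂ) * t) * evalSeries b (scale n * t)) := by
    intro i hi
    have h1 := (hga.summable i hw).tsum_eq_zero_add
    rw [PowerSeries.coeff_C_mul, evalSeries, PowerSeries.coeff_mk, h1, evalSeries,
      PowerSeries.coeff_mk, ← tsum_mul_left]
    have h2 : PowerSeries.coeff i (a 0) = 0 := by
      simp only [ha, Nat.cast_zero, mul_zero, map_zero, zero_add]
      rw [PowerSeries.coeff_X_pow_mul', if_neg (by omega)]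
    rw [h2, zero_mul, zero_add]
    refine tsum_congr fun k => ?_
    rw [hab, pow_succ]; ring
  rw [logSeries, logSeries, ← mul_assoc, ← mul_assoc, ← PowerSeries.coeff_C_mul,
    coeff_mul_congr hcoef hm, sub_eq_zero]
  congr 1
  ring

/-! ### Solutions at infinity -/

/-- The coefficients of the solutions at infinity. -/
def infCoeff (n : ℕ) (k : Fin n) : ℕ → ℂ
  | 0 => 1
  | i + 1 => (-(rho n k + i)) ^ n / (∏ j, (rho n j - rho n k - (i + 1))) * infCoeff n k i

/-- All `ρⱼ` lie in `(0, 1)`, so no two differ by a positive integer: there is no resonance at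
infinity and no logarithm occurs there. -/
lemma infCoeff_denom_ne_zero (n : ℕ) (k : Fin n) (i : ℕ) :
    ∏ j, (rho n j - rho n k - ((i : ℂ) + 1)) ≠ 0 := by
  refine Finset.prod_ne_zero_iff.mpr fun j _ h => ?_
  have := congrArg Complex.re h
  simp only [rho_eq_ofReal, Complex.sub_re, Complex.ofReal_re, Complex.add_re, Complex.natCast_re,
    Complex.one_re, Complex.zero_re] at this
  have h1 := rhoReal_lt_one n j
  have h2 := rhoReal_pos n k
  have h3 : (0 : ℝ) ≤ i := by positivity
  linarith

/-- Factor by factor the recursion multiplies by a quotient of modulus at most `1`, because `i + ρ_k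
≤ i + 1 + ρ_k - ρⱼ`. Hence convergence for all `|C t| > 1`. -/
lemma norm_infCoeff_le (n : ℕ) (k : Fin n) (i : ℕ) : ‖infCoeff n k i‖ ≤ 1 := by
  induction i with
  | zero => simp [infCoeff]
  | succ i ih =>
    rw [infCoeff, norm_mul]
    refine mul_le_one₀ ?_ (norm_nonneg _) ih
    rw [norm_div, div_le_one (norm_pos_iff.mpr (infCoeff_denom_ne_zero n k i)), norm_pow,
      norm_prod]
    calc ‖-(rho n k + i)‖ ^ n = ∏ _j : Fin n, ‖-(rho n k + i)‖ := by simp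
      _ ≤ _ := by
        refine Finset.prod_le_prod (fun _ _ => norm_nonneg _) fun j _ => ?_
        have h1 := rhoReal_lt_one n j
        have h2 := rhoReal_pos n k
        have h3 : (0 : ℝ) ≤ i := by positivity
        have e1 : -(rho n k + i) = ((-(rhoReal n k + i) : ℝ) : ℂ) := by
          rw [rho_eq_ofReal]; push_cast; ring
        have e2 : rho n j - rho n k - ((i : ℂ) + 1) =
            ((rhoReal n j - rhoReal n k - (i + 1) : ℝ) : ℂ) := by
          rw [rho_eq_ofReal, rho_eq_ofReal]; push_cast; ring
        rw [e1, e2, Complex.norm_real, Complex.norm_real, Real.norm_eq_abs, Real.norm_eq_abs,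
          abs_of_nonpos (by linarith), abs_of_nonpos (by linarith)]
        linarith

/-- The power series at infinity. -/
def infSeries (n : ℕ) (k : Fin n) (v : ℂ) : ℂ := ∑' i, infCoeff n k i * v ^ i

/-- The solution `t^(-ρ_k) (1 + O(1/t))` for a branch `L` of the logarithm. -/
def infSolution (n : ℕ) (k : Fin n) (L : ℂ → ℂ) (t : ℂ) : ℂ :=
  Complex.exp (-rho n k * L t) * infSeries n k (scale n * t)⁻¹

lemma polyGrowth_infCoeff (n : ℕ) (k : Fin n) :
    PolyGrowth fun i => PowerSeries.C (infCoeff n k i) := fun i =>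
  ⟨1, 0, fun l => by
    rw [PowerSeries.coeff_C]
    split_ifs
    · simpa using norm_infCoeff_le n k l
    · simp⟩

lemma coeff_zero_logSeries (α : ℂ) (L w : ℂ → ℂ) (d : ℕ → PowerSeries ℂ) (t : ℂ) :
    PowerSeries.coeff 0 (logSeries α L w d t) =
      Complex.exp (α * L t) * ∑' k, PowerSeries.constantCoeff (d k) * w t ^ k := by
  simp [logSeries, evalSeries, constantCoeff_expSeries]

lemma infSolution_eq (n : ℕ) (k : Fin n) (L : ℂ → ℂ) (t : ℂ) :
    infSolution n k L t = PowerSeries.coeff 0 (logSeries (-rho n k) L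
      (fun t => (scale n * t)⁻¹) (fun i => PowerSeries.C (infCoeff n k i)) t) := by
  rw [coeff_zero_logSeries]
  simp [infSolution, infSeries]

lemma differentiableOn_infSolution {n : ℕ} (k : Fin n) {L : ℂ → ℂ} {U : Set ℂ}
    (h : IsLogChart (-1) L (fun t => (scale n * t)⁻¹) U) :
    DifferentiableOn ℂ (infSolution n k L) U :=
  (h.differentiableOn (-rho n k) (polyGrowth_infCoeff n k) 0).congr fun t _ =>
    infSolution_eq n k L t

/-- Here the unmatched term is the initial one of the second series; it contains the factor `ρⱼ -
ρ_k` with `j = k` and so vanishes. -/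
lemma picardFuchs_infSolution {n : ℕ} (k : Fin n) {L : ℂ → ℂ} {U : Set ℂ}
    (h : IsLogChart (-1) L (fun t => (scale n * t)⁻¹) U) :
    ∀ t ∈ U, picardFuchs n (infSolution n k L) t = 0 := by
  intro t ht
  have hw := h.norm_lt t ht
  have hC := scale_ne_zero n
  have h0 := h.ne_zero t ht
  have hgb : PolyGrowth fun i : ℕ => (∏ j, (PowerSeries.C (-rho n k + -1 * (i : ℂ) + rho n j) +
      PowerSeries.X)) * PowerSeries.C (infCoeff n k i) := by
    have := (polyGrowth_infCoeff n k).list_prod (-rho n k) (-1) (List.ofFn (rho n))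
    simpa only [List.map_ofFn, List.prod_ofFn, Function.comp_apply] using this
  rw [h.picardFuchs_eq (-rho n k) (polyGrowth_infCoeff n k) n 0
    (fun s _ => infSolution_eq n k L s) ht, coeff_zero_logSeries, coeff_zero_logSeries]
  have hs := hgb.summable 0 hw
  simp only [PowerSeries.coeff_zero_eq_constantCoeff_apply] at hs
  rw [hs.tsum_eq_zero_add]
  have hz : PowerSeries.constantCoeff ((∏ j, (PowerSeries.C (-rho n k + -1 * ((0 : ℕ) : ℂ) +
      rho n j) + PowerSeries.X)) * PowerSeries.C (infCoeff n k 0)) = 0 := by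
    rw [map_mul, map_prod]
    refine mul_eq_zero_of_left (Finset.prod_eq_zero (Finset.mem_univ k) ?_) _
    simp
  rw [hz, zero_mul, zero_add, mul_left_comm, ← mul_sub]
  refine mul_eq_zero_of_right _ ?_
  rw [sub_eq_zero, ← tsum_mul_left]
  refine tsum_congr fun i => ?_
  have e1 : PowerSeries.constantCoeff ((PowerSeries.C (-rho n k + -1 * (i : ℂ)) +
      PowerSeries.X) ^ n * PowerSeries.C (infCoeff n k i)) =
      (-(rho n k + i)) ^ n * infCoeff n k i := by
    simp; left; ring
  have e2 : PowerSeries.constantCoeff ((∏ j, (PowerSeries.C (-rho n k + -1 * ((i + 1 : ℕ) : ℂ) +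
      rho n j) + PowerSeries.X)) * PowerSeries.C (infCoeff n k (i + 1))) =
      (-(rho n k + i)) ^ n * infCoeff n k i := by
    rw [map_mul, map_prod, PowerSeries.constantCoeff_C, infCoeff, ← mul_assoc]
    congr 1
    have : ∀ j, PowerSeries.constantCoeff (PowerSeries.C (-rho n k + -1 * ((i + 1 : ℕ) : ℂ) +
        rho n j) + PowerSeries.X) = rho n j - rho n k - ((i : ℂ) + 1) := fun j => by
      simp; ring
    simp only [this]
    rw [mul_div_cancel₀ _ (infCoeff_denom_ne_zero n k i)]
  rw [e1, e2, pow_succ]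
  field_simp

lemma tendsto_infSeries (n : ℕ) (k : Fin n) : Tendsto (infSeries n k) (𝓝 0) (𝓝 1) := by
  obtain ⟨D, hD, -⟩ := hasDerivAt_evalSeries (polyGrowth_infCoeff n k) 0 (w := 0) (by simp)
  have h := hD.continuousAt.tendsto
  have e : (fun z => PowerSeries.coeff 0 (evalSeries (fun i => PowerSeries.C (infCoeff n k i)) z))
      = infSeries n k := by
    funext z; simp [evalSeries, infSeries]
  rw [e] at h
  have h1 : infSeries n k 0 = 1 := by
    rw [infSeries, tsum_eq_single 0 (fun i hi => by simp [hi])]; simp [infCoeff]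
  rwa [congrFun e 0, h1] at h

/-! ### Linear independence -/

/-- Along the ray the solution of index `k` behaves like `x^(-ρ_k)`. The direction `s` is left free
because `log (-t)` on the negative axis and `log t` on the positive axis are both needed. -/
lemma infSolution_independent (n : ℕ) {L : ℂ → ℂ} {s : ℂ}
    (hL : ∀ x : ℝ, 0 < x → L (s * x) = Real.log x) {c : Fin n → ℂ}
    (h : ∀ᶠ x : ℝ in atTop, ∑ k, c k * infSolution n k L (s * x) = 0) : c = 0 := by
  have hv : ∀ k, Tendsto (fun x : ℝ => infSeries n k (scale n * (s * x))⁻¹) atTop (𝓝 1) := by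
    intro k
    refine (tendsto_infSeries n k).comp ?_
    have h1 : Tendsto (fun x : ℝ => (x : ℂ)⁻¹) atTop (𝓝 0) := by
      have := (Complex.continuous_ofReal.tendsto 0).comp tendsto_inv_atTop_zero
      simpa [Function.comp_def] using this
    have h2 := h1.const_mul ((scale n : ℂ) * s)⁻¹
    simp only [mul_zero] at h2
    refine h2.congr fun x => ?_
    rw [← mul_assoc, mul_inv (_ * s)]
  have hdiv : ∀ i j, ∀ᶠ x : ℝ in atTop, infSolution n i L (s * x) /
      Complex.exp (-rho n j * Real.log x) =
      ((Real.exp (-(rhoReal n i - rhoReal n j) * Real.log x) : ℝ) : ℂ) *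
        infSeries n i (scale n * (s * x))⁻¹ := by
    intro i j
    filter_upwards [eventually_gt_atTop 0] with x hx
    rw [infSolution, hL x hx, mul_comm, mul_div_assoc, ← Complex.exp_sub, mul_comm,
      rho_eq_ofReal, rho_eq_ofReal]
    congr 1
    push_cast
    ring_nf
  -- A smaller exponent `ρ_k` means slower decay, so the ranking by growth reverses the order of the
  -- indices.
  refine eq_zero_of_comparable_growth (r := fun k : Fin n => n - 1 - k)
    (F := fun k x => infSolution n k L (s * (x : ℝ)))
    (w := fun k x => Complex.exp (-rho n k * Real.log x)) ?_ ?_ ?_ h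
  · intro i j hij
    have := i.2
    have := j.2
    simp only at hij
    ext; omega
  · intro i j hij
    refine (tendsto_congr' (hdiv i j)).mpr ?_
    have hlt : rhoReal n j < rhoReal n i := by
      have h1 : (j : ℕ) < i := by
        have := i.2
        have := j.2
        omega
      unfold rhoReal
      have h2 : ((j : ℕ) : ℝ) < ((i : ℕ) : ℝ) := by exact_mod_cast h1
      gcongr
    have h1 : Tendsto (fun x : ℝ => Real.exp (-(rhoReal n i - rhoReal n j) * Real.log x)) atTop
        (𝓝 0) := Real.tendsto_exp_atBot.comp
      (Real.tendsto_log_atTop.const_mul_atTop_of_neg (by linarith))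
    have h2 : Tendsto (fun x : ℝ =>
        ((Real.exp (-(rhoReal n i - rhoReal n j) * Real.log x) : ℝ) : ℂ)) atTop (𝓝 0) := by
      rw [← Complex.ofReal_zero]
      exact (Complex.continuous_ofReal.tendsto 0).comp h1
    simpa using h2.mul (hv i)
  · intro j
    refine ⟨1, one_ne_zero, (tendsto_congr' (hdiv j j)).mpr ?_⟩
    simpa using hv j

lemma tendsto_log_pow_div {i j : ℕ} (h : i ≤ j) :
    Tendsto (fun x : ℝ => (Real.log x : ℂ) ^ i / (Real.log x : ℂ) ^ j) (𝓝[>] 0)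
      (𝓝 (if i = j then 1 else 0)) := by
  have h1 : ∀ᶠ x : ℝ in 𝓝[>] 0, (Real.log x : ℂ) ≠ 0 := by
    filter_upwards [Real.tendsto_log_nhdsGT_zero.eventually (eventually_lt_atBot 0)] with x hx
    exact_mod_cast hx.ne
  split_ifs with hij
  · subst hij
    refine (tendsto_congr' ?_).mpr tendsto_const_nhds
    filter_upwards [h1] with x hx using div_self (pow_ne_zero _ hx)
  · obtain ⟨k, rfl⟩ := Nat.exists_eq_add_of_le h
    have hk : k ≠ 0 := fun h => hij (by simp [h])
    have h2 : Tendsto (fun x : ℝ => ((Real.log x)⁻¹ : ℝ)) (𝓝[>] 0) (𝓝 0) :=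
      tendsto_inv_atBot_zero.comp Real.tendsto_log_nhdsGT_zero
    have h3 : Tendsto (fun x : ℝ => ((Real.log x : ℂ)⁻¹) ^ k) (𝓝[>] 0) (𝓝 0) := by
      have := ((Complex.continuous_ofReal.tendsto 0).comp h2).pow k
      simpa [Function.comp_def, hk] using this
    refine (tendsto_congr' ?_).mpr h3
    filter_upwards [h1] with x hx
    rw [pow_add, inv_pow]
    field_simp

/-- As `x → 0+` the coefficient of degree `m` is asymptotic to `q 0 (log x)^m / m!`. -/
lemma logarithmic_independent (n : ℕ) {Q : ℝ → PowerSeries ℂ} {q : ℕ → ℂ} (hq : q 0 ≠ 0)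
    (hQ : ∀ i, Tendsto (fun x => PowerSeries.coeff i (Q x)) (𝓝[>] 0) (𝓝 (q i)))
    {c : Fin n → ℂ} (h : ∀ᶠ x : ℝ in 𝓝[>] 0, ∑ m, c m *
      PowerSeries.coeff (m : ℕ) (expSeries (Real.log x) * Q x) = 0) : c = 0 := by
  have key : ∀ i j : ℕ, i ≤ j → Tendsto (fun x : ℝ =>
      PowerSeries.coeff i (expSeries (Real.log x) * Q x) / (Real.log x : ℂ) ^ j) (𝓝[>] 0)
      (𝓝 (∑ p ∈ Finset.HasAntidiagonal.antidiagonal i, (if p.1 = j then 1 else 0) *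
        ((p.1.factorial : ℂ)⁻¹ * q p.2))) := by
    intro i j hij
    simp only [PowerSeries.coeff_mul, Finset.sum_div, coeff_expSeries]
    refine tendsto_finsetSum _ fun p hp => ?_
    rw [Finset.HasAntidiagonal.mem_antidiagonal] at hp
    have := (tendsto_log_pow_div (i := p.1) (j := j) (by omega)).mul
      ((hQ p.2).const_mul (p.1.factorial : ℂ)⁻¹)
    refine this.congr fun x => ?_
    ring
  refine eq_zero_of_comparable_growth (r := fun k : Fin n => (k : ℕ)) Fin.val_injective
    (F := fun m x => PowerSeries.coeff (m : ℕ) (expSeries (Real.log x) * Q x))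
    (w := fun m x => (Real.log x : ℂ) ^ (m : ℕ)) ?_ ?_ h
  · intro i j hij
    have h1 := key i j hij.le
    rwa [Finset.sum_eq_zero] at h1
    intro p hp
    rw [Finset.HasAntidiagonal.mem_antidiagonal] at hp
    have : p.1 ≠ j := by omega
    simp [this]
  · intro j
    refine ⟨((j : ℕ).factorial : ℂ)⁻¹ * q 0, mul_ne_zero (inv_ne_zero (by
      exact_mod_cast (j : ℕ).factorial_ne_zero)) hq, ?_⟩
    have h1 := key j j le_rfl
    rw [Finset.sum_eq_single ((j : ℕ), 0)] at h1
    · simpa using h1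
    · intro p hp hne
      rw [Finset.HasAntidiagonal.mem_antidiagonal] at hp
      have : p.1 ≠ j := fun h => hne (Prod.ext h (by simp; omega))
      simp [this]
    · simp

/-! ### The Frobenius basis on the slit disc -/

lemma differentiableOn_coeff_mul {U : Set ℂ} {F G : ℂ → PowerSeries ℂ}
    (hF : ∀ i, DifferentiableOn ℂ (fun t => PowerSeries.coeff i (F t)) U)
    (hG : ∀ i, DifferentiableOn ℂ (fun t => PowerSeries.coeff i (G t)) U) (m : ℕ) :
    DifferentiableOn ℂ (fun t => PowerSeries.coeff m (F t * G t)) U := by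
  simp only [PowerSeries.coeff_mul]
  exact DifferentiableOn.fun_sum fun p _ => (hF p.1).mul (hG p.2)

lemma differentiableOn_coeff_expSeries {U : Set ℂ} {L : ℂ → ℂ} (hL : DifferentiableOn ℂ L U)
    (m : ℕ) : DifferentiableOn ℂ (fun t => PowerSeries.coeff m (expSeries (L t))) U := by
  simp only [coeff_expSeries]
  exact (hL.pow m).div_const _

lemma differentiableOn_coeff_psiSeries {n : ℕ} (hn : n ≠ 0) {U : Set ℂ}
    (hU : ∀ t ∈ U, (scale n : ℂ) * t ∈ cutPlane) (m : ℕ) :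
    DifferentiableOn ℂ (fun t => PowerSeries.coeff m (psiSeries n (scale n * t))) U := by
  simp only [psiSeries, PowerSeries.coeff_mk]
  exact (differentiableOn_psi hn m).comp (by fun_prop) hU

/-- The plane cut along `(-∞, 0]` and `[1/C, ∞)`. -/
def doubleSlit (n : ℕ) : Set ℂ := {t | t ∈ Complex.slitPlane ∧ (scale n : ℂ) * t ∈ cutPlane}

lemma isOpen_doubleSlit (n : ℕ) : IsOpen (doubleSlit n) :=
  Complex.isOpen_slitPlane.inter (isOpen_cutPlane.preimage (by fun_prop))

lemma slitDisc_subset_doubleSlit (n : ℕ) : slitDisc n ⊆ doubleSlit n := fun _ ht =>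
  ⟨ht.2, mem_cutPlane_of_norm_lt (norm_scale_mul_lt (by simpa using ht.1))⟩

lemma scale_mul_mem_cutPlane_of_im {n : ℕ} {t : ℂ} (ht : t.im ≠ 0) :
    (scale n : ℂ) * t ∈ cutPlane := by
  refine mem_cutPlane_of_im_ne_zero ?_
  simp [(scale_pos n).ne', ht]

lemma mem_doubleSlit_of_im {n : ℕ} {t : ℂ} (ht : t.im ≠ 0) : t ∈ doubleSlit n :=
  ⟨Complex.mem_slitPlane_iff.mpr (Or.inr ht), scale_mul_mem_cutPlane_of_im ht⟩

lemma differentiableOn_frobSeries {n : ℕ} (hn : n ≠ 0) (m : ℕ) :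
    DifferentiableOn ℂ (fun t => PowerSeries.coeff m (frobSeries n t)) (doubleSlit n) :=
  differentiableOn_coeff_mul (fun _ => differentiableOn_const _) (differentiableOn_coeff_mul
    (differentiableOn_coeff_expSeries fun _ ht =>
      (Complex.differentiableAt_log ht.1).differentiableWithinAt)
    (differentiableOn_coeff_psiSeries hn fun _ ht => ht.2)) m

lemma isLogChart_slitDisc (n : ℕ) :
    IsLogChart 1 Complex.log (fun t => scale n * t) (slitDisc n) :=
  isLogChart_zero (isOpen_slitDisc n) (fun _ ht => Complex.slitPlane_ne_zero ht.2)
    (fun _ ht => Complex.hasDerivAt_log ht.2) (fun _ ht => by simpa using ht.1)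

lemma picardFuchs_frobSeries {n : ℕ} (hn : n ≠ 0) (m : Fin n) :
    ∀ t ∈ slitDisc n,
      picardFuchs n (fun t => PowerSeries.coeff (m : ℕ) (frobSeries n t)) t = 0 := by
  intro t ht
  have h := isLogChart_slitDisc n
  rw [picardFuchs_sum n (F := fun t => PowerSeries.coeff (m : ℕ) (frobSeries n t))
    (isOpen_slitDisc n) (G := fun j : Fin n => fun t =>
    PowerSeries.coeff (j : ℕ) (expSeries (Complex.log t) * psiSeries n (scale n * t)))
    (fun j => ?_) (fun j => toeplitz n (normSeries n) m j)
    (fun s _ => coeff_mul_eq_sum _ _ m) t ht]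
  · exact Finset.sum_eq_zero fun j _ =>
      mul_eq_zero_of_right _ (picardFuchs_zero_solution hn h j.2 t ht)
  · exact (differentiableOn_coeff_mul
      (differentiableOn_coeff_expSeries fun t ht =>
        (Complex.differentiableAt_log ht.2).differentiableWithinAt)
      (differentiableOn_coeff_psiSeries hn fun t ht => (slitDisc_subset_doubleSlit n ht).2)) j

lemma psi_zero_zero {n : ℕ} : psi n 0 0 = 1 := by simp [psi, logPow]

lemma ofReal_mem_slitDisc {n : ℕ} {x : ℝ} (h0 : 0 < x) (h1 : x < 1 / scale n) :
    (x : ℂ) ∈ slitDisc n :=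
  ⟨by simpa [abs_of_pos h0] using h1, Complex.mem_slitPlane_iff.mpr (Or.inl (by simpa using h0))⟩

lemma frobSeries_independent {n : ℕ} (hn : n ≠ 0) {c : Fin n → ℂ}
    (h : ∀ t ∈ slitDisc n, ∑ m, c m * PowerSeries.coeff (m : ℕ) (frobSeries n t) = 0) :
    c = 0 := by
  refine logarithmic_independent n (Q := fun x => normSeries n * psiSeries n (scale n * x))
    (q := fun i => PowerSeries.coeff i (normSeries n * psiSeries n 0)) ?_ ?_ ?_
  · rw [PowerSeries.coeff_zero_eq_constantCoeff_apply, map_mul, constantCoeff_normSeries,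
      ← PowerSeries.coeff_zero_eq_constantCoeff_apply, psiSeries, PowerSeries.coeff_mk,
      psi_zero_zero]
    simp
  · intro i
    simp only [PowerSeries.coeff_mul]
    refine tendsto_finsetSum _ fun p _ => Tendsto.const_mul _ ?_
    simp only [psiSeries, PowerSeries.coeff_mk]
    have h1 := ((differentiableOn_psi hn p.2).differentiableAt (isOpen_cutPlane.mem_nhds
      (mem_cutPlane_of_norm_lt (w := 0) (by simp)))).continuousAt.tendsto
    refine h1.comp ?_
    have h2 : Continuous fun x : ℝ => (scale n : ℂ) * x := by fun_prop
    have h3 := h2.tendsto 0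
    simp only [Complex.ofReal_zero, mul_zero] at h3
    exact h3.mono_left nhdsWithin_le_nhds
  · filter_upwards [Ioo_mem_nhdsGT (inv_scale_pos n)] with x hx
    have := h x (ofReal_mem_slitDisc hx.1 hx.2)
    rw [← this]
    refine Finset.sum_congr rfl fun m _ => ?_
    rw [frobSeries, Complex.ofReal_log hx.1.le]
    congr 2
    ring

lemma twoPiI_ne_zero : twoPiI ≠ 0 := by
  simp [twoPiI, Real.pi_ne_zero]

lemma frobeniusBasis_eq {n : ℕ} (i : Fin n) {t : ℂ} (ht : t ∈ slitDisc n) :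
    frobeniusBasis n i t =
      PowerSeries.coeff (i.rev : ℕ) (frobSeries n t) / twoPiI ^ (i.rev : ℕ) :=
  frobenius_eq (Nat.pos_iff_ne_zero.mp i.pos) _ (Complex.slitPlane_ne_zero ht.2)
    (by simpa using ht.1)

theorem differentiableOn_frobeniusBasis {n : ℕ} (i : Fin n) :
    DifferentiableOn ℂ (frobeniusBasis n i) (slitDisc n) :=
  (((differentiableOn_frobSeries (Nat.pos_iff_ne_zero.mp i.pos) _).mono
    (slitDisc_subset_doubleSlit n)).div_const _).congr fun _ ht => frobeniusBasis_eq i ht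

lemma frobeniusBasis_independent {n : ℕ} (hn : n ≠ 0) {c : Fin n → ℂ}
    (h : ∀ t ∈ slitDisc n, ∑ i, c i * frobeniusBasis n i t = 0) : c = 0 := by
  have h1 : (fun m : Fin n => c m.rev / twoPiI ^ (m : ℕ)) = 0 := by
    refine frobSeries_independent hn fun t ht => ?_
    rw [← h t ht, ← Equiv.sum_comp Fin.revPerm]
    refine Finset.sum_congr rfl fun i _ => ?_
    rw [frobeniusBasis_eq i ht, Fin.revPerm_apply, Fin.rev_rev]
    ring
  funext i
  have h2 := congrFun h1 i.rev
  simpa [twoPiI_ne_zero] using h2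

lemma picardFuchs_frobeniusBasis {n : ℕ} (i : Fin n) :
    ∀ t ∈ slitDisc n, picardFuchs n (frobeniusBasis n i) t = 0 := by
  intro t ht
  have hn := Nat.pos_iff_ne_zero.mp i.pos
  rw [picardFuchs_sum n (isOpen_slitDisc n) (G := fun _ : Unit => fun t =>
    PowerSeries.coeff (i.rev : ℕ) (frobSeries n t)) (fun _ => (differentiableOn_frobSeries hn _).mono
    (slitDisc_subset_doubleSlit n)) (fun _ => (twoPiI ^ (i.rev : ℕ))⁻¹) (fun s hs => by
      rw [frobeniusBasis_eq i hs]; simp; ring) t ht]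
  exact Finset.sum_eq_zero fun _ _ => mul_eq_zero_of_right _ (picardFuchs_frobSeries hn i.rev t ht)

lemma scale_mul_ne_one_slitDisc {n : ℕ} : ∀ t ∈ slitDisc n, (scale n : ℂ) * t ≠ 1 :=
  fun t ht => scale_mul_ne_one_of_norm (by have : ‖t‖ < 1 / scale n := by simpa using ht.1
                                           exact this.ne)

lemma half_mem_slitDisc (n : ℕ) : ((1 / scale n / 2 : ℝ) : ℂ) ∈ slitDisc n :=
  ofReal_mem_slitDisc (half_pos (inv_scale_pos n)) (half_lt_self (inv_scale_pos n))

theorem frobeniusBasis_basis {n : ℕ} (hn : n ≠ 0) {F : ℂ → ℂ}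
    (hF : DifferentiableOn ℂ F (slitDisc n)) :
    (∀ t ∈ slitDisc n, picardFuchs n F t = 0) ↔
      ∃! c : Fin n → ℂ, ∀ t ∈ slitDisc n, F t = ∑ i, c i * frobeniusBasis n i t := by
  constructor
  · intro h
    obtain ⟨c, hc⟩ := picardFuchs_span (isOpen_slitDisc n) (isPreconnected_slitDisc n)
      (fun _ ht => Complex.slitPlane_ne_zero ht.2) scale_mul_ne_one_slitDisc
      ⟨_, half_mem_slitDisc n⟩ differentiableOn_frobeniusBasis picardFuchs_frobeniusBasis
      (fun c hc => frobeniusBasis_independent hn hc) hF h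
    refine ⟨c, hc, fun c' hc' => sub_eq_zero.mp (frobeniusBasis_independent hn fun t ht => ?_)⟩
    simp only [Pi.sub_apply, sub_mul, Finset.sum_sub_distrib]
    rw [← hc t ht, ← hc' t ht, sub_self]
  · rintro ⟨c, hc, -⟩ t ht
    rw [picardFuchs_sum n (isOpen_slitDisc n) differentiableOn_frobeniusBasis c hc t ht]
    exact Finset.sum_eq_zero fun i _ =>
      mul_eq_zero_of_right _ (picardFuchs_frobeniusBasis i t ht)

/-! ### The solutions on the plane cut along the positive axis -/

/-- The solutions with the branch of the logarithm that is real on the negative axis. -/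
def negSeries (n : ℕ) (t : ℂ) : PowerSeries ℂ :=
  expSeries (Complex.log (-t)) * psiSeries n (scale n * t)

/-- The plane cut along the positive real axis. -/
def negSlit : Set ℂ := {t | -t ∈ Complex.slitPlane}

lemma isOpen_negSlit : IsOpen negSlit := Complex.isOpen_slitPlane.preimage continuous_neg

lemma scale_mul_mem_cutPlane_of_negSlit {n : ℕ} {t : ℂ} (ht : t ∈ negSlit) :
    (scale n : ℂ) * t ∈ cutPlane := by
  rcases Complex.mem_slitPlane_iff.mp ht with h | h
  · refine Complex.mem_slitPlane_iff.mpr (Or.inl ?_)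
    rw [Complex.neg_re] at h
    have := scale_pos n
    simp
    nlinarith
  · exact scale_mul_mem_cutPlane_of_im (by simpa using h)

lemma differentiableOn_negSeries {n : ℕ} (hn : n ≠ 0) (m : ℕ) :
    DifferentiableOn ℂ (fun t => PowerSeries.coeff m (negSeries n t)) negSlit :=
  differentiableOn_coeff_mul
    (differentiableOn_coeff_expSeries fun _ ht =>
      (hasDerivAt_log_neg ht).differentiableAt.differentiableWithinAt)
    (differentiableOn_coeff_psiSeries hn fun _ ht => scale_mul_mem_cutPlane_of_negSlit ht) m

lemma differentiableOn_picardFuchs (n : ℕ) {U : Set ℂ} (hU : IsOpen U) {F : ℂ → ℂ}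
    (hF : DifferentiableOn ℂ F U) : DifferentiableOn ℂ (picardFuchs n F) U := by
  have h1 : ∀ r : ℕ, DifferentiableOn ℂ (theta^[r] F) U := fun r => by
    induction r with
    | zero => simpa using hF
    | succ r ih => rw [Function.iterate_succ_apply']; exact differentiableOn_theta hU ih
  exact (h1 n).sub ((by fun_prop : DifferentiableOn ℂ (fun t => (scale n : ℂ) * t) U).mul
    (differentiableOn_foldr hU hF _))

lemma eqOn_of_eqOn_open {U V : Set ℂ} (hU : IsOpen U) (hUc : IsPreconnected U) (hV : IsOpen V)
    {F G : ℂ → ℂ} (hF : DifferentiableOn ℂ F U) (hG : DifferentiableOn ℂ G U)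
    {t₁ : ℂ} (hU₁ : t₁ ∈ U) (hV₁ : t₁ ∈ V) (h : ∀ t ∈ V, F t = G t) : ∀ t ∈ U, F t = G t :=
  (hF.analyticOnNhd hU).eqOn_of_preconnected_of_eventuallyEq (hG.analyticOnNhd hU) hUc hU₁
    (by filter_upwards [hV.mem_nhds hV₁] with t ht using h t ht)

lemma isPreconnected_negSlit : IsPreconnected negSlit := by
  have h := (Complex.starConvex_one_slitPlane.isPathConnected
    Complex.one_mem_slitPlane).isConnected.isPreconnected.image (fun t => -t)
    continuous_neg.continuousOn
  convert h using 1
  ext t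
  simp [negSlit]

/-- Inside the disc this is `picardFuchs_zero_solution`; the identity theorem carries the equation
to the rest of the cut plane, in particular beyond `|t| = 1/C`. -/
lemma picardFuchs_negSeries {n : ℕ} (hn : n ≠ 0) {m : ℕ} (hm : m < n) :
    ∀ t ∈ negSlit, picardFuchs n (fun t => PowerSeries.coeff m (negSeries n t)) t = 0 := by
  have hV : IsOpen (negSlit ∩ Metric.ball 0 (1 / scale n)) :=
    isOpen_negSlit.inter Metric.isOpen_ball
  have hmem : -((1 / scale n / 2 : ℝ) : ℂ) ∈ negSlit ∩ Metric.ball 0 (1 / scale n) := by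
    have h := half_mem_slitDisc n
    refine ⟨by rw [negSlit, Set.mem_ofPred_eq, neg_neg]; exact h.2, ?_⟩
    have := h.1
    rw [mem_ball_zero_iff] at this ⊢
    rwa [norm_neg]
  refine eqOn_of_eqOn_open isOpen_negSlit isPreconnected_negSlit hV
    (differentiableOn_picardFuchs n isOpen_negSlit (differentiableOn_negSeries hn m))
    (differentiableOn_const 0) hmem.1 hmem ?_
  exact picardFuchs_zero_solution hn (isLogChart_zero hV
    (fun _ ht => neg_ne_zero.mp (Complex.slitPlane_ne_zero ht.1))
    (fun _ ht => hasDerivAt_log_neg ht.1) (fun t ht => by simpa using ht.2)) hm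

/-- The exterior of the disc `|t| ≤ 1/C`, cut along the positive real axis. -/
def negExterior (n : ℕ) : Set ℂ := {t | -t ∈ slitExterior n}

lemma isOpen_negExterior (n : ℕ) : IsOpen (negExterior n) :=
  (isOpen_slitExterior n).preimage continuous_neg

lemma isLogChart_negExterior (n : ℕ) : IsLogChart (-1) (fun t => Complex.log (-t))
    (fun t => (scale n * t)⁻¹) (negExterior n) :=
  isLogChart_infinity (isOpen_negExterior n)
    (fun _ ht => neg_ne_zero.mp (Complex.slitPlane_ne_zero ht.2))
    (fun _ ht => hasDerivAt_log_neg ht.2) (fun _ ht => by simpa using ht.1)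

lemma isLogChart_slitExterior (n : ℕ) : IsLogChart (-1) Complex.log
    (fun t => (scale n * t)⁻¹) (slitExterior n) :=
  isLogChart_infinity (isOpen_slitExterior n)
    (fun _ ht => Complex.slitPlane_ne_zero ht.2)
    (fun _ ht => Complex.hasDerivAt_log ht.2) (fun _ ht => ht.1)

/-- Mere existence, by the dimension of the solution space. The series `a k` have meaning only
modulo degree `n`; they are filled up by zeros, and their shape is found afterwards. -/
lemma exists_connection {n : ℕ} (hn : n ≠ 0) : ∃ a : Fin n → PowerSeries ℂ,
    ∀ m < n, ∀ t ∈ negExterior n, PowerSeries.coeff m (negSeries n t) =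
      ∑ k, PowerSeries.coeff m (a k) * infSolution n k (fun t => Complex.log (-t)) t := by
  have hsub : negExterior n ⊆ negSlit := fun t ht => ht.2
  have h2 : (-2 / scale n : ℂ) ∈ negExterior n := by
    have := inv_scale_pos n
    have h1 : -(-2 / scale n : ℂ) = ((2 * (1 / scale n) : ℝ) : ℂ) := by push_cast; ring
    rw [negExterior, Set.mem_ofPred_eq, h1]
    refine ⟨?_, Complex.mem_slitPlane_iff.mpr (Or.inl ?_)⟩
    · rw [Set.mem_ofPred_eq, Complex.norm_real, Real.norm_of_nonneg (by positivity)]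
      linarith
    · rw [Complex.ofReal_re]; positivity
  have h := fun m : Fin n => picardFuchs_span (isOpen_negExterior n)
    (isPreconnected_neg_slitExterior n) (isLogChart_negExterior n).ne_zero
    (fun t ht => scale_mul_ne_one_of_norm (by
      have : 1 / scale n < ‖t‖ := by simpa using ht.1
      exact this.ne'))
    ⟨_, h2⟩ (fun k => differentiableOn_infSolution k (isLogChart_negExterior n))
    (fun k => picardFuchs_infSolution k (isLogChart_negExterior n))
    (fun c hc => infSolution_independent n (L := fun t => Complex.log (-t)) (s := -1)
      (fun x hx => by simp [Complex.ofReal_log hx.le]) (by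
        filter_upwards [eventually_gt_atTop (1 / scale n)] with x hx
        refine hc _ ?_
        have h0 := (inv_scale_pos n).trans hx
        refine ⟨?_, Complex.mem_slitPlane_iff.mpr (Or.inl ?_)⟩
        · simpa [abs_of_pos h0] using hx
        · simpa using h0))
    ((differentiableOn_negSeries hn m).mono hsub)
    (fun t ht => picardFuchs_negSeries hn m.2 t (hsub ht))
  choose c hc using h
  refine ⟨fun k => PowerSeries.mk fun m => if hm : m < n then c ⟨m, hm⟩ k else 0,
    fun m hm t ht => ?_⟩
  rw [hc ⟨m, hm⟩ t ht]
  simp [hm]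

/-! ### The components without monodromy at the conifold point -/

/-- The function `-(log v)^(m+1) / ((m+1)! (v - 1))`, extended to `v = 1`. -/
def jumpKernel (m : ℕ) (v : ℂ) : ℂ :=
  -(Complex.log v ^ m * dslope Complex.log 1 v) / ((m + 1).factorial : ℂ)

lemma jumpKernel_eq {m : ℕ} {v : ℂ} (hv : v ≠ 1) :
    jumpKernel m v = Complex.log v ^ (m + 1) / ((m + 1).factorial : ℂ) * (1 - v)⁻¹ := by
  have h1 : v - 1 ≠ 0 := sub_ne_zero.mpr hv
  have h2 : 1 - v ≠ 0 := sub_ne_zero.mpr hv.symm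
  rw [jumpKernel, dslope_of_ne _ hv, slope_def_field, Complex.log_one, sub_zero,
    ← neg_sub v 1, inv_neg, pow_succ]
  field_simp

/-- The zero of the logarithm at `v = 1` removes the pole of `1 / (1 - v)`. This needs at least one
logarithm, which is why the exponent in the kernel is `m + 1`. -/
lemma differentiableOn_jumpKernel (m : ℕ) :
    DifferentiableOn ℂ (jumpKernel m) Complex.slitPlane := by
  have hl : DifferentiableOn ℂ Complex.log Complex.slitPlane := fun v hv =>
    (Complex.differentiableAt_log hv).differentiableWithinAt
  have hd : DifferentiableOn ℂ (dslope Complex.log 1) Complex.slitPlane :=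
    (Complex.differentiableOn_dslope (Complex.isOpen_slitPlane.mem_nhds
      Complex.one_mem_slitPlane)).mpr hl
  exact (((hl.pow m).mul hd).neg).div_const _

/-- Within distance `1/2` of `1` the difference quotient is at most `3/2`; further away the
denominator is at least `1/2`. -/
lemma norm_dslope_log_le {v : ℂ} (hv : v ∈ Complex.slitPlane) :
    ‖dslope Complex.log 1 v‖ ≤ 2 * (‖Complex.log v‖ + 1) := by
  rcases eq_or_ne v 1 with rfl | hne
  · rw [dslope_same, (Complex.hasDerivAt_log hv).deriv]; simp
  have h1 : 0 < ‖v - 1‖ := norm_pos_iff.mpr (sub_ne_zero.mpr hne)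
  rw [dslope_of_ne _ hne, slope_def_field, Complex.log_one, sub_zero, norm_div, div_le_iff₀ h1]
  rcases le_total ‖v - 1‖ (1 / 2) with h | h
  · have h2 := Complex.norm_log_one_add_half_le_self (z := v - 1) h
    rw [add_sub_cancel] at h2
    nlinarith [norm_nonneg (Complex.log v)]
  · nlinarith [norm_nonneg (Complex.log v)]

lemma norm_jumpKernel_le {m : ℕ} {v : ℂ} (hv : v ∈ Complex.slitPlane) :
    ‖jumpKernel m v‖ ≤ 2 * (‖Complex.log v‖ + 1) ^ (m + 1) := by
  rw [jumpKernel, norm_div, norm_neg, norm_mul, norm_pow, Complex.norm_natCast, pow_succ]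
  have h1 : (1 : ℝ) ≤ ((m + 1).factorial : ℝ) := by exact_mod_cast (m + 1).factorial_pos
  refine (div_le_self (by positivity) h1).trans ?_
  have h3 : ‖Complex.log v‖ ^ m ≤ (‖Complex.log v‖ + 1) ^ m := by gcongr; linarith
  calc _ ≤ (‖Complex.log v‖ + 1) ^ m * (2 * (‖Complex.log v‖ + 1)) :=
        mul_le_mul h3 (norm_dslope_log_le hv) (norm_nonneg _) (by positivity)
    _ = _ := by ring

lemma mul_ofReal_mem_slitPlane {w : ℂ} (hw : w ∈ Complex.slitPlane) {u : ℝ} (hu : 0 < u) :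
    w * u ∈ Complex.slitPlane := by
  rcases Complex.mem_slitPlane_iff.mp hw with h | h
  · exact Complex.mem_slitPlane_iff.mpr (Or.inl (by simpa using mul_pos h hu))
  · exact Complex.mem_slitPlane_iff.mpr (Or.inr (by simpa using ⟨h, hu.ne'⟩))

lemma log_mul_ofReal' {w : ℂ} (hw : w ≠ 0) {u : ℝ} (hu : 0 < u) :
    Complex.log (w * u) = Complex.log w + Real.log u := by
  rw [mul_comm, Complex.log_ofReal_mul hu hw, add_comm]

lemma integrable_log_pow {n : ℕ} (hn : n ≠ 0) {B : ℝ} (hB : 0 ≤ B) (m : ℕ) :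
    Integrable (fun u : ℝ => (B + |Real.log u|) ^ m) (eulerMeasure n) := by
  have hr := expRadius_pos n
  refine Integrable.mono' ((integrable_negMoment n).const_mul
    ((m.factorial : ℝ) * (expRadius n)⁻¹ ^ m * Real.exp (expRadius n * B)))
    (by fun_prop) ?_
  filter_upwards [eulerMeasure_ae_mem_Ioo hn] with u hu
  have hl : Real.log u ≤ 0 := Real.log_nonpos hu.1.le hu.2.le
  rw [abs_of_nonpos hl]
  have h0 : 0 ≤ B + -Real.log u := by linarith
  have := Real.pow_div_factorial_le_exp (expRadius n * (B + -Real.log u)) (by positivity) m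
  rw [Real.norm_of_nonneg (by positivity), mul_assoc, ← Real.exp_add]
  rw [div_le_iff₀ (by positivity), mul_pow] at this
  calc (B + -Real.log u) ^ m = (expRadius n)⁻¹ ^ m *
        (expRadius n ^ m * (B + -Real.log u) ^ m) := by
        rw [← mul_assoc, ← mul_pow, inv_mul_cancel₀ hr.ne', one_pow, one_mul]
    _ ≤ (expRadius n)⁻¹ ^ m * (Real.exp (expRadius n * (B + -Real.log u)) * m.factorial) := by
        gcongr
    _ = _ := by ring_nf

/-- The coefficients of positive index of `(C t)^ε ∫ u^ε / (1 - C t u)`, in the variable `C t`. -/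
def jumpIntegral (n m : ℕ) (w : ℂ) : ℂ := ∫ u : ℝ, jumpKernel m (w * u) ∂eulerMeasure n

/-- Unlike `psi`, which needs the cut `[1, ∞)`, this integral crosses it: only the cut of the
logarithm remains. The bound by powers of `|log u|` is integrable against the Euler measure. -/
lemma differentiableOn_jumpIntegral {n : ℕ} (hn : n ≠ 0) (m : ℕ) :
    DifferentiableOn ℂ (jumpIntegral n m) Complex.slitPlane := by
  have hres : (eulerMeasure n).restrict (Set.Ioo 0 1) = eulerMeasure n :=
    Measure.restrict_eq_self_of_ae_mem (eulerMeasure_ae_mem_Ioo hn)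
  refine differentiableOn_integral_of_dominated (fun z hz => ?_) ?_ ?_
  · rw [← hres]
    refine ContinuousOn.aestronglyMeasurable (fun u hu => ?_) measurableSet_Ioo
    have h1 := ((differentiableOn_jumpKernel m).differentiableAt
      (Complex.isOpen_slitPlane.mem_nhds (mul_ofReal_mem_slitPlane hz hu.1))).continuousAt
    exact (ContinuousAt.comp (f := fun u : ℝ => z * u) h1 (by fun_prop)).continuousWithinAt
  · filter_upwards [eulerMeasure_ae_mem_Ioo hn] with u hu
    exact (differentiableOn_jumpKernel m).comp (by fun_prop)
      fun z hz => mul_ofReal_mem_slitPlane hz hu.1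
  · intro w₀ hw₀
    obtain ⟨δ, hδ, hsub⟩ := Metric.nhds_basis_closedBall.mem_iff.mp
      (Complex.isOpen_slitPlane.mem_nhds hw₀)
    obtain ⟨B, hB⟩ := (isCompact_closedBall w₀ δ).exists_bound_of_continuousOn
      (f := Complex.log) (fun w hw => (Complex.differentiableAt_log
        (hsub hw)).continuousAt.continuousWithinAt)
    refine ⟨δ, hδ, Metric.ball_subset_closedBall.trans hsub,
      fun u => 2 * (|B| + 1 + |Real.log u|) ^ (m + 1),
      (integrable_log_pow hn (by positivity) (m + 1)).const_mul 2, ?_⟩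
    filter_upwards [eulerMeasure_ae_mem_Ioo hn] with u hu z hz
    have hz' := Metric.ball_subset_closedBall hz
    refine (norm_jumpKernel_le (mul_ofReal_mem_slitPlane (hsub hz') hu.1)).trans ?_
    have h1 : ‖Complex.log (z * u)‖ ≤ |B| + |Real.log u| := by
      rw [log_mul_ofReal' (Complex.slitPlane_ne_zero (hsub hz')) hu.1]
      refine (norm_add_le _ _).trans (add_le_add ((hB z hz').trans (le_abs_self B)) ?_)
      rw [Complex.norm_real, Real.norm_eq_abs]
    have h2 : ‖Complex.log (z * u)‖ + 1 ≤ |B| + 1 + |Real.log u| := by linarith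
    exact mul_le_mul_of_nonneg_left (pow_le_pow_left₀ (by positivity) h2 _) (by norm_num)

/-- Since `w^ε u^ε = (w u)^ε`, the Cauchy product collects into a power of `log (w u)`. -/
lemma coeff_succ_eq_jumpIntegral {n : ℕ} (hn : n ≠ 0) (m : ℕ) {w : ℂ} (hw0 : w ≠ 0)
    (hw : w ∈ cutPlane) :
    PowerSeries.coeff (m + 1) (expSeries (Complex.log w) * psiSeries n w) =
      jumpIntegral n m w := by
  obtain ⟨δ, hδ, -, B, hB⟩ := exists_bound_kernel hw
  have hint : ∀ i, Integrable (fun u : ℝ => logPow i u * (1 - w * u)⁻¹) (eulerMeasure n) :=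
    fun i => integrable_logPow_mul hn i (measurable_kernel w).aestronglyMeasurable
      fun u hu => hB u (Set.Ioo_subset_Icc_self hu) w (Metric.mem_ball_self hδ)
  rw [PowerSeries.coeff_mul, jumpIntegral]
  simp only [psiSeries, PowerSeries.coeff_mk, psi]
  simp_rw [← integral_const_mul]
  rw [← integral_finsetSum _ fun p _ => (hint p.2).const_mul _]
  refine integral_congr_ae ?_
  filter_upwards [eulerMeasure_ae_mem_Ioo hn] with u hu
  have h1 : w * u ≠ 1 := fun h => one_sub_mul_ne_zero hw (Set.Ioo_subset_Icc_self hu) (by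
    rw [h, sub_self])
  rw [jumpKernel_eq h1, log_mul_ofReal' hw0 hu.1, ← coeff_expSeries, expSeries_add,
    PowerSeries.coeff_mul, Finset.sum_mul]
  refine Finset.sum_congr rfl fun p _ => ?_
  rw [coeff_expSeries _ p.2, logPow]
  ring

/-! ### The transition coefficients -/

lemma log_neg_of_im_neg {t : ℂ} (ht : t.im < 0) :
    Complex.log (-t) = Complex.log t + Real.pi * Complex.I := by
  rw [Complex.log, Complex.log, norm_neg, Complex.arg_neg_eq_arg_add_pi_of_im_neg ht]
  push_cast
  ring

lemma log_neg_of_im_pos {t : ℂ} (ht : 0 < t.im) :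
    Complex.log (-t) = Complex.log t - Real.pi * Complex.I := by
  rw [Complex.log, Complex.log, norm_neg, Complex.arg_neg_eq_arg_sub_pi_of_im_pos ht]
  push_cast
  ring

lemma series_eq_of_im_neg {n : ℕ} {t : ℂ} (ht : t.im < 0) :
    expSeries (Complex.log t) * psiSeries n (scale n * t) =
      expSeries (-(Real.pi * Complex.I)) * negSeries n t := by
  rw [negSeries, ← mul_assoc, ← expSeries_add, log_neg_of_im_neg ht]
  congr 2; ring

lemma series_eq_of_im_pos {n : ℕ} {t : ℂ} (ht : 0 < t.im) :
    expSeries (Complex.log t) * psiSeries n (scale n * t) =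
      expSeries (Real.pi * Complex.I) * negSeries n t := by
  rw [negSeries, ← mul_assoc, ← expSeries_add, log_neg_of_im_pos ht]
  congr 2; ring

lemma infSolution_neg_of_im_neg {n : ℕ} (k : Fin n) {t : ℂ} (ht : t.im < 0) :
    infSolution n k (fun t => Complex.log (-t)) t =
      Complex.exp (-(Real.pi * Complex.I * rho n k)) * infSolution n k Complex.log t := by
  rw [infSolution, infSolution, log_neg_of_im_neg ht, ← mul_assoc, ← Complex.exp_add]
  congr 2; ring

lemma infSolution_neg_of_im_pos {n : ℕ} (k : Fin n) {t : ℂ} (ht : 0 < t.im) :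
    infSolution n k (fun t => Complex.log (-t)) t =
      Complex.exp (Real.pi * Complex.I * rho n k) * infSolution n k Complex.log t := by
  rw [infSolution, infSolution, log_neg_of_im_pos ht, ← mul_assoc, ← Complex.exp_add]
  congr 2; ring

lemma coeff_mul_sum {n : ℕ} {a : Fin n → PowerSeries ℂ} {G : PowerSeries ℂ} {g : Fin n → ℂ}
    (h : ∀ m < n, PowerSeries.coeff m G = ∑ k, PowerSeries.coeff m (a k) * g k)
    (A : PowerSeries ℂ) {m : ℕ} (hm : m < n) :
    PowerSeries.coeff m (A * G) = ∑ k, PowerSeries.coeff m (A * a k) * g k := by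
  simp only [PowerSeries.coeff_mul, Finset.sum_mul]
  rw [Finset.sum_comm]
  refine Finset.sum_congr rfl fun p hp => ?_
  rw [Finset.HasAntidiagonal.mem_antidiagonal] at hp
  rw [h p.2 (by omega), Finset.mul_sum]
  exact Finset.sum_congr rfl fun k _ => by ring

/-- The Taylor series of `-2 i sin (π (ρ_k + ε))`. -/
def sinSeries (n : ℕ) (k : Fin n) : PowerSeries ℂ :=
  PowerSeries.C (Complex.exp (-(Real.pi * Complex.I * rho n k))) *
      expSeries (-(Real.pi * Complex.I)) -
    PowerSeries.C (Complex.exp (Real.pi * Complex.I * rho n k)) * expSeries (Real.pi * Complex.I)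

lemma mem_slitExterior_of_im {n : ℕ} {t : ℂ} (ht : t.im ≠ 0) (h : 1 / scale n < ‖t‖) :
    t ∈ slitExterior n ∧ t ∈ negExterior n :=
  ⟨⟨h, Complex.mem_slitPlane_iff.mpr (Or.inr ht)⟩,
    (by rwa [Set.mem_ofPred_eq, norm_neg] : -t ∈ {t | 1 / scale n < ‖t‖}),
    Complex.mem_slitPlane_iff.mpr (Or.inr (by simpa using ht))⟩

lemma norm_pi_mul_I {n : ℕ} {s : ℝ} (hs : |s| = 1) :
    1 / scale n < ‖((2 * (1 / scale n) * s : ℝ) : ℂ) * Complex.I‖ := by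
  have := inv_scale_pos n
  rw [norm_mul, Complex.norm_real, Complex.norm_I, Real.norm_eq_abs, abs_mul, hs,
    abs_of_pos (by positivity)]
  linarith

/-- The key step. Coefficients of positive degree do not jump across `(1/C, ∞)`, so their expansions
at infinity obtained from below and from above agree. Passing from `log (-t)` to `log t` multiplies
the terms by `e^(∓πi(ρ_k+ε))`, and the difference of the two factors is the sine. -/
theorem coeff_connection_mul_sin {n : ℕ} (hn : n ≠ 0) {a : Fin n → PowerSeries ℂ}
    (ha : ∀ m < n, ∀ t ∈ negExterior n, PowerSeries.coeff m (negSeries n t) =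
      ∑ k, PowerSeries.coeff m (a k) * infSolution n k (fun t => Complex.log (-t)) t)
    (k : Fin n) {m : ℕ} (hm : m + 1 < n) :
    PowerSeries.coeff (m + 1) (expSeries (Real.log (scale n)) * (sinSeries n k * a k)) = 0 := by
  have hC := scale_pos n
  have hlog : ∀ t ∈ slitExterior n, Complex.log (scale n * t) =
      Real.log (scale n) + Complex.log t := fun t ht =>
    Complex.log_ofReal_mul hC (Complex.slitPlane_ne_zero ht.2)
  have hJ : DifferentiableOn ℂ (fun t => jumpIntegral n m (scale n * t)) (slitExterior n) :=
    (differentiableOn_jumpIntegral hn m).comp (by fun_prop) fun t ht => by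
      rw [mul_comm]; exact mul_ofReal_mem_slitPlane ht.2 hC
  have hG : ∀ b : Fin n → ℂ, DifferentiableOn ℂ
      (fun t => ∑ k, b k * infSolution n k Complex.log t) (slitExterior n) := fun b =>
    DifferentiableOn.fun_sum fun k _ =>
      (differentiableOn_infSolution k (isLogChart_slitExterior n)).const_mul _
  -- The sign `s` selects a half plane. The identity found there extends to the whole slit exterior,
  -- since both sides are holomorphic across the positive axis.
  have hside : ∀ (s : ℝ) (e : ℂ) (E : Fin n → ℂ), |s| = 1 →
      (∀ t : ℂ, 0 < s * t.im → expSeries (Complex.log t) * psiSeries n (scale n * t) =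
        expSeries e * negSeries n t) →
      (∀ k, ∀ t : ℂ, 0 < s * t.im → infSolution n k (fun t => Complex.log (-t)) t =
        E k * infSolution n k Complex.log t) →
      ∀ t ∈ slitExterior n, jumpIntegral n m (scale n * t) =
        ∑ k, PowerSeries.coeff (m + 1) (expSeries (Real.log (scale n)) * expSeries e * a k) *
          E k * infSolution n k Complex.log t := by
    intro s e E hs h1 h2
    have hs1 : s * s = 1 := by rw [← abs_mul_abs_self, hs, one_mul]
    have him : (((2 * (1 / scale n) * s : ℝ) : ℂ) * Complex.I).im = 2 * (1 / scale n) * s := by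
      simp
    have him0 : 0 < s * (((2 * (1 / scale n) * s : ℝ) : ℂ) * Complex.I).im := by
      rw [him]
      have := inv_scale_pos n
      nlinarith
    have hne : ∀ t : ℂ, 0 < s * t.im → t.im ≠ 0 := fun t ht h => by simp [h] at ht
    refine eqOn_of_eqOn_open (isOpen_slitExterior n) (isPreconnected_slitExterior n)
      (V := {t | 0 < s * t.im} ∩ {t | 1 / scale n < ‖t‖})
      (IsOpen.inter (isOpen_lt continuous_const (continuous_const.mul Complex.continuous_im))
        (isOpen_lt continuous_const continuous_norm)) hJ (hG _)
      (mem_slitExterior_of_im (hne _ him0) (norm_pi_mul_I hs)).1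
      ⟨him0, norm_pi_mul_I hs⟩ fun t ht => ?_
    obtain ⟨hp, hn'⟩ := mem_slitExterior_of_im (hne t ht.1) ht.2
    rw [← coeff_succ_eq_jumpIntegral hn m (mul_ne_zero (scale_ne_zero n)
      (Complex.slitPlane_ne_zero hp.2)) (scale_mul_mem_cutPlane_of_im (hne t ht.1)),
      hlog t hp, expSeries_add, mul_assoc, h1 t ht.1, ← mul_assoc,
      coeff_mul_sum (fun m hm => ha m hm t hn') _ hm]
    exact Finset.sum_congr rfl fun k _ => by rw [h2 k t ht.1]; ring
  have hlow := hside (-1) (-(Real.pi * Complex.I))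
    (fun k => Complex.exp (-(Real.pi * Complex.I * rho n k))) (by simp)
    (fun t ht => series_eq_of_im_neg (by linarith))
    (fun k t ht => infSolution_neg_of_im_neg k (by linarith))
  have hup := hside 1 (Real.pi * Complex.I)
    (fun k => Complex.exp (Real.pi * Complex.I * rho n k)) (by simp)
    (fun t ht => series_eq_of_im_pos (by linarith))
    (fun k t ht => infSolution_neg_of_im_pos k (by linarith))
  have hzero := infSolution_independent n (L := Complex.log) (s := 1)
    (c := fun k => PowerSeries.coeff (m + 1)
      (expSeries (Real.log (scale n)) * (sinSeries n k * a k)))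
    (fun x hx => by simp [Complex.ofReal_log hx.le]) (by
      filter_upwards [eventually_gt_atTop (1 / scale n)] with x hx
      have h0 := (inv_scale_pos n).trans hx
      have hmem : (1 * x : ℂ) ∈ slitExterior n :=
        ⟨by simpa [abs_of_pos h0] using hx,
          Complex.mem_slitPlane_iff.mpr (Or.inl (by simpa using h0))⟩
      have h3 := (hlow _ hmem).symm.trans (hup _ hmem)
      rw [← sub_eq_zero, ← Finset.sum_sub_distrib] at h3
      rw [← h3]
      refine Finset.sum_congr rfl fun k _ => ?_
      rw [← sub_mul]
      congr 1
      rw [sinSeries, show expSeries (Real.log (scale n)) * ((PowerSeries.C (Complex.exp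
        (-(Real.pi * Complex.I * rho n k))) * expSeries (-(Real.pi * Complex.I)) -
        PowerSeries.C (Complex.exp (Real.pi * Complex.I * rho n k)) *
          expSeries (Real.pi * Complex.I)) * a k) =
        PowerSeries.C (Complex.exp (-(Real.pi * Complex.I * rho n k))) *
          (expSeries (Real.log (scale n)) * expSeries (-(Real.pi * Complex.I)) * a k) -
        PowerSeries.C (Complex.exp (Real.pi * Complex.I * rho n k)) *
          (expSeries (Real.log (scale n)) * expSeries (Real.pi * Complex.I) * a k) by ring,
        map_sub, PowerSeries.coeff_C_mul, PowerSeries.coeff_C_mul]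
      ring)
  exact congrFun hzero k

/-! ### The transition matrix -/

/-- The Taylor series of `C^(-ε) B_k(ε)`. -/
def transitionSeries (n : ℕ) (k : Fin n) : PowerSeries ℂ :=
  jet fun ε => (scale n : ℂ) ^ (-ε) * transitionFun n k ε

lemma sin_rho_ne_zero (n : ℕ) (k : Fin n) : Complex.sin (Real.pi * rho n k) ≠ 0 := by
  rw [rho_eq_ofReal, ← Complex.ofReal_mul, ← Complex.ofReal_sin, Complex.ofReal_ne_zero]
  refine (Real.sin_pos_of_pos_of_lt_pi (mul_pos Real.pi_pos (rhoReal_pos n k)) ?_).ne'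
  nlinarith [Real.pi_pos, rhoReal_lt_one n k]

lemma neg_two_I_sin (z : ℂ) : -2 * Complex.I * Complex.sin z =
    Complex.exp (-(z * Complex.I)) - Complex.exp (z * Complex.I) := by
  rw [Complex.sin]
  have := Complex.I_mul_I
  linear_combination (-(Complex.exp (-z * Complex.I) - Complex.exp (z * Complex.I))) * this +
    congrArg Complex.exp (neg_mul z Complex.I)

lemma sinSeries_eq_jet (n : ℕ) (k : Fin n) : sinSeries n k =
    jet fun ε => -2 * Complex.I * Complex.sin (Real.pi * rho n k + Real.pi * ε) := by
  have h1 : ∀ c e : ℂ, jet (fun z => c * Complex.exp (e * z)) =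
      PowerSeries.C c * expSeries e := fun c e => by
    rw [jet_mul (by fun_prop) (by fun_prop), jet_const, jet_exp]
  have h2 : ∀ f g : ℂ → ℂ, AnalyticAt ℂ f 0 → AnalyticAt ℂ g 0 →
      jet (fun z => f z - g z) = jet f - jet g := fun f g hf hg => by
    ext i
    rw [map_sub, coeff_jet, coeff_jet, coeff_jet,
      iteratedDeriv_fun_sub hf.contDiffAt hg.contDiffAt, sub_div]
  rw [sinSeries, ← h1, ← h1, ← h2 _ _ (by fun_prop) (by fun_prop)]
  congr 1
  funext ε
  rw [neg_two_I_sin, ← Complex.exp_add, ← Complex.exp_add]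
  congr 2 <;> ring

lemma transitionFun_eq (n : ℕ) (k : Fin n) (ε : ℂ) : transitionFun n k ε =
    Complex.exp (-(Real.pi * Complex.I) * ε) * (moment n ε)⁻¹ *
      (Complex.sin (Real.pi * rho n k) / Complex.sin (Real.pi * rho n k + Real.pi * ε)) := by
  rw [transitionFun, moment, ← Finset.prod_inv_distrib]
  simp only [inv_div, neg_mul]

lemma analyticAt_sin_div (n : ℕ) (k : Fin n) : AnalyticAt ℂ (fun ε : ℂ =>
    Complex.sin (Real.pi * rho n k) / Complex.sin (Real.pi * rho n k + Real.pi * ε)) 0 := by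
  refine AnalyticAt.fun_div (by fun_prop) (by fun_prop) ?_
  simpa using sin_rho_ne_zero n k

/-- Multiplying by the sine clears the only denominator of `B_k` that depends on `k`. -/
lemma transitionSeries_mul_sinSeries {n : ℕ} (hn : n ≠ 0) (k : Fin n) :
    transitionSeries n k * sinSeries n k =
      PowerSeries.C (-2 * Complex.I * Complex.sin (Real.pi * rho n k)) *
        (normSeries n * (expSeries (-(Real.pi * Complex.I)) *
          expSeries (-(Real.log (scale n) : ℂ)))) := by
  have hs := analyticAt_sin_div n k
  have hi := analyticAt_inv_moment hn
  have h1 : (fun ε => (scale n : ℂ) ^ (-ε) * transitionFun n k ε) = fun ε =>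
      Complex.exp (-(Real.log (scale n) : ℂ) * ε) *
      (Complex.exp (-(Real.pi * Complex.I) * ε) * ((moment n ε)⁻¹ *
      (Complex.sin (Real.pi * rho n k) / Complex.sin (Real.pi * rho n k + Real.pi * ε)))) := by
    funext ε
    rw [transitionFun_eq, Complex.cpow_def_of_ne_zero (scale_ne_zero n),
      ← Complex.ofReal_log (scale_pos n).le, mul_assoc (Complex.exp (-(Real.pi * Complex.I) * ε))]
    congr 2; ring
  rw [transitionSeries, h1, jet_mul (by fun_prop) (by fun_prop),
    jet_mul (by fun_prop) (by fun_prop), jet_mul hi hs, jet_exp, jet_exp, sinSeries_eq_jet,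
    normSeries]
  have h2 : jet (fun ε => Complex.sin (Real.pi * rho n k) /
        Complex.sin (Real.pi * rho n k + Real.pi * ε)) *
      jet (fun ε => -2 * Complex.I * Complex.sin (Real.pi * rho n k + Real.pi * ε)) =
      PowerSeries.C (-2 * Complex.I * Complex.sin (Real.pi * rho n k)) := by
    rw [← jet_mul hs (by fun_prop), ← jet_const]
    refine jet_congr ?_
    have hc : ContinuousAt (fun ε : ℂ => Complex.sin (Real.pi * rho n k + Real.pi * ε)) 0 := by
      fun_prop
    have := hc.eventually_ne (y := 0) (by simpa using sin_rho_ne_zero n k)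
    filter_upwards [this] with ε hε
    rw [div_mul_eq_mul_div, mul_left_comm, ← mul_assoc, mul_div_assoc, div_self hε, mul_one]
  linear_combination (expSeries (-(Real.log (scale n) : ℂ)) * expSeries (-(Real.pi * Complex.I)) *
    jet fun z => (moment n z)⁻¹) * h2

lemma constantCoeff_sinSeries_ne_zero (n : ℕ) (k : Fin n) :
    PowerSeries.constantCoeff (sinSeries n k) ≠ 0 := by
  rw [sinSeries_eq_jet, ← PowerSeries.coeff_zero_eq_constantCoeff_apply, coeff_jet]
  simpa using sin_rho_ne_zero n k

/-- Modulo degree `n` the product `C^ε sin(π(ρ_k+ε)) a_k` is constant, so solving for `a_k` gives a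
multiple of the `k`-th transition series. The multiples `γ` need not be computed. -/
theorem exists_transition {n : ℕ} (hn : n ≠ 0) : ∃ γ : Fin n → ℂ,
    ∀ m < n, ∀ t ∈ negExterior n,
      PowerSeries.coeff m (normSeries n * (expSeries (-(Real.pi * Complex.I)) * negSeries n t)) =
      ∑ k, PowerSeries.coeff m (transitionSeries n k) *
        (γ k * infSolution n k (fun t => Complex.log (-t)) t) := by
  obtain ⟨a, ha⟩ := exists_connection hn
  set s : Fin n → ℂ := fun k => -2 * Complex.I * Complex.sin (Real.pi * rho n k) with hs
  have hs0 : ∀ k, s k ≠ 0 := fun k => mul_ne_zero (by simp) (sin_rho_ne_zero n k)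
  set g : Fin n → ℂ := fun k => PowerSeries.coeff 0
    (expSeries (Real.log (scale n)) * (sinSeries n k * a k)) with hg
  -- Only the coefficient of degree `0` is left undetermined by the absence of a jump.
  have h1 : ∀ k, ∀ m < n, PowerSeries.coeff m
      (expSeries (Real.log (scale n)) * (sinSeries n k * a k)) =
      PowerSeries.coeff m (PowerSeries.C (g k)) := by
    intro k m hm
    rcases m with _ | m
    · rw [PowerSeries.coeff_zero_C]
    · rw [coeff_connection_mul_sin hn ha k hm, PowerSeries.coeff_C, if_neg (by omega)]
  refine ⟨fun k => g k / s k, fun m hm t ht => ?_⟩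
  rw [← mul_assoc, coeff_mul_sum (fun m hm => ha m hm t ht) _ hm]
  refine Finset.sum_congr rfl fun k _ => ?_
  rw [← mul_assoc]
  congr 1
  have hE : expSeries (-(Real.log (scale n) : ℂ)) * expSeries (Real.log (scale n)) = 1 := by
    rw [← expSeries_add, neg_add_cancel, expSeries_zero]
  have hS := PowerSeries.mul_inv_cancel _ (constantCoeff_sinSeries_ne_zero n k)
  have hT := transitionSeries_mul_sinSeries hn k
  have e1 : normSeries n * expSeries (-(Real.pi * Complex.I)) * a k =
      ((sinSeries n k)⁻¹ * (normSeries n * (expSeries (-(Real.pi * Complex.I)) *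
        expSeries (-(Real.log (scale n) : ℂ))))) *
        (expSeries (Real.log (scale n)) * (sinSeries n k * a k)) := by
    linear_combination (-(normSeries n * expSeries (-(Real.pi * Complex.I)) * a k *
      (sinSeries n k * (sinSeries n k)⁻¹))) * hE -
      (normSeries n * expSeries (-(Real.pi * Complex.I)) * a k) * hS
  have e2 : ((sinSeries n k)⁻¹ * (normSeries n * (expSeries (-(Real.pi * Complex.I)) *
        expSeries (-(Real.log (scale n) : ℂ))))) * PowerSeries.C (g k) =
      PowerSeries.C (g k / s k) * transitionSeries n k := by
    have e3 : PowerSeries.C (g k) = PowerSeries.C (g k / s k) * PowerSeries.C (s k) := by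
      rw [← map_mul, div_mul_cancel₀ _ (hs0 k)]
    rw [e3]
    linear_combination (-((sinSeries n k)⁻¹ * PowerSeries.C (g k / s k))) * hT +
      (PowerSeries.C (g k / s k) * transitionSeries n k) * hS
  rw [e1, coeff_mul_congr (h1 k) hm, e2, PowerSeries.coeff_C_mul, mul_comm]

/-! ### Normalized coefficient vectors -/

/-- The coefficients of `(2 π i ε)^m`, in decreasing order of `m`. -/
def coeffVector (n : ℕ) (G : PowerSeries ℂ) : Fin n → ℂ := fun i =>
  PowerSeries.coeff (i.rev : ℕ) G / twoPiI ^ (i.rev : ℕ)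

lemma frobeniusBasis_eq_coeffVector {n : ℕ} (i : Fin n) {t : ℂ} (ht : t ∈ slitDisc n) :
    frobeniusBasis n i t = coeffVector n (frobSeries n t) i := frobeniusBasis_eq i ht

lemma transitionMatrix_apply (n : ℕ) (i c : Fin n) :
    transitionMatrix n i c = coeffVector n (transitionSeries n c.rev) i := by
  rw [transitionMatrix, Matrix.of_apply, coeffVector, transitionSeries, coeff_jet, div_div,
    mul_comm (twoPiI ^ _)]

lemma coeffVector_exp_mul (n : ℕ) (G : PowerSeries ℂ) :
    coeffVector n (expSeries twoPiI * G) = (monodromyZero n).mulVec (coeffVector n G) := by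
  funext i
  rw [coeffVector, coeff_mul_eq_sum, Matrix.mulVec, dotProduct, ← Equiv.sum_comp Fin.revPerm,
    Finset.sum_div]
  refine Finset.sum_congr rfl fun j _ => ?_
  rw [Fin.revPerm_apply]
  simp only [toeplitz, Matrix.of_apply, monodromyZero, coeffVector]
  have h1 : ((j.rev : Fin n) : ℕ) ≤ (i.rev : Fin n) ↔ i ≤ j := by
    rw [Fin.val_fin_le, Fin.rev_le_rev]
  by_cases hij : i ≤ j
  · rw [if_pos (h1.mpr hij), if_pos hij, coeff_expSeries]
    have h2 : (i.rev : ℕ) = ((j : ℕ) - i) + j.rev := by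
      have := Fin.val_fin_le.mpr hij
      have := j.2
      rw [Fin.val_rev, Fin.val_rev]; omega
    have h3 : (i.rev : ℕ) - (j.rev : ℕ) = (j : ℕ) - i := by omega
    rw [h3, h2, pow_add]
    have := twoPiI_ne_zero
    field_simp
  · rw [if_neg (fun h => hij (h1.mp h)), if_neg hij]
    simp

lemma isUnit_det_monodromyZero (n : ℕ) : IsUnit (monodromyZero n).det := by
  rw [Matrix.det_of_isUpperTriangular (M := monodromyZero n) fun i j hij => by
    simp only [monodromyZero, Matrix.of_apply]
    exact if_neg (not_le.mpr hij)]
  simp [monodromyZero]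

/-- The factor by which the branches of `t^(-ρ)` for `log (-t)` and `log t` differ. -/
def infinityInverse (n : ℕ) : Matrix (Fin n) (Fin n) ℂ :=
  Matrix.diagonal fun c => Complex.exp (twoPiI * rho n c.rev)

lemma localInfinity_mul_inverse (n : ℕ) : localInfinity n * infinityInverse n = 1 := by
  rw [localInfinity, infinityInverse, Matrix.diagonal_mul_diagonal, ← Matrix.diagonal_one]
  congr 1
  funext c
  rw [← Complex.exp_add, neg_add_cancel, Complex.exp_zero]

/-- The solutions at infinity on the slit exterior, with the constants `γ`. -/
def infVector (n : ℕ) (γ : Fin n → ℂ) (t : ℂ) : Fin n → ℂ := fun c =>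
  γ c * infSolution n c.rev Complex.log t

/-- The factor `e^(-πiε)` in `B_k` is the one that appears on passing to `log t` from below, so
there the matrix is `P` itself. From above, `ε` and `ρ` pick up the extra factors `e^(2πiε)` and
`e^(2πiρ)`, which are `m₀` and `M_∞⁻¹`. -/
theorem exists_infVector {n : ℕ} (hn : n ≠ 0) : ∃ γ : Fin n → ℂ,
    (∀ t ∈ slitExterior n, t.im < 0 →
      coeffVector n (frobSeries n t) = (transitionMatrix n).mulVec (infVector n γ t)) ∧
    (∀ t ∈ slitExterior n, 0 < t.im → coeffVector n (frobSeries n t) =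
      (monodromyZero n).mulVec ((transitionMatrix n).mulVec
        ((infinityInverse n).mulVec (infVector n γ t)))) := by
  obtain ⟨γ, hγ⟩ := exists_transition hn
  have h1 : ∀ t ∈ negExterior n, coeffVector n (normSeries n *
      (expSeries (-(Real.pi * Complex.I)) * negSeries n t)) =
      (transitionMatrix n).mulVec fun c =>
        γ c.rev * infSolution n c.rev (fun t => Complex.log (-t)) t := by
    intro t ht
    funext i
    rw [coeffVector, hγ _ i.rev.2 t ht, Matrix.mulVec, dotProduct, ← Equiv.sum_comp Fin.revPerm,
      Finset.sum_div]
    refine Finset.sum_congr rfl fun c _ => ?_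
    rw [transitionMatrix_apply, coeffVector, Fin.revPerm_apply]
    ring
  refine ⟨fun c => γ c.rev * Complex.exp (-(Real.pi * Complex.I * rho n c.rev)),
    fun t ht him => ?_, fun t ht him => ?_⟩
  · rw [frobSeries, series_eq_of_im_neg him, h1 t (mem_slitExterior_of_im him.ne ht.1).2]
    congr 1
    funext c
    rw [infSolution_neg_of_im_neg _ him, infVector]
    ring
  · have h2 : frobSeries n t = expSeries twoPiI * (normSeries n *
        (expSeries (-(Real.pi * Complex.I)) * negSeries n t)) := by
      have h3 : expSeries (Real.pi * Complex.I) =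
          expSeries twoPiI * expSeries (-(Real.pi * Complex.I)) := by
        rw [← expSeries_add, twoPiI]; congr 1; ring
      rw [frobSeries, series_eq_of_im_pos him, h3]
      ring
    rw [h2, coeffVector_exp_mul, h1 t (mem_slitExterior_of_im him.ne' ht.1).2]
    congr 2
    funext c
    rw [infSolution_neg_of_im_pos _ him, infinityInverse, Matrix.mulVec_diagonal, infVector]
    have h4 : Complex.exp (Real.pi * Complex.I * rho n c.rev) =
        Complex.exp (twoPiI * rho n c.rev) *
          Complex.exp (-(Real.pi * Complex.I * rho n c.rev)) := by
      rw [← Complex.exp_add, twoPiI]; congr 1; ring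
    rw [h4]
    ring

/-- A left kernel vector of `P` would be a linear relation among the Frobenius functions in the
lower half plane, hence on the slit disc. Nothing about the constants `γ` is needed. -/
theorem isUnit_det_transitionMatrix {n : ℕ} (hn : n ≠ 0) : IsUnit (transitionMatrix n).det := by
  obtain ⟨γ, hγ, -⟩ := exists_infVector hn
  by_contra hdet
  have h0 : (transitionMatrix n).det = 0 := by
    by_contra h; exact hdet (isUnit_iff_ne_zero.mpr h)
  obtain ⟨v, hv, hv0⟩ := Matrix.exists_vecMul_eq_zero_iff.mpr h0
  refine hv (frobeniusBasis_independent hn fun t ht => ?_)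
  have hU : IsOpen {t : ℂ | t.im < 0} := isOpen_lt Complex.continuous_im continuous_const
  have hUc : IsPreconnected {t : ℂ | t.im < 0} :=
    (convex_halfSpace_im_lt 0).isPreconnected
  have hd : ∀ U ⊆ doubleSlit n, DifferentiableOn ℂ
      (fun t => ∑ i, v i * coeffVector n (frobSeries n t) i) U := fun U hU =>
    DifferentiableOn.fun_sum fun i _ =>
      (((differentiableOn_frobSeries hn _).mono hU).div_const _).const_mul _
  have hlow : ∀ t ∈ {t : ℂ | t.im < 0},
      ∑ i, v i * coeffVector n (frobSeries n t) i = 0 := by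
    have hs : |(-1 : ℝ)| = 1 := by simp
    have hm : (((2 * (1 / scale n) * (-1) : ℝ) : ℂ) * Complex.I).im < 0 := by
      have := inv_scale_pos n
      simpa using this
    refine eqOn_of_eqOn_open hU hUc (V := {t | t.im < 0} ∩ {t | 1 / scale n < ‖t‖})
      (hU.inter (isOpen_lt continuous_const continuous_norm))
      (hd _ fun t ht => mem_doubleSlit_of_im (ne_of_lt ht)) (differentiableOn_const 0)
      hm ⟨hm, norm_pi_mul_I hs⟩ fun t ht => ?_
    rw [hγ t (mem_slitExterior_of_im (ne_of_lt ht.1) ht.2).1 ht.1]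
    change v ⬝ᵥ (transitionMatrix n).mulVec (infVector n γ t) = 0
    rw [Matrix.dotProduct_mulVec, hv0, zero_dotProduct]
  have hall := eqOn_of_eqOn_open (isOpen_slitDisc n) (isPreconnected_slitDisc n) hU
    (hd _ (slitDisc_subset_doubleSlit n)) (differentiableOn_const 0)
    -- A point of argument `-π/4`, lying both in the slit disc and in the lower half plane.
    (t₁ := ((1 / scale n / 2 : ℝ) : ℂ) * Complex.exp (-(Real.pi / 4 : ℝ) * Complex.I))
    ?_ ?_ hlow t ht
  · simpa only [frobeniusBasis_eq_coeffVector _ ht] using hall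
  · have h := half_mem_slitDisc n
    refine ⟨?_, Complex.mem_slitPlane_iff.mpr (Or.inl ?_)⟩
    · have h1 := h.1
      rw [mem_ball_zero_iff] at h1 ⊢
      rwa [norm_mul, ← Complex.ofReal_neg, Complex.norm_exp_ofReal_mul_I, mul_one]
    · rw [Complex.re_ofReal_mul, ← Complex.ofReal_neg, Complex.exp_ofReal_mul_I_re, Real.cos_neg,
        Real.cos_pi_div_four]
      have := inv_scale_pos n
      positivity
  · rw [Set.mem_ofPred_eq, Complex.im_ofReal_mul, ← Complex.ofReal_neg,
      Complex.exp_ofReal_mul_I_im, Real.sin_neg, Real.sin_pi_div_four]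
    have := inv_scale_pos n
    have h2 : 0 < √2 / 2 := by positivity
    nlinarith

lemma monodromyInfinity_mul {n : ℕ} (hn : n ≠ 0) :
    monodromyInfinity n * transitionMatrix n = transitionMatrix n * localInfinity n := by
  rw [monodromyInfinity, Matrix.mul_assoc,
    Matrix.nonsing_inv_mul _ (isUnit_det_transitionMatrix hn), Matrix.mul_one]

/-- `P M_∞ P⁻¹ m₀⁻¹` cancels `m₀ P M_∞⁻¹`. Thus `f` below and `m_(1/C) f` above are restrictions of
the same functions across `(1/C, ∞)`. -/
theorem exists_infVector' {n : ℕ} (hn : n ≠ 0) : ∃ γ : Fin n → ℂ,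
    (∀ t ∈ slitExterior n, t.im < 0 →
      coeffVector n (frobSeries n t) = (transitionMatrix n).mulVec (infVector n γ t)) ∧
    (∀ t ∈ slitExterior n, 0 < t.im →
      (monodromyConifold n).mulVec (coeffVector n (frobSeries n t)) =
        (transitionMatrix n).mulVec (infVector n γ t)) := by
  obtain ⟨γ, h1, h2⟩ := exists_infVector hn
  refine ⟨γ, h1, fun t ht him => ?_⟩
  rw [h2 t ht him, Matrix.mulVec_mulVec, Matrix.mulVec_mulVec, Matrix.mulVec_mulVec,
    monodromyConifold, Matrix.mul_assoc _ _ (monodromyZero n),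
    Matrix.nonsing_inv_mul _ (isUnit_det_monodromyZero n), Matrix.mul_one,
    monodromyInfinity_mul hn, Matrix.mul_assoc, localInfinity_mul_inverse, Matrix.mul_one]

/-! ### Analytic continuation along pieces of a path -/

/-- On the set `S` of parameters, `Φ` is a coherent family of germs along `γ`. -/
def IsContinuationOn (γ : unitInterval → ℂ) (S : Set unitInterval) (Φ : unitInterval → ℂ → ℂ) :
    Prop :=
  (∀ s ∈ S, AnalyticAt ℂ (Φ s) (γ s)) ∧ ∀ s ∈ S, ∀ᶠ s' in 𝓝[S] s, Φ s' =ᶠ[𝓝 (γ s')] Φ s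

lemma IsContinuationOn.const {γ : unitInterval → ℂ} {S : Set unitInterval} {U : Set ℂ}
    (hU : IsOpen U) {F : ℂ → ℂ} (hF : DifferentiableOn ℂ F U) (h : ∀ s ∈ S, γ s ∈ U) :
    IsContinuationOn γ S fun _ => F :=
  ⟨fun s hs => hF.analyticAt (hU.mem_nhds (h s hs)), fun _ _ => .of_forall fun _ => .rfl⟩

lemma IsContinuationOn.comp {γ δ : unitInterval → ℂ} {S T : Set unitInterval}
    {Φ : unitInterval → ℂ → ℂ} (h : IsContinuationOn γ S Φ) {σ : unitInterval → unitInterval}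
    (hσ : ContinuousOn σ T) (hST : Set.MapsTo σ T S) (hδ : ∀ s ∈ T, δ s = γ (σ s)) :
    IsContinuationOn δ T fun s => Φ (σ s) := by
  refine ⟨fun s hs => hδ s hs ▸ h.1 _ (hST hs), fun s hs => ?_⟩
  have h1 := ((hσ s hs).tendsto_nhdsWithin hST).eventually (h.2 _ (hST hs))
  filter_upwards [h1, self_mem_nhdsWithin] with s' hs' hT
  rwa [hδ s' hT]

lemma IsContinuationOn.eventually_eq {γ : unitInterval → ℂ} (hγ : Continuous γ)
    {S : Set unitInterval} {Φ Ψ : unitInterval → ℂ → ℂ} (hΦ : IsContinuationOn γ S Φ)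
    {s₀ : unitInterval} (h₀ : s₀ ∈ S) (h : Φ s₀ =ᶠ[𝓝 (γ s₀)] Ψ s₀) :
    ∀ᶠ s in 𝓝[S] s₀, Φ s =ᶠ[𝓝 (γ s)] Ψ s₀ := by
  have h1 : ∀ᶠ s in 𝓝[S] s₀, Φ s₀ =ᶠ[𝓝 (γ s)] Ψ s₀ :=
    (hγ.continuousAt.eventually (eventually_eventually_nhds.mpr h)).filter_mono nhdsWithin_le_nhds
  filter_upwards [h1, hΦ.2 s₀ h₀] with s hs1 hs2 using hs2.trans hs1

/-- Coherence needs checking only at the junction, where agreement of the two germs propagates to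
nearby points of the path. -/
lemma IsContinuationOn.glue {γ : unitInterval → ℂ} (hγ : Continuous γ) {S : Set unitInterval}
    {Φ Ψ : unitInterval → ℂ → ℂ} {s₀ : unitInterval} (h₀ : s₀ ∈ S)
    (hΦ : IsContinuationOn γ (S ∩ Set.Iic s₀) Φ) (hΨ : IsContinuationOn γ (S ∩ Set.Ici s₀) Ψ)
    (h : Φ s₀ =ᶠ[𝓝 (γ s₀)] Ψ s₀) :
    IsContinuationOn γ S fun s => if s ≤ s₀ then Φ s else Ψ s := by
  refine ⟨fun s hs => ?_, fun s hs => ?_⟩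
  · beta_reduce
    split_ifs with hle
    · exact hΦ.1 s ⟨hs, hle⟩
    · exact hΨ.1 s ⟨hs, (not_le.mp hle).le⟩
  · rcases lt_trichotomy s s₀ with hlt | heq | hgt
    · have h1 : 𝓝[S ∩ Set.Iic s₀] s = 𝓝[S] s :=
        nhdsWithin_inter_of_mem' (mem_nhdsWithin_of_mem_nhds (Iic_mem_nhds hlt))
      filter_upwards [h1 ▸ hΦ.2 s ⟨hs, hlt.le⟩, mem_nhdsWithin_of_mem_nhds (Iic_mem_nhds hlt)]
        with s' hs' hle
      simpa only [if_pos hlt.le, if_pos (Set.mem_Iic.mp hle)] using hs'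
    · subst heq
      simp only [if_pos (le_refl s)]
      have h1 := hΦ.2 s ⟨hs, Set.mem_Iic.mpr le_rfl⟩
      have h2 := hΨ.eventually_eq hγ (Ψ := Φ) ⟨hs, Set.mem_Ici.mpr le_rfl⟩ h.symm
      have h3 : 𝓝[S] s = 𝓝[S ∩ Set.Iic s] s ⊔ 𝓝[S ∩ Set.Ici s] s := by
        rw [← nhdsWithin_union, ← Set.inter_union_distrib_left, Set.Iic_union_Ici, Set.inter_univ]
      rw [h3, eventually_sup]
      constructor
      · filter_upwards [h1, self_mem_nhdsWithin] with s' hs' hm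
        rw [if_pos (Set.mem_Iic.mp hm.2)]
        exact hs'
      · filter_upwards [h2, self_mem_nhdsWithin] with s' hs' hm
        split_ifs with hle
        · obtain rfl : s' = s := le_antisymm hle hm.2
          exact .rfl
        · exact hs'
    · have h1 : 𝓝[S ∩ Set.Ici s₀] s = 𝓝[S] s :=
        nhdsWithin_inter_of_mem' (mem_nhdsWithin_of_mem_nhds (Ici_mem_nhds hgt))
      filter_upwards [h1 ▸ hΨ.2 s ⟨hs, hgt.le⟩, mem_nhdsWithin_of_mem_nhds (Ioi_mem_nhds hgt)]
        with s' hs' hle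
      simpa only [if_neg (not_le.mpr hgt), if_neg (not_le.mpr (Set.mem_Ioi.mp hle))] using hs'

lemma IsContinuationOn.continuesAlong {a b : ℂ} {γ : Path a b} {Φ : unitInterval → ℂ → ℂ}
    (h : IsContinuationOn γ Set.univ Φ) {F G : ℂ → ℂ} (hF : Φ 0 =ᶠ[𝓝 a] F)
    (hG : Φ 1 =ᶠ[𝓝 b] G) : ContinuesAlong γ F G :=
  ⟨Φ, fun s => h.1 s trivial, fun s => by simpa [nhdsWithin_univ] using h.2 s trivial, hF, hG⟩

lemma ContinuesAlong.exists_isContinuationOn {a b : ℂ} {γ : Path a b} {F G : ℂ → ℂ}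
    (h : ContinuesAlong γ F G) : ∃ Φ, IsContinuationOn γ Set.univ Φ ∧ Φ 0 =ᶠ[𝓝 a] F ∧
      Φ 1 =ᶠ[𝓝 b] G := by
  obtain ⟨Φ, h1, h2, h3⟩ := h
  exact ⟨Φ, ⟨fun s _ => h1 s, fun s _ => by simpa [nhdsWithin_univ] using h2 s⟩, h3⟩

lemma ContinuesAlong.symm {a b : ℂ} {γ : Path a b} {F G : ℂ → ℂ} (h : ContinuesAlong γ F G) :
    ContinuesAlong γ.symm G F := by
  obtain ⟨Φ, h, h0, h1⟩ := h.exists_isContinuationOn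
  exact (h.comp (δ := γ.symm) (σ := unitInterval.symm) (T := Set.univ)
    unitInterval.continuous_symm.continuousOn (Set.mapsTo_univ _ _) fun s _ => rfl).continuesAlong
      (by simpa using h1) (by simpa using h0)

lemma ContinuesAlong.congr {a b : ℂ} {γ : Path a b} {F G F' G' : ℂ → ℂ}
    (h : ContinuesAlong γ F G) (hF : F =ᶠ[𝓝 a] F') (hG : G =ᶠ[𝓝 b] G') :
    ContinuesAlong γ F' G' := by
  obtain ⟨Φ, h1, h2, h3, h4⟩ := h
  exact ⟨Φ, h1, h2, h3.trans hF, h4.trans hG⟩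

lemma ContinuesAlong.trans {a b c : ℂ} {γ : Path a b} {δ : Path b c} {F G H : ℂ → ℂ}
    (h : ContinuesAlong γ F G) (h' : ContinuesAlong δ G H) :
    ContinuesAlong (γ.trans δ) F H := by
  obtain ⟨Φ, h, h0, h1⟩ := h.exists_isContinuationOn
  obtain ⟨Ψ, h', h0', h1'⟩ := h'.exists_isContinuationOn
  -- Clamping makes both reparametrisations continuous on the entire interval; each is used only on
  -- its own half.
  set σ : unitInterval → unitInterval := fun s => Set.projIcc 0 1 zero_le_one (2 * (s : ℝ)) with hσ
  set τ : unitInterval → unitInterval :=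
    fun s => Set.projIcc 0 1 zero_le_one (2 * (s : ℝ) - 1) with hτ
  have hσc : Continuous σ := continuous_projIcc.comp (by fun_prop)
  have hτc : Continuous τ := continuous_projIcc.comp (by fun_prop)
  set s₀ : unitInterval := ⟨1 / 2, by norm_num, by norm_num⟩
  have hs0 : σ s₀ = 1 := by
    rw [hσ]; exact Set.projIcc_of_right_le _ (by norm_num [s₀])
  have ht0 : τ s₀ = 0 := by
    rw [hτ]; exact Set.projIcc_of_le_left _ (by norm_num [s₀])
  have hle : ∀ s : unitInterval, s ≤ s₀ → (γ.trans δ) s = γ (σ s) := fun s hs => by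
    have hs' : (s : ℝ) ≤ 1 / 2 := hs
    rw [Path.trans_apply, dif_pos hs']
    congr 1
    exact (Set.projIcc_of_mem _ ⟨by linarith [s.2.1], by linarith⟩).symm
  have hge : ∀ s : unitInterval, s₀ ≤ s → (γ.trans δ) s = δ (τ s) := fun s hs => by
    rcases hs.eq_or_lt with rfl | hlt
    · rw [hle _ le_rfl, hs0, ht0, γ.target, δ.source]
    · have hs' : ¬ (s : ℝ) ≤ 1 / 2 := not_le.mpr hlt
      rw [Path.trans_apply, dif_neg hs']
      congr 1
      exact (Set.projIcc_of_mem _ ⟨by linarith, by linarith [s.2.2]⟩).symm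
  refine (IsContinuationOn.glue (S := Set.univ) (γ.trans δ).continuous (s₀ := s₀) trivial
    (h.comp (T := Set.univ ∩ Set.Iic s₀) hσc.continuousOn (Set.mapsTo_univ _ _)
      fun s hs => hle s hs.2)
    (h'.comp (T := Set.univ ∩ Set.Ici s₀) hτc.continuousOn (Set.mapsTo_univ _ _)
      fun s hs => hge s hs.2) ?_).continuesAlong ?_ ?_
  · rw [hs0, ht0, hge _ le_rfl, ht0, δ.source]
    exact h1.trans h0'.symm
  · have h2 : (0 : unitInterval) ≤ s₀ := unitInterval.nonneg'
    have h3 : σ 0 = 0 := Set.projIcc_of_le_left _ (by norm_num)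
    simpa only [if_pos h2, h3] using h0
  · have h2 : ¬ (1 : unitInterval) ≤ s₀ := by
      rw [not_le]; change (1 / 2 : ℝ) < 1; norm_num
    have h3 : τ 1 = 1 := Set.projIcc_of_right_le _ (by norm_num)
    simpa only [if_neg h2, h3] using h1'

/-! ### Circles around the origin -/

/-- The branch of the logarithm on the rotated slit plane that continues the principal branch
along the circle. -/
def rotatedLog (s : unitInterval) (t : ℂ) : ℂ :=
  Complex.log (t * Complex.exp (-(twoPiI * (s : ℝ)))) + twoPiI * (s : ℝ)

lemma rotatedLog_zero : rotatedLog 0 = Complex.log := by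
  funext t; simp [rotatedLog]

lemma rotatedLog_one : rotatedLog 1 = fun t => Complex.log t + twoPiI := by
  funext t
  have h : Complex.exp (-twoPiI) = 1 := by
    rw [Complex.exp_neg, twoPiI, Complex.exp_two_pi_mul_I, inv_one]
  simp [rotatedLog, h]

lemma hasDerivAt_rotatedLog {s : unitInterval} {t : ℂ}
    (ht : t * Complex.exp (-(twoPiI * (s : ℝ))) ∈ Complex.slitPlane) :
    HasDerivAt (rotatedLog s) t⁻¹ t := by
  have h1 := ((hasDerivAt_id t).mul_const (Complex.exp (-(twoPiI * (s : ℝ))))).clog ht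
  have h2 := h1.add_const (twoPiI * (s : ℝ))
  convert! h2 using 1
  have h3 : t ≠ 0 := left_ne_zero_of_mul (Complex.slitPlane_ne_zero ht)
  have h4 := Complex.exp_ne_zero (-(twoPiI * ((s : ℝ) : ℂ)))
  simp only [id]
  field_simp

lemma circleLoop_zero_mul_exp (a : ℂ) (s : unitInterval) :
    circleLoop 0 a s * Complex.exp (-(twoPiI * (s : ℝ))) = a := by
  change (0 + (a - 0) * Complex.exp (2 * Real.pi * Complex.I * ((s : ℝ) : ℂ))) *
    Complex.exp (-(twoPiI * (s : ℝ))) = a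
  rw [zero_add, sub_zero, mul_assoc, ← Complex.exp_add, twoPiI, add_neg_cancel, Complex.exp_zero,
    mul_one]

/-- A parameter change below `1/4` turns by less than `π/2`. Added to an argument in `(-π/2, π/2)`,
it stays within `(-π, π)`, so no branch is crossed. -/
lemma rotatedLog_eq {s s' : unitInterval} (h : |(s' : ℝ) - s| < 1 / 4) {t : ℂ}
    (ht : 0 < (t * Complex.exp (-(twoPiI * (s' : ℝ)))).re) : rotatedLog s' t = rotatedLog s t := by
  set v := t * Complex.exp (-(twoPiI * (s' : ℝ))) with hv
  have hv0 : v ≠ 0 := fun h0 => by rw [h0] at ht; simp at ht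
  have h1 : Complex.exp (Complex.log v + twoPiI * ((s' : ℝ) - s)) =
      t * Complex.exp (-(twoPiI * (s : ℝ))) := by
    rw [Complex.exp_add, Complex.exp_log hv0, hv, mul_assoc, ← Complex.exp_add]
    congr 2; ring
  have h2 : (Complex.log v + twoPiI * ((s' : ℝ) - s)).im =
      Complex.arg v + 2 * Real.pi * ((s' : ℝ) - s) := by
    rw [Complex.add_im, Complex.log_im, twoPiI]
    congr 1
    have h3 : (2 * (Real.pi : ℂ) * Complex.I * (((s' : ℝ) : ℂ) - ((s : ℝ) : ℂ))) =
      ((2 * Real.pi * ((s' : ℝ) - s) : ℝ) : ℂ) * Complex.I := by push_cast; ring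
    rw [h3, Complex.im_ofReal_mul, Complex.I_im, mul_one]
  have h3 := Complex.abs_arg_lt_pi_div_two_iff.mpr (Or.inl ht)
  rw [abs_lt] at h h3
  have hp := Real.pi_pos
  rw [rotatedLog, rotatedLog, ← h1, Complex.log_exp (by rw [h2]; nlinarith)
    (by rw [h2]; nlinarith)]
  ring

/-- The circle `|t| = a` turns a function `K (log t) t` into `K (log t + 2πi) t`. -/
theorem continuesAlong_circleLoop_zero {a : ℝ} (ha : 0 < a) {b : ℂ} (hb : b = a) (K : ℂ → ℂ → ℂ) {V : Set ℂ}
    (hV : IsOpen V) (haV : ∀ t : ℂ, ‖t‖ = a → t ∈ V)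
    (hK : ∀ s : unitInterval, DifferentiableOn ℂ (fun t => K (rotatedLog s t) t)
      (V ∩ {t | t * Complex.exp (-(twoPiI * (s : ℝ))) ∈ Complex.slitPlane})) :
    ContinuesAlong (circleLoop 0 b) (fun t => K (Complex.log t) t)
      (fun t => K (Complex.log t + twoPiI) t) := by
  subst hb
  refine ⟨fun s t => K (rotatedLog s t) t, fun s => ?_, fun s => ?_, ?_, ?_⟩
  · refine (hK s).analyticAt ((hV.inter (Complex.isOpen_slitPlane.preimage
      (by fun_prop))).mem_nhds ⟨haV _ ?_, ?_⟩)
    · change ‖0 + ((a : ℂ) - 0) * Complex.exp (2 * Real.pi * Complex.I * ((s : ℝ) : ℂ))‖ = a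
      have : 2 * (Real.pi : ℂ) * Complex.I * ((s : ℝ) : ℂ) =
        ((2 * Real.pi * s : ℝ) : ℂ) * Complex.I := by push_cast; ring
      rw [zero_add, sub_zero, norm_mul, this, Complex.norm_exp_ofReal_mul_I, mul_one,
        Complex.norm_real, Real.norm_of_nonneg ha.le]
    · rw [Set.mem_preimage, circleLoop_zero_mul_exp]
      exact Complex.ofReal_mem_slitPlane.mpr ha
  · have h1 : ∀ᶠ s' : unitInterval in 𝓝 s, |(s' : ℝ) - s| < 1 / 4 := by
      have : Continuous fun s' : unitInterval => |(s' : ℝ) - s| := by fun_prop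
      exact this.continuousAt.eventually (Iio_mem_nhds (by simp))
    filter_upwards [h1] with s' hs'
    have h2 : ∀ᶠ t in 𝓝 (circleLoop 0 (a : ℂ) s'),
        0 < (t * Complex.exp (-(twoPiI * (s' : ℝ)))).re := by
      have : Continuous fun t : ℂ => (t * Complex.exp (-(twoPiI * (s' : ℝ)))).re := by fun_prop
      exact this.continuousAt.eventually (Ioi_mem_nhds (by
        beta_reduce; rw [circleLoop_zero_mul_exp]; exact ha))
    filter_upwards [h2] with t ht
    rw [rotatedLog_eq hs' ht]
  · simp [rotatedLog_zero]
  · simp [rotatedLog_one]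

/-! ### The monodromy of the Frobenius basis -/

lemma frobeniusBasis_eventuallyEq {n : ℕ} {t₀ : ℝ} (h0 : 0 < t₀) (h1 : t₀ < 1 / scale n)
    (i : Fin n) : (fun t => coeffVector n (frobSeries n t) i) =ᶠ[𝓝 (t₀ : ℂ)]
      frobeniusBasis n i := by
  filter_upwards [(isOpen_slitDisc n).mem_nhds (ofReal_mem_slitDisc h0 h1)] with t ht
    using (frobeniusBasis_eq_coeffVector i ht).symm

lemma mulVec_frobeniusBasis_eventuallyEq {n : ℕ} {t₀ : ℝ} (h0 : 0 < t₀) (h1 : t₀ < 1 / scale n)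
    (M : Matrix (Fin n) (Fin n) ℂ) (i : Fin n) :
    (fun t => M.mulVec (coeffVector n (frobSeries n t)) i) =ᶠ[𝓝 (t₀ : ℂ)]
      fun t => ∑ j, M i j * frobeniusBasis n j t := by
  filter_upwards [(isOpen_slitDisc n).mem_nhds (ofReal_mem_slitDisc h0 h1)] with t ht
  simp only [Matrix.mulVec, dotProduct, frobeniusBasis_eq_coeffVector _ ht]

/-- The Stieltjes transforms are single valued on the disc; only `log t` changes, by `2πi`. -/
theorem hasMonodromy_loopZero {n : ℕ} (hn : n ≠ 0) {t₀ : ℝ} (h0 : 0 < t₀)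
    (h1 : t₀ < 1 / scale n) :
    HasMonodromy (loopZero t₀) (frobeniusBasis n) (monodromyZero n) := by
  intro i
  have h := continuesAlong_circleLoop_zero h0 rfl (fun L t => coeffVector n (normSeries n *
    (expSeries L * psiSeries n (scale n * t))) i) (V := Metric.ball 0 (1 / scale n))
    Metric.isOpen_ball (fun t ht => by simpa [ht] using h1) fun s =>
      (differentiableOn_coeff_mul (fun _ => differentiableOn_const _) (differentiableOn_coeff_mul
        (differentiableOn_coeff_expSeries fun t ht =>
          (hasDerivAt_rotatedLog ht.2).differentiableAt.differentiableWithinAt)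
        (differentiableOn_coeff_psiSeries hn fun t ht =>
          mem_cutPlane_of_norm_lt (norm_scale_mul_lt (by simpa using ht.1)))) _).div_const _
  refine h.congr (frobeniusBasis_eventuallyEq h0 h1 i)
    (.trans (.of_eq ?_) (mulVec_frobeniusBasis_eventuallyEq h0 h1 _ i))
  funext t
  rw [← coeffVector_exp_mul, expSeries_add, frobSeries]
  congr 1
  ring

section Arcs

variable {n : ℕ} {t₀ : ℝ}

/-- A point of the circle around `1/C` through `t₀`, at the angle `θ` from `t₀`. -/
def conifoldPoint (n : ℕ) (t₀ θ : ℝ) : ℂ :=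
  conifold n + (t₀ - conifold n) * Complex.exp (θ * Complex.I)

lemma conifoldPoint_re (n : ℕ) (t₀ θ : ℝ) :
    (conifoldPoint n t₀ θ).re = 1 / scale n - (1 / scale n - t₀) * Real.cos θ := by
  rw [conifoldPoint, conifold, ← Complex.ofReal_sub, Complex.add_re, Complex.re_ofReal_mul,
    Complex.exp_ofReal_mul_I_re, Complex.ofReal_re]
  ring

lemma conifoldPoint_im (n : ℕ) (t₀ θ : ℝ) :
    (conifoldPoint n t₀ θ).im = -((1 / scale n - t₀) * Real.sin θ) := by
  rw [conifoldPoint, conifold, ← Complex.ofReal_sub, Complex.add_im, Complex.im_ofReal_mul,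
    Complex.exp_ofReal_mul_I_im, Complex.ofReal_im]
  ring

/-- This is the half of the circle to the left of `1/C`, end points included: at the end points `1 -
C t` is purely imaginary and nonzero. -/
lemma conifoldPoint_mem_doubleSlit (h0 : 0 < t₀) (h1 : t₀ < 1 / scale n) {θ : ℝ}
    (hθ : 0 ≤ Real.cos θ) : conifoldPoint n t₀ θ ∈ doubleSlit n := by
  have hr : 0 < 1 / scale n - t₀ := by linarith
  have hc := Real.cos_le_one θ
  refine ⟨Complex.mem_slitPlane_iff.mpr (Or.inl ?_), Complex.mem_slitPlane_iff.mpr ?_⟩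
  · rw [conifoldPoint_re]; nlinarith
  · have hs := scale_pos n
    have e : scale n * (1 / scale n) = 1 := mul_one_div_cancel hs.ne'
    rw [Complex.sub_re, Complex.re_ofReal_mul, Complex.one_re, Complex.sub_im,
      Complex.im_ofReal_mul, Complex.one_im, conifoldPoint_re, conifoldPoint_im, mul_sub, e]
    rcases hθ.eq_or_lt with h | h
    · right
      have h2 := Real.sin_sq_add_cos_sq θ
      rw [← h] at h2
      have h3 : Real.sin θ ≠ 0 := fun h3 => by rw [h3] at h2; norm_num at h2
      rw [zero_sub, mul_neg, neg_neg]
      exact mul_ne_zero hs.ne' (mul_ne_zero hr.ne' h3)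
    · left
      have := mul_pos hs (mul_pos hr h)
      linarith

/-- The right half, again with its end points, whose modulus exceeds `1/C` because of their
imaginary part. -/
lemma conifoldPoint_mem_slitExterior (h1 : t₀ < 1 / scale n) {θ : ℝ}
    (hθ : Real.cos θ ≤ 0) : conifoldPoint n t₀ θ ∈ slitExterior n := by
  have hr : 0 < 1 / scale n - t₀ := by linarith
  have hi := inv_scale_pos n
  have hre : 1 / scale n ≤ (conifoldPoint n t₀ θ).re := by rw [conifoldPoint_re]; nlinarith
  refine ⟨?_, Complex.mem_slitPlane_iff.mpr (Or.inl (by linarith))⟩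
  rw [Set.mem_ofPred_eq, ← abs_of_pos hi, ← sq_lt_sq₀ (abs_nonneg _) (norm_nonneg _),
    ← Complex.normSq_eq_norm_sq, Complex.normSq_apply, sq_abs, conifoldPoint_re, conifoldPoint_im]
  have h2 := Real.sin_sq_add_cos_sq θ
  have h3 : 0 < (1 / scale n - t₀) ^ 2 := by positivity
  have h4 : 0 ≤ 1 / scale n * ((1 / scale n - t₀) * -Real.cos θ) :=
    mul_nonneg hi.le (mul_nonneg hr.le (by linarith))
  nlinarith

lemma differentiableOn_mulVec {V : ℂ → Fin n → ℂ} {U : Set ℂ}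
    (h : ∀ c, DifferentiableOn ℂ (fun t => V t c) U) (M : Matrix (Fin n) (Fin n) ℂ) (i : Fin n) :
    DifferentiableOn ℂ (fun t => M.mulVec (V t) i) U := by
  simp only [Matrix.mulVec, dotProduct]
  exact DifferentiableOn.fun_sum fun j _ => (h j).const_mul _

lemma differentiableOn_mulVec_coeffVector (hn : n ≠ 0) (M : Matrix (Fin n) (Fin n) ℂ) (i : Fin n) :
    DifferentiableOn ℂ (fun t => M.mulVec (coeffVector n (frobSeries n t)) i) (doubleSlit n) :=
  differentiableOn_mulVec (fun j => (differentiableOn_frobSeries hn (j.rev : ℕ)).div_const _) M i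

lemma differentiableOn_mulVec_infVector (γ : Fin n → ℂ) (M : Matrix (Fin n) (Fin n) ℂ)
    (i : Fin n) : DifferentiableOn ℂ (fun t => M.mulVec (infVector n γ t) i) (slitExterior n) :=
  differentiableOn_mulVec (fun j =>
    (differentiableOn_infSolution j.rev (isLogChart_slitExterior n)).const_mul _) M i

lemma eventuallyEq_of_im_neg {F G : ℂ → ℂ} (h : ∀ t ∈ slitExterior n, t.im < 0 → F t = G t)
    {t : ℂ} (ht : t ∈ slitExterior n) (him : t.im < 0) : F =ᶠ[𝓝 t] G := by
  filter_upwards [(isOpen_slitExterior n).mem_nhds ht,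
    (isOpen_lt Complex.continuous_im continuous_const).mem_nhds him] with s h1 h2 using h s h1 h2

lemma eventuallyEq_of_im_pos {F G : ℂ → ℂ} (h : ∀ t ∈ slitExterior n, 0 < t.im → F t = G t)
    {t : ℂ} (ht : t ∈ slitExterior n) (him : 0 < t.im) : F =ᶠ[𝓝 t] G := by
  filter_upwards [(isOpen_slitExterior n).mem_nhds ht,
    (isOpen_lt continuous_const Complex.continuous_im).mem_nhds him] with s h1 h2 using h s h1 h2


/-- Starting to the left of `1/C`, the circle runs first below the axis. On its right half the germs
are `P g`, and the germs glue at the points straight below and straight above `1/C`, at times `1/4`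
and `3/4`, by the two parts of `exists_infVector'`. -/
theorem hasMonodromy_loopConifold (hn : n ≠ 0) (h0 : 0 < t₀) (h1 : t₀ < 1 / scale n) :
    HasMonodromy (loopConifold n t₀) (frobeniusBasis n) (monodromyConifold n) := by
  obtain ⟨γ, hlow, hup⟩ := exists_infVector' hn
  intro i
  have hpt : ∀ s : unitInterval, loopConifold n t₀ s = conifoldPoint n t₀ (2 * Real.pi * s) := by
    intro s
    change conifold n + (t₀ - conifold n) * Complex.exp (2 * Real.pi * Complex.I * ((s : ℝ) : ℂ)) =
      _
    rw [conifoldPoint]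
    congr 3
    push_cast; ring
  have hr : 0 < 1 / scale n - t₀ := by linarith
  have hp := Real.pi_pos
  have hq : ((1 / 4 : ℝ)) ∈ Set.Icc (0 : ℝ) 1 := by norm_num
  have hq' : ((3 / 4 : ℝ)) ∈ Set.Icc (0 : ℝ) 1 := by norm_num
  set a : unitInterval := ⟨1 / 4, hq⟩ with ha
  set b : unitInterval := ⟨3 / 4, hq'⟩ with hb
  have hab : a ≤ b := by change (1 / 4 : ℝ) ≤ 3 / 4; norm_num
  have hA : ∀ s ∈ Set.univ ∩ Set.Iic a, loopConifold n t₀ s ∈ doubleSlit n := by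
    intro s hs
    have hs1 : (s : ℝ) ≤ 1 / 4 := hs.2
    rw [hpt]
    exact conifoldPoint_mem_doubleSlit h0 h1
      (Real.cos_nonneg_of_neg_pi_div_two_le_of_le (by nlinarith [s.2.1]) (by nlinarith))
  have hB : ∀ s : unitInterval, a ≤ s → s ≤ b → loopConifold n t₀ s ∈ slitExterior n := by
    intro s hs1 hs2
    have hs3 : 1 / 4 ≤ (s : ℝ) := hs1
    have hs4 : (s : ℝ) ≤ 3 / 4 := hs2
    rw [hpt]
    exact conifoldPoint_mem_slitExterior h1
      (Real.cos_nonpos_of_pi_div_two_le_of_le (by nlinarith) (by nlinarith))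
  have hD : ∀ s : unitInterval, b ≤ s → loopConifold n t₀ s ∈ doubleSlit n := by
    intro s hs1
    have hs3 : 3 / 4 ≤ (s : ℝ) := hs1
    rw [hpt]
    refine conifoldPoint_mem_doubleSlit h0 h1 ?_
    rw [← Real.cos_sub_two_pi]
    exact Real.cos_nonneg_of_neg_pi_div_two_le_of_le (by nlinarith) (by nlinarith [s.2.2])
  have him : (loopConifold n t₀ a).im < 0 := by
    rw [hpt, conifoldPoint_im, show 2 * Real.pi * (a : ℝ) = Real.pi / 2 by
      change 2 * Real.pi * (1 / 4) = _; ring, Real.sin_pi_div_two]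
    linarith
  have him' : 0 < (loopConifold n t₀ b).im := by
    rw [hpt, conifoldPoint_im, show 2 * Real.pi * (b : ℝ) = Real.pi / 2 + Real.pi by
      change 2 * Real.pi * (3 / 4) = _; ring, Real.sin_add_pi, Real.sin_pi_div_two]
    linarith
  refine (IsContinuationOn.glue (S := Set.univ) (loopConifold n (t₀ : ℂ)).continuous (s₀ := a)
    trivial (.const (isOpen_doubleSlit n) (differentiableOn_mulVec_coeffVector hn 1 i) hA)
    (IsContinuationOn.glue (loopConifold n (t₀ : ℂ)).continuous (s₀ := b) ⟨trivial, hab⟩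
      (.const (isOpen_slitExterior n) (differentiableOn_mulVec_infVector γ (transitionMatrix n) i)
        fun s hs => hB s hs.1.2 hs.2)
      (.const (isOpen_doubleSlit n) (differentiableOn_mulVec_coeffVector hn (monodromyConifold n) i)
        fun s hs => hD s hs.2) ?_) ?_).continuesAlong ?_ ?_
  · exact (eventuallyEq_of_im_pos (fun t ht h => congrFun (hup t ht h) i)
      (hB b hab le_rfl) him').symm
  · simp only [if_pos hab]
    exact eventuallyEq_of_im_neg (fun t ht h => by rw [Matrix.one_mulVec, hlow t ht h])
      (hB a le_rfl hab) him
  · simp only [if_pos (unitInterval.nonneg' : (0 : unitInterval) ≤ a), Matrix.one_mulVec]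
    exact frobeniusBasis_eventuallyEq h0 h1 i
  · have h2 : ¬ (1 : unitInterval) ≤ a := by
      rw [not_le]; change (1 / 4 : ℝ) < 1; norm_num
    have h3 : ¬ (1 : unitInterval) ≤ b := by
      rw [not_le]; change (3 / 4 : ℝ) < 1; norm_num
    simp only [if_neg h2, if_neg h3]
    exact mulVec_frobeniusBasis_eventuallyEq h0 h1 _ i

lemma continuesAlong_halfCircle (hn : n ≠ 0) (h0 : 0 < t₀) (h1 : t₀ < 1 / scale n)
    {γ : Fin n → ℂ} (hγ : ∀ t ∈ slitExterior n, t.im < 0 →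
      coeffVector n (frobSeries n t) = (transitionMatrix n).mulVec (infVector n γ t))
    (M : Matrix (Fin n) (Fin n) ℂ) (i : Fin n) :
    ContinuesAlong (halfCircle (conifold n) t₀)
      (fun t => M.mulVec (coeffVector n (frobSeries n t)) i)
      (fun t => (M * transitionMatrix n).mulVec (infVector n γ t) i) := by
  have hpt : ∀ s : unitInterval, halfCircle (conifold n) t₀ s =
      conifoldPoint n t₀ (Real.pi * s) := by
    intro s
    change conifold n + (t₀ - conifold n) * Complex.exp (Real.pi * Complex.I * ((s : ℝ) : ℂ)) = _
    rw [conifoldPoint]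
    congr 3
    push_cast; ring
  have hp := Real.pi_pos
  have hq : ((1 / 2 : ℝ)) ∈ Set.Icc (0 : ℝ) 1 := by norm_num
  set a : unitInterval := ⟨1 / 2, hq⟩ with ha
  have hB : ∀ s : unitInterval, a ≤ s → halfCircle (conifold n) t₀ s ∈ slitExterior n := by
    intro s hs1
    have hs3 : 1 / 2 ≤ (s : ℝ) := hs1
    rw [hpt]
    exact conifoldPoint_mem_slitExterior h1
      (Real.cos_nonpos_of_pi_div_two_le_of_le (by nlinarith) (by nlinarith [s.2.2]))
  refine (IsContinuationOn.glue (S := Set.univ) (halfCircle (conifold n) (t₀ : ℂ)).continuous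
    (s₀ := a) trivial
    (.const (isOpen_doubleSlit n) (differentiableOn_mulVec_coeffVector hn M i) fun s hs => ?_)
    (.const (isOpen_slitExterior n)
      (differentiableOn_mulVec_infVector γ (M * transitionMatrix n) i)
        fun s hs => hB s hs.2) ?_).continuesAlong ?_ ?_
  · have hs1 : (s : ℝ) ≤ 1 / 2 := hs.2
    rw [hpt]
    exact conifoldPoint_mem_doubleSlit h0 h1
      (Real.cos_nonneg_of_neg_pi_div_two_le_of_le (by nlinarith [s.2.1]) (by nlinarith))
  · refine eventuallyEq_of_im_neg (fun t ht h => by rw [hγ t ht h, Matrix.mulVec_mulVec])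
      (hB a le_rfl) ?_
    rw [hpt, conifoldPoint_im, show Real.pi * (a : ℝ) = Real.pi / 2 by
      change Real.pi * (1 / 2) = _; ring, Real.sin_pi_div_two]
    linarith
  · simp only [if_pos (unitInterval.nonneg' : (0 : unitInterval) ≤ a)]
    exact .rfl
  · have h2 : ¬ (1 : unitInterval) ≤ a := by
      rw [not_le]; change (1 / 2 : ℝ) < 1; norm_num
    simp only [if_neg h2]
    exact .rfl

lemma continuesAlong_circle_infinity {a : ℝ} (ha : 1 / scale n < a) {b : ℂ} (hb : b = a)
    (γ : Fin n → ℂ) (M : Matrix (Fin n) (Fin n) ℂ) (i : Fin n) :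
    ContinuesAlong (circleLoop 0 b) (fun t => M.mulVec (infVector n γ t) i)
      (fun t => (M * localInfinity n).mulVec (infVector n γ t) i) := by
  have h0 := (inv_scale_pos n).trans ha
  have h := continuesAlong_circleLoop_zero h0 hb (fun L t => M.mulVec
    (fun c => γ c * (Complex.exp (-rho n c.rev * L) * infSeries n c.rev (scale n * t)⁻¹)) i)
    (V := {t | 1 / scale n < ‖t‖}) (isOpen_lt continuous_const continuous_norm)
    (fun t ht => by rwa [Set.mem_ofPred_eq, ht]) fun s =>
      differentiableOn_mulVec (fun j => (differentiableOn_infSolution j.rev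
        (isLogChart_infinity ((isOpen_lt continuous_const continuous_norm).inter
          (Complex.isOpen_slitPlane.preimage (by fun_prop)))
          (fun t ht => norm_pos_iff.mp ((inv_scale_pos n).trans ht.1))
          (fun t ht => hasDerivAt_rotatedLog ht.2) fun t ht => ht.1)).const_mul _) M i
  refine h.congr .rfl (.of_eq ?_)
  funext t
  rw [← Matrix.mulVec_mulVec]
  congr 2
  funext c
  rw [localInfinity, Matrix.mulVec_diagonal, infVector, infSolution, mul_add, Complex.exp_add]
  ring_nf

/-- The half circle takes `f` to `P g` and the large circle takes this to `P M_∞ g = m_∞ P g`. The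
latter is where the half circle takes `m_∞ f`, so the way back ends in `m_∞ f`. -/
theorem hasMonodromy_loopInfinity (hn : n ≠ 0) (h0 : 0 < t₀) (h1 : t₀ < 1 / scale n) :
    HasMonodromy (loopInfinity n t₀) (frobeniusBasis n) (monodromyInfinity n) := by
  obtain ⟨γ, hγ, -⟩ := exists_infVector hn
  intro i
  have h2 := continuesAlong_halfCircle hn h0 h1 hγ 1 i
  have h3 := continuesAlong_halfCircle hn h0 h1 hγ (monodromyInfinity n) i
  rw [monodromyInfinity_mul hn] at h3
  rw [Matrix.one_mul] at h2
  refine ((h2.trans (continuesAlong_circle_infinity (a := 2 * (1 / scale n) - t₀) (by linarith)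
    (by rw [conifold]; push_cast; ring) γ (transitionMatrix n) i)).trans h3.symm).congr ?_
    (mulVec_frobeniusBasis_eventuallyEq h0 h1 _ i)
  simpa only [Matrix.one_mulVec] using frobeniusBasis_eventuallyEq h0 h1 i

end Arcs

/-! ### The multiplication theorem for the Gamma function -/

lemma gammaSeq_one_add (z : ℂ) {M : ℕ} (hM : M ≠ 0) :
    Complex.GammaSeq (1 + z) M = (M : ℂ) ^ z * (M / (M + 1)) *
      ∏ l ∈ Finset.range (M + 1), ((l : ℂ) + 1) / (l + 1 + z) := by
  have hM' : (M : ℂ) ≠ 0 := by exact_mod_cast hM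
  have hM1 : (M : ℂ) + 1 ≠ 0 := by exact_mod_cast M.succ_ne_zero
  have h1 : ∏ l ∈ Finset.range (M + 1), ((l : ℂ) + 1) = (M.factorial : ℂ) * (M + 1) := by
    have := Finset.prod_range_add_one_eq_factorial (M + 1)
    rw [Nat.factorial_succ] at this
    have h2 := congrArg (Nat.cast : ℕ → ℂ) this
    push_cast at h2
    rw [h2, mul_comm]
  rw [Complex.GammaSeq, Finset.prod_div_distrib, h1, Complex.cpow_add _ _ hM', Complex.cpow_one]
  have h3 : ∏ j ∈ Finset.range (M + 1), (1 + z + (j : ℂ)) =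
      ∏ l ∈ Finset.range (M + 1), ((l : ℂ) + 1 + z) :=
    Finset.prod_congr rfl fun j _ => by ring
  rw [h3]
  field_simp

lemma gammaSeq_ratio {a z : ℂ} {K : ℕ} (hK : K ≠ 0) :
    Complex.GammaSeq (a + z) K / Complex.GammaSeq a K = (K : ℂ) ^ z *
      ∏ m ∈ Finset.range (K + 1), (a + m) / (a + m + z) := by
  have hK' : (K : ℂ) ≠ 0 := by exact_mod_cast hK
  have hf : (K.factorial : ℂ) ≠ 0 := by exact_mod_cast K.factorial_ne_zero
  have hc : (K : ℂ) ^ a ≠ 0 := by simp [Complex.cpow_eq_zero_iff, hK']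
  have h3 : ∏ j ∈ Finset.range (K + 1), (a + z + (j : ℂ)) =
      ∏ l ∈ Finset.range (K + 1), (a + l + z) :=
    Finset.prod_congr rfl fun j _ => by ring
  rw [Complex.GammaSeq, Complex.GammaSeq, Finset.prod_div_distrib, Complex.cpow_add _ _ hK', h3,
    div_div_div_eq]
  field_simp

/-- A product over all residues and all blocks is a product over an initial segment. -/
lemma prod_range_mul_eq (N K : ℕ) (f : ℕ → ℂ) :
    ∏ l ∈ Finset.range (N * K), f l =
      ∏ j ∈ Finset.range N, ∏ m ∈ Finset.range K, f (j + N * m) := by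
  rw [Finset.prod_comm]
  induction K with
  | zero => simp
  | succ K ih =>
    rw [Nat.mul_succ, Finset.prod_range_add, ih, Finset.prod_range_succ]
    congr 1
    exact Finset.prod_congr rfl fun j _ => by rw [add_comm]

lemma prod_gammaSeq_ratio {N : ℕ} (hN : N ≠ 0) (z : ℂ) {K : ℕ} (hK : K ≠ 0) :
    ∏ j ∈ Finset.range N, (Complex.GammaSeq (((j : ℂ) + 1) / N + z) K /
      Complex.GammaSeq (((j : ℂ) + 1) / N) K) =
      ((K : ℂ) ^ z) ^ N * ∏ l ∈ Finset.range (N * (K + 1)), ((l : ℂ) + 1) / (l + 1 + N * z) := by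
  have hN' : (N : ℂ) ≠ 0 := by exact_mod_cast hN
  rw [prod_range_mul_eq, Finset.prod_congr rfl fun j _ => gammaSeq_ratio hK,
    Finset.prod_mul_distrib, Finset.prod_const, Finset.card_range]
  congr 1
  refine Finset.prod_congr rfl fun j _ => Finset.prod_congr rfl fun m _ => ?_
  have e1 : (((j + N * m : ℕ) : ℂ) + 1) = N * (((j : ℂ) + 1) / N + m) := by
    push_cast; field_simp; ring
  rw [e1, ← mul_add, mul_div_mul_left _ _ hN']

lemma tendsto_index {N : ℕ} (hN : N ≠ 0) :
    Tendsto (fun K : ℕ => N * (K + 1) - 1) atTop atTop := by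
  refine tendsto_atTop_mono (fun K => ?_) tendsto_id
  have : 1 * (K + 1) ≤ N * (K + 1) := Nat.mul_le_mul_right _ (Nat.pos_of_ne_zero hN)
  simp only [id]; omega

/-- Gauss' multiplication theorem divided by its value at `z = 0`, so that no constant has to be
found. The finite Euler products on both sides coincide when the index on the right is `N(K+1) - 1`.
-/
theorem prod_gamma_ratio {N : ℕ} (hN : N ≠ 0) (z : ℂ) :
    (∏ j ∈ Finset.range N, (Complex.Gamma (((j : ℂ) + 1) / N + z) /
      Complex.Gamma (((j : ℂ) + 1) / N))) = Complex.Gamma (1 + N * z) * ((N : ℂ) ^ (-(N * z))) := by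
  have hN' : (N : ℂ) ≠ 0 := by exact_mod_cast hN
  have h1 : Tendsto (fun K => ∏ j ∈ Finset.range N, (Complex.GammaSeq (((j : ℂ) + 1) / N + z) K /
      Complex.GammaSeq (((j : ℂ) + 1) / N) K)) atTop (𝓝 (∏ j ∈ Finset.range N,
        (Complex.Gamma (((j : ℂ) + 1) / N + z) / Complex.Gamma (((j : ℂ) + 1) / N)))) := by
    refine tendsto_finsetProd _ fun j _ => (Complex.GammaSeq_tendsto_Gamma _).div
      (Complex.GammaSeq_tendsto_Gamma _) (Complex.Gamma_ne_zero_of_re_pos ?_)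
    have : (((j : ℂ) + 1) / N).re = ((j : ℝ) + 1) / N := by
      have : ((j : ℂ) + 1) / N = (((j + 1) / N : ℝ) : ℂ) := by push_cast; rfl
      rw [this, Complex.ofReal_re]
    rw [this]
    have : (0 : ℝ) < N := by exact_mod_cast Nat.pos_of_ne_zero hN
    positivity
  have h2 := (Complex.GammaSeq_tendsto_Gamma (1 + N * z)).comp (tendsto_index hN)
  -- the quotient of the two sequences
  have hr : Tendsto (fun K : ℕ => (K : ℝ) / (N * (K + 1) - 1)) atTop (𝓝 (1 / N)) := by
    have hN'' : (N : ℝ) ≠ 0 := by exact_mod_cast hN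
    have h3 : Tendsto (fun K : ℕ => (1 : ℝ) / (N + ((N : ℝ) - 1) * (1 / (K : ℝ)))) atTop
        (𝓝 (1 / (N + (N - 1) * 0))) :=
      (tendsto_const_nhds.div (tendsto_const_nhds.add
        (tendsto_const_nhds.mul tendsto_one_div_atTop_nhds_zero_nat)) (by simpa using hN''))
    rw [mul_zero, add_zero] at h3
    refine h3.congr' ?_
    filter_upwards [eventually_gt_atTop 0] with K hK
    have hK' : (K : ℝ) ≠ 0 := by exact_mod_cast hK.ne'
    rw [← mul_div_mul_left 1 _ hK']
    congr 1
    · ring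
    · field_simp; ring
  have h4 : Tendsto (fun K : ℕ => (((K : ℝ) / (N * (K + 1) - 1) : ℝ) : ℂ) ^ (N * z)) atTop
      (𝓝 (((1 / N : ℝ) : ℂ) ^ (N * z))) := by
    have hpos : (0 : ℝ) < 1 / N := by
      have : (0 : ℝ) < N := by exact_mod_cast Nat.pos_of_ne_zero hN
      positivity
    exact ((continuousAt_cpow_const (Complex.ofReal_mem_slitPlane.mpr hpos)).tendsto).comp
      ((Complex.continuous_ofReal.tendsto _).comp hr)
  -- Compensates the factor `M / (M + 1)` of `gammaSeq_one_add`.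
  have h5 : Tendsto (fun K : ℕ => 1 + 1 / ((N * (K + 1) - 1 : ℕ) : ℂ)) atTop (𝓝 (1 + 0)) :=
    tendsto_const_nhds.add ((tendsto_one_div_atTop_nhds_zero_nat (𝕜 := ℂ)).comp (tendsto_index hN))
  have h6 := (h2.mul h4).mul h5
  have hval : ((1 / N : ℝ) : ℂ) ^ (N * z) = (N : ℂ) ^ (-(N * z)) := by
    have h0 : ((1 / N : ℝ) : ℂ) = ((N : ℝ) : ℂ)⁻¹ := by push_cast; rw [one_div]
    rw [h0, Complex.inv_cpow _ _ (by
      rw [Complex.arg_ofReal_of_nonneg (Nat.cast_nonneg N)]; exact Real.pi_pos.ne),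
      Complex.cpow_neg, Complex.ofReal_natCast]
  rw [hval, add_zero, mul_one] at h6
  refine tendsto_nhds_unique h1 (h6.congr' ?_)
  filter_upwards [eventually_gt_atTop 0] with K hK
  rw [prod_gammaSeq_ratio hN z hK.ne', Function.comp_apply]
  have hge : K + 1 ≤ N * (K + 1) := Nat.le_mul_of_pos_left _ (Nat.pos_of_ne_zero hN)
  have hM : N * (K + 1) - 1 + 1 = N * (K + 1) := by omega
  have hM0 : N * (K + 1) - 1 ≠ 0 := by omega
  have hM0' : ((N * (K + 1) - 1 : ℕ) : ℂ) ≠ 0 := by exact_mod_cast hM0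
  rw [gammaSeq_one_add _ hM0, hM]
  have hc : ((N * (K + 1) - 1 : ℕ) : ℂ) + 1 = ((N * (K + 1) : ℕ) : ℂ) := by
    exact_mod_cast congrArg (Nat.cast : ℕ → ℂ) hM
  have hc0 : ((N * (K + 1) - 1 : ℕ) : ℂ) + 1 ≠ 0 := by
    exact_mod_cast (Nat.succ_ne_zero (N * (K + 1) - 1))
  have hd : ((N : ℝ) * (K + 1) - 1) = ((N * (K + 1) - 1 : ℕ) : ℝ) := by
    rw [Nat.cast_sub (by omega)]; push_cast; ring
  rw [hd, Complex.ofReal_div, Complex.div_cpow_ofReal_nonneg (Nat.cast_nonneg _)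
    (Nat.cast_nonneg _), Complex.ofReal_natCast, Complex.ofReal_natCast]
  have hp : ((N * (K + 1) - 1 : ℕ) : ℂ) ^ (N * z) ≠ 0 := by simp [Complex.cpow_eq_zero_iff, hM0']
  rw [← Complex.cpow_nat_mul]
  field_simp

/-- The multiplication theorem with `N = n + 1`: its last residue contributes `Γ(1+ε)`, and the
power of `N` is `C^ε`. -/
lemma moment_mul_gamma {n : ℕ} {ε : ℂ} (hε : ‖ε‖ < 1) :
    (scale n : ℂ) ^ ε * moment n ε * Complex.Gamma (1 + ε) ^ (n + 1) =
      Complex.Gamma (1 + (n + 1) * ε) := by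
  have hN : n + 1 ≠ 0 := n.succ_ne_zero
  have h := prod_gamma_ratio hN ε
  have hN' : ((n + 1 : ℕ) : ℂ) ≠ 0 := by exact_mod_cast hN
  have hN1 : (n : ℂ) + 1 ≠ 0 := by exact_mod_cast hN
  have hG : Complex.Gamma (1 + ε) ≠ 0 := by
    refine Complex.Gamma_ne_zero_of_re_pos ?_
    have := (abs_lt.mp ((Complex.abs_re_le_norm ε).trans_lt hε)).1
    simpa using by linarith
  rw [Finset.prod_range_succ, ← Fin.prod_univ_eq_prod_range (fun j => Complex.Gamma
    (((j : ℂ) + 1) / ((n + 1 : ℕ) : ℂ) + ε) / Complex.Gamma (((j : ℂ) + 1) / ((n + 1 : ℕ) : ℂ)))]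
    at h
  push_cast at h hN'
  rw [div_self hN1, Complex.Gamma_one, div_one] at h
  have hs : (scale n : ℂ) ^ ε = ((n : ℂ) + 1) ^ (((n : ℂ) + 1) * ε) := by
    rw [Complex.cpow_def_of_ne_zero (scale_ne_zero n), ← Complex.ofReal_log (scale_pos n).le,
      Complex.cpow_def_of_ne_zero hN1, scale, Real.log_pow,
      show (n : ℂ) + 1 = (((n : ℝ) + 1 : ℝ) : ℂ) by push_cast; rfl,
      ← Complex.ofReal_log (by positivity)]
    push_cast
    ring_nf
  rw [Complex.cpow_neg, ← div_eq_mul_inv, eq_div_iff (by simp [Complex.cpow_eq_zero_iff, hN1])] at h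
  rw [← h, hs, moment]
  simp only [rho]
  rw [Finset.prod_div_distrib, Finset.prod_div_distrib, Finset.prod_mul_distrib, Finset.prod_const,
    Finset.card_univ, Fintype.card_fin]
  field_simp
  ring

/-! ### The Taylor expansion of `log Γ(1 + z)` -/

/-- The coefficients of `-γ z - log Γ(1 + z)`. -/
def logGammaCoeff (k : ℕ) : ℂ := if k < 2 then 0 else (-1) ^ (k + 1) * riemannZeta k / k

/-- The terms of the double series for `-γ z - log Γ(1 + z)`. -/
def logGammaTerm (z : ℂ) (p : ℕ × ℕ) : ℂ :=
  if p.2 < 2 then 0 else (-1) ^ (p.2 + 1) * (z / (p.1 + 1)) ^ p.2 / p.2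

lemma norm_natCast_add_one (l : ℕ) : ‖((l : ℂ) + 1)‖ = (l : ℝ) + 1 := by
  rw [show (l : ℂ) + 1 = (((l : ℝ) + 1 : ℝ) : ℂ) by push_cast; rfl, Complex.norm_real,
    Real.norm_of_nonneg (by positivity)]

/-- Since only `k ≥ 2` occurs, the terms are dominated by `|z|^k / (l+1)²`. This permits exchanging
the sum of logarithms with the sum over zeta values. -/
lemma summable_logGammaTerm {z : ℂ} (hz : ‖z‖ < 1) : Summable (logGammaTerm z) := by
  have h1 : Summable fun l : ℕ => 1 / ((l : ℝ) + 1) ^ 2 := by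
    have := (summable_nat_add_iff 1).mpr (Real.summable_one_div_nat_pow.mpr (one_lt_two))
    simpa using this
  have h2 : Summable fun k : ℕ => ‖z‖ ^ k := summable_geometric_of_lt_one (norm_nonneg _) hz
  refine Summable.of_norm_bounded (h1.mul_of_nonneg h2 (fun _ => by positivity)
    fun _ => by positivity) fun p => ?_
  rw [logGammaTerm]
  split_ifs with h
  · rw [norm_zero]; positivity
  · push Not at h
    have hl : (1 : ℝ) ≤ (p.1 : ℝ) + 1 := by have : (0 : ℝ) ≤ p.1 := Nat.cast_nonneg _; linarith
    rw [norm_div, norm_mul, norm_pow, norm_neg, norm_one, one_pow, one_mul, norm_pow, norm_div,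
      norm_natCast_add_one, Complex.norm_natCast, div_pow, div_div]
    have hk : (1 : ℝ) ≤ p.2 := by exact_mod_cast (by omega : 1 ≤ p.2)
    have hp : ((p.1 : ℝ) + 1) ^ 2 ≤ ((p.1 : ℝ) + 1) ^ p.2 * p.2 :=
      (pow_le_pow_right₀ hl h).trans (le_mul_of_one_le_right (by positivity) hk)
    rw [one_div_mul_eq_div]
    gcongr

lemma norm_div_add_one_lt {z : ℂ} (hz : ‖z‖ < 1) (l : ℕ) : ‖z / ((l : ℂ) + 1)‖ < 1 := by
  rw [norm_div, norm_natCast_add_one, div_lt_one (by positivity)]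
  have : (0 : ℝ) ≤ l := Nat.cast_nonneg _
  linarith

lemma hasSum_logGammaTerm_left {z : ℂ} (hz : ‖z‖ < 1) (l : ℕ) :
    HasSum (fun k => logGammaTerm z (l, k)) (Complex.log (1 + z / (l + 1)) - z / (l + 1)) := by
  have h := Complex.hasSum_taylorSeries_log (norm_div_add_one_lt hz l)
  have h1 : HasSum (fun k : ℕ => if k = 1 then z / ((l : ℂ) + 1) else 0) (z / ((l : ℂ) + 1)) :=
    hasSum_ite_eq 1 _
  convert! h.sub h1 using 1
  funext k
  rw [logGammaTerm]
  rcases k with _ | _ | k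
  · simp
  · simp
  · simp

lemma hasSum_logGammaTerm_right (z : ℂ) (k : ℕ) :
    HasSum (fun l => logGammaTerm z (l, k)) (logGammaCoeff k * z ^ k) := by
  simp only [logGammaTerm, logGammaCoeff]
  split_ifs with h
  · simp
  · push Not at h
    have hs : Summable fun l : ℕ => 1 / (l : ℂ) ^ k := by
      refine Summable.of_norm ?_
      simpa using Real.summable_one_div_nat_pow.mpr (by omega : 1 < k)
    have h1 := hs.hasSum
    rw [← zeta_nat_eq_tsum_of_gt_one (by omega : 1 < k)] at h1
    have h2 := ((hasSum_nat_add_iff' 1).mpr h1)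
    simp only [Finset.sum_range_one, Nat.cast_zero, zero_pow (by omega : k ≠ 0), div_zero,
      sub_zero, Nat.cast_add, Nat.cast_one] at h2
    have h3 := h2.mul_left ((-1) ^ (k + 1) * z ^ k / k)
    convert! h3 using 1
    · funext l
      rw [div_pow]; ring
    · ring

/-- The function `-γ z - log Γ(1 + z)`. -/
def logGammaRest (z : ℂ) : ℂ := ∑' k, logGammaCoeff k * z ^ k

lemma hasSum_logGammaRest {z : ℂ} (hz : ‖z‖ < 1) :
    HasSum (fun k => logGammaCoeff k * z ^ k) (logGammaRest z) ∧
      HasSum (fun l : ℕ => Complex.log (1 + z / (l + 1)) - z / (l + 1)) (logGammaRest z) := by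
  have h := (summable_logGammaTerm hz).hasSum
  have h1 := h.prod_fiberwise (hasSum_logGammaTerm_left hz)
  have h2 := ((Equiv.prodComm ℕ ℕ).hasSum_iff.mpr h).prod_fiberwise
    (hasSum_logGammaTerm_right z)
  rw [logGammaRest, h2.tsum_eq]
  exact ⟨h2, h1⟩

/-- Euler's limit: the subtracted terms `z/(l+1)` add up to harmonic numbers, which combine with
`log K` to Euler's constant. -/
theorem gamma_one_add {z : ℂ} (hz : ‖z‖ < 1) : Complex.Gamma (1 + z) =
    Complex.exp (-(Real.eulerMascheroniConstant * z) - logGammaRest z) := by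
  have hN : Tendsto (fun K : ℕ => Complex.GammaSeq (1 + z) K) atTop
    (𝓝 (Complex.Gamma (1 + z))) := Complex.GammaSeq_tendsto_Gamma _
  have hsum : HasSum (fun l : ℕ => Complex.log (1 + z / (l + 1)) - z / (l + 1))
      (logGammaRest z) := (hasSum_logGammaRest hz).2
  have h1 := (hsum.tendsto_sum_nat.comp (tendsto_add_atTop_nat 1))
  have h2 : Tendsto (fun K : ℕ => ((harmonic (K + 1) : ℝ) - Real.log K : ℝ)) atTop
      (𝓝 (Real.eulerMascheroniConstant)) := by
    have := Real.tendsto_harmonic_sub_log.add (tendsto_one_div_add_atTop_nhds_zero_nat (𝕜 := ℝ))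
    rw [add_zero] at this
    refine this.congr fun K => ?_
    rw [harmonic_succ]
    push_cast
    ring
  have h3 := (((Complex.continuous_ofReal.tendsto _).comp h2).mul_const z).neg.sub h1
  have h4 := (Complex.continuous_exp.tendsto _).comp h3
  have h5 : Tendsto (fun K : ℕ => (K : ℂ) / (K + 1)) atTop (𝓝 1) := 
    tendsto_natCast_div_add_atTop 1
  have h6 := h4.mul h5
  rw [mul_one] at h6
  refine tendsto_nhds_unique hN (h6.congr' ?_)
  filter_upwards [eventually_gt_atTop 0] with K hK
  have hK' : (K : ℂ) ≠ 0 := by exact_mod_cast hK.ne'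
  rw [gammaSeq_one_add z hK.ne', Complex.cpow_def_of_ne_zero hK']
  have h7 : ∏ l ∈ Finset.range (K + 1), ((l : ℂ) + 1) / (l + 1 + z) = Complex.exp
      (-∑ l ∈ Finset.range (K + 1), Complex.log (1 + z / (l + 1))) := by
    rw [← Finset.sum_neg_distrib, Complex.exp_sum]
    refine Finset.prod_congr rfl fun l _ => ?_
    have hl : (l : ℂ) + 1 ≠ 0 := by exact_mod_cast l.succ_ne_zero
    have hlz : 1 + z / ((l : ℂ) + 1) ≠ 0 := by
      intro h0
      have h8 := norm_div_add_one_lt hz l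
      rw [(neg_eq_of_add_eq_zero_right h0).symm, norm_neg, norm_one] at h8
      exact lt_irrefl _ h8
    rw [Complex.exp_neg, Complex.exp_log hlz]
    have : (l : ℂ) + 1 + z = (l + 1) * (1 + z / (l + 1)) := by field_simp
    rw [this]
    field_simp
  rw [h7, mul_right_comm, ← Complex.exp_add]
  simp only [Function.comp_apply]
  refine congrArg (· * ((K : ℂ) / (K + 1))) (congrArg Complex.exp ?_)
  have h8 : ∑ l ∈ Finset.range (K + 1), z / ((l : ℂ) + 1) = ((harmonic (K + 1) : ℝ) : ℂ) * z := by
    rw [harmonic]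
    push_cast
    rw [Finset.sum_mul]
    exact Finset.sum_congr rfl fun l _ => by rw [div_eq_inv_mul]
  rw [Finset.sum_sub_distrib, h8, ← Complex.ofReal_natCast, ← Complex.ofReal_log (Nat.cast_nonneg K)]
  push_cast
  ring

/-! ### The normalizing series -/

/-- The Taylor coefficients of `log (Γ(1 + ε)^(n+1) / Γ(1 + (n+1) ε))`. -/
def connectionCoeff (n k : ℕ) : ℂ := (((n : ℂ) + 1) ^ k - (n + 1)) * logGammaCoeff k

/-- The Taylor series of `Γ(1 + ε)^(n+1) / Γ(1 + (n+1) ε)`. -/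
def connectionSeries (n : ℕ) : PowerSeries ℂ :=
  normSeries n * expSeries (-(Real.log (scale n) : ℂ))

lemma jet_deriv (f : ℂ → ℂ) (k : ℕ) : PowerSeries.coeff k (jet (deriv f)) =
    (k + 1) * PowerSeries.coeff (k + 1) (jet f) := by
  rw [coeff_jet, coeff_jet, ← iteratedDeriv_succ', Nat.factorial_succ]
  have h1 : ((k : ℂ) + 1) ≠ 0 := by exact_mod_cast k.succ_ne_zero
  have h2 : (k.factorial : ℂ) ≠ 0 := by exact_mod_cast k.factorial_ne_zero
  push_cast
  field_simp

/-- In `log (Γ(1+ε)^(n+1) / Γ(1+(n+1)ε))` the linear terms with Euler's constant cancel, so only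
zeta values remain. -/
theorem connectionSeries_eq {n : ℕ} (hn : n ≠ 0) : ∃ S : ℂ → ℂ, AnalyticAt ℂ S 0 ∧ S 0 = 0 ∧
    jet S = PowerSeries.mk (connectionCoeff n) ∧
    connectionSeries n = jet fun ε => Complex.exp (S ε) := by
  have hN : (0 : ℝ) < (n : ℝ) + 1 := by positivity
  set S : ℂ → ℂ := fun ε => logGammaRest ((n + 1) * ε) - (n + 1) * logGammaRest ε with hS
  have hnorm : ∀ z : ℂ, ‖z‖ < 1 / ((n : ℝ) + 1) → ‖z‖ < 1 ∧ ‖((n : ℂ) + 1) * z‖ < 1 := by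
    intro z hz
    rw [lt_div_iff₀ hN] at hz
    refine ⟨?_, ?_⟩
    · have : 0 ≤ ‖z‖ * n := by positivity
      linarith
    · rwa [norm_mul, norm_natCast_add_one, mul_comm]
  have hsum : ∀ z : ℂ, ‖z‖ < 1 / ((n : ℝ) + 1) →
      HasSum (fun k => connectionCoeff n k * z ^ k) (S z) := by
    intro z hz
    have h1 := (hasSum_logGammaRest (hnorm z hz).2).1.sub
      ((hasSum_logGammaRest (hnorm z hz).1).1.mul_left ((n : ℂ) + 1))
    convert! h1 using 1
    funext k
    rw [connectionCoeff, mul_pow]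
    ring
  obtain ⟨hA, hJ⟩ := hasSum_analyticAt_jet (by positivity) hsum
  have h0 : S 0 = 0 := by
    have h1 := congrArg (PowerSeries.coeff 0) hJ
    rw [coeff_jet, PowerSeries.coeff_mk] at h1
    simpa [connectionCoeff, logGammaCoeff] using h1
  refine ⟨S, hA, h0, hJ, ?_⟩
  rw [connectionSeries, ← jet_exp, normSeries, ← jet_mul (analyticAt_inv_moment hn) (by fun_prop)]
  refine jet_congr ?_
  filter_upwards [Metric.ball_mem_nhds (0 : ℂ) (by positivity : (0 : ℝ) < 1 / ((n : ℝ) + 1))]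
    with ε hε
  rw [mem_ball_zero_iff] at hε
  obtain ⟨h1, h2⟩ := hnorm ε hε
  have h3 := moment_mul_gamma (n := n) h1
  rw [gamma_one_add h1, gamma_one_add h2, Complex.cpow_def_of_ne_zero (scale_ne_zero n),
    ← Complex.ofReal_log (scale_pos n).le, ← Complex.exp_nat_mul] at h3
  have hm : moment n ε ≠ 0 := fun h0 => by
    rw [h0, mul_zero, zero_mul] at h3
    exact Complex.exp_ne_zero _ h3.symm
  have hm' : moment n ε = Complex.exp (-(Real.eulerMascheroniConstant * ((n + 1) * ε)) -
      logGammaRest ((n + 1) * ε) - Real.log (scale n) * ε - ((n + 1 : ℕ) : ℂ) *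
        (-(Real.eulerMascheroniConstant * ε) - logGammaRest ε)) := by
    rw [Complex.exp_sub, Complex.exp_sub, ← h3]
    field_simp
  rw [inv_mul_eq_iff_eq_mul₀ hm, hm', ← Complex.exp_add, hS]
  push_cast
  ring_nf

/-- Compare coefficients in `(e^S)' = e^S S'`. -/
lemma coeff_jet_exp_succ {S : ℂ → ℂ} (hS : AnalyticAt ℂ S 0) (k : ℕ) :
    (k + 1) * PowerSeries.coeff (k + 1) (jet fun ε => Complex.exp (S ε)) =
      ∑ p ∈ Finset.HasAntidiagonal.antidiagonal k,
        PowerSeries.coeff p.1 (jet fun ε => Complex.exp (S ε)) *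
          ((p.2 + 1) * PowerSeries.coeff (p.2 + 1) (jet S)) := by
  simp only [← jet_deriv]
  rw [← PowerSeries.coeff_mul, ← jet_mul hS.cexp' hS.deriv]
  congr 1
  refine jet_congr ?_
  filter_upwards [hS.eventually_analyticAt] with z hz
  exact hz.differentiableAt.hasDerivAt.cexp.deriv

theorem coeff_connectionSeries {n : ℕ} (hn : n ≠ 0) :
    PowerSeries.coeff 0 (connectionSeries n) = 1 ∧
    PowerSeries.coeff 1 (connectionSeries n) = 0 ∧
    PowerSeries.coeff 2 (connectionSeries n) = connectionCoeff n 2 ∧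
    PowerSeries.coeff 3 (connectionSeries n) = connectionCoeff n 3 ∧
    PowerSeries.coeff 4 (connectionSeries n) =
      connectionCoeff n 4 + connectionCoeff n 2 ^ 2 / 2 := by
  obtain ⟨S, hA, h0, hJ, hG⟩ := connectionSeries_eq hn
  have h := coeff_jet_exp_succ hA
  rw [← hG, hJ] at h
  simp only [PowerSeries.coeff_mk] at h
  have c0 : PowerSeries.coeff 0 (connectionSeries n) = 1 := by
    rw [hG, coeff_jet]; simp [h0]
  have s1 : connectionCoeff n 1 = 0 := by simp [connectionCoeff, logGammaCoeff]
  have e1 := h 0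
  have e2 := h 1
  have e3 := h 2
  have e4 := h 3
  simp only [Finset.Nat.antidiagonal_succ, Finset.Nat.antidiagonal_zero, Finset.sum_cons,
    Finset.map_singleton, Finset.sum_singleton, Finset.map_cons, Function.Embedding.prodMap,
    Function.Embedding.coeFn_mk, Prod.map, Function.Embedding.refl_apply, c0] at e1 e2 e3 e4
  norm_num [s1] at e1 e2 e3 e4
  rw [e1] at e3 e4
  rw [e2] at e4
  refine ⟨c0, e1, e2, ?_, ?_⟩
  · linear_combination e3 / 3
  · linear_combination e4 / 4

lemma connectionCoeff_two (n : ℕ) : connectionCoeff n 2 = ((n : ℂ) + 1) * n / 48 * twoPiI ^ 2 := by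
  rw [connectionCoeff, logGammaCoeff, twoPiI]
  norm_num [riemannZeta_two]
  linear_combination (-((n : ℂ) + 1) * n / 12 * Real.pi ^ 2) * Complex.I_sq

lemma connectionCoeff_three (n : ℕ) :
    connectionCoeff n 3 = (((n : ℂ) + 1) ^ 3 - (n + 1)) * (riemannZeta 3 / 3) := by
  rw [connectionCoeff, logGammaCoeff]
  norm_num

lemma connectionCoeff_four (n : ℕ) :
    connectionCoeff n 4 = -((((n : ℂ) + 1) ^ 4 - (n + 1)) / 5760) * twoPiI ^ 4 := by
  rw [connectionCoeff, logGammaCoeff, twoPiI]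
  have hI : Complex.I ^ 4 = 1 := Complex.I_pow_four
  norm_num [riemannZeta_four, mul_pow, hI]
  ring

/-! ### The monodromy matrices -/

lemma one_sub_exp_rho (n : ℕ) (k : Fin n) : 1 - Complex.exp (twoPiI * rho n k) =
    -2 * Complex.I * Complex.sin (Real.pi * rho n k) *
      Complex.exp (Real.pi * Complex.I * rho n k) := by
  have h1 : twoPiI * rho n k = Real.pi * rho n k * Complex.I + Real.pi * rho n k * Complex.I := by
    rw [twoPiI]; ring
  have h2 : -(Real.pi * rho n k) * Complex.I = -(Real.pi * rho n k * Complex.I) := by ring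
  have h3 : Real.pi * Complex.I * rho n k = Real.pi * rho n k * Complex.I := by ring
  rw [Complex.sin, h1, Complex.exp_add, h2, h3, Complex.exp_neg]
  have := Complex.exp_ne_zero (Real.pi * rho n k * Complex.I)
  field_simp
  linear_combination (1 - Complex.exp (Real.pi * rho n k * Complex.I) ^ 2) * Complex.I_sq

/-- Written with exponentials, `e^(-πiε) sin(πρ) / sin(πρ+πε)` is `e^(-2πiε)`-free: it equals `(1-ω)
/ (1 - ω e^(2πiε))` with `ω = e^(2πiρ)`. So the `k`-th series is a resolvent applied to a series
independent of `k`. -/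
lemma transitionSeries_mul {n : ℕ} (hn : n ≠ 0) (k : Fin n) :
    transitionSeries n k -
      PowerSeries.C (Complex.exp (twoPiI * rho n k)) * (transitionSeries n k * expSeries twoPiI) =
      PowerSeries.C (1 - Complex.exp (twoPiI * rho n k)) * connectionSeries n := by
  have h := transitionSeries_mul_sinSeries hn k
  have h1 : sinSeries n k = PowerSeries.C (Complex.exp (-(Real.pi * Complex.I * rho n k))) *
      expSeries (-(Real.pi * Complex.I)) *
        (1 - PowerSeries.C (Complex.exp (twoPiI * rho n k)) * expSeries twoPiI) := by
    have e1 : expSeries (Real.pi * Complex.I) =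
        expSeries (-(Real.pi * Complex.I)) * expSeries twoPiI := by
      rw [← expSeries_add, twoPiI]; congr 1; ring
    have e2 : Complex.exp (Real.pi * Complex.I * rho n k) =
        Complex.exp (-(Real.pi * Complex.I * rho n k)) * Complex.exp (twoPiI * rho n k) := by
      rw [← Complex.exp_add, twoPiI]; congr 1; ring
    rw [sinSeries, e1, e2, map_mul]
    ring
  have h2 : expSeries (Real.pi * Complex.I) * expSeries (-(Real.pi * Complex.I)) = 1 := by
    rw [← expSeries_add, add_neg_cancel, expSeries_zero]
  have h3 : PowerSeries.C (Complex.exp (Real.pi * Complex.I * rho n k)) *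
      PowerSeries.C (Complex.exp (-(Real.pi * Complex.I * rho n k))) = 1 := by
    rw [← map_mul, ← Complex.exp_add, add_neg_cancel, Complex.exp_zero, map_one]
  rw [h1] at h
  rw [one_sub_exp_rho, map_mul, connectionSeries]
  set P := PowerSeries.C (Complex.exp (Real.pi * Complex.I * rho n k))
  set E := expSeries (Real.pi * Complex.I)
  set Q := PowerSeries.C (Complex.exp (-(Real.pi * Complex.I * rho n k)))
  set F := expSeries (-(Real.pi * Complex.I))
  set W := 1 - PowerSeries.C (Complex.exp (twoPiI * rho n k)) * expSeries twoPiI with hW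
  set D := PowerSeries.C (-2 * Complex.I * Complex.sin (Real.pi * rho n k))
  have h4 : transitionSeries n k * W = D * P * (normSeries n *
      expSeries (-(Real.log (scale n) : ℂ))) := by
    linear_combination (P * E) * h - transitionSeries n k * W * (h2 * (P * Q)) -
      transitionSeries n k * W * h3 +
      D * P * (normSeries n * expSeries (-(Real.log (scale n) : ℂ))) * h2
  rw [← h4, hW]
  ring

/-- The coefficients of the connection series in the variable `2πi ε`. -/
def connectionEntry (n j : ℕ) : ℂ := PowerSeries.coeff j (connectionSeries n) / twoPiI ^ j

/-- The recursion for the entries of a column of the transition matrix, where `u = 1 / (1 - ω)`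
for the eigenvalue `ω⁻¹` of the monodromy at infinity. -/
def IsTransitionColumn (n : ℕ) (u : ℂ) (v : ℕ → ℂ) : Prop :=
  ∀ j, v j = connectionEntry n j + (u - 1) * ∑ p ∈ Finset.range j, v p / ((j - p).factorial : ℂ)

/-- With `u = 1/(1-ω)` one has `ω/(1-ω) = u - 1`, so dividing the relation of `transitionSeries_mul`
by `1 - ω` gives the recursion. The equation for `u` expresses `ω^(n+1) = 1`, and `u/(u-1)` is the
eigenvalue `ω⁻¹`. -/
lemma isTransitionColumn {n : ℕ} (hn : n ≠ 0) (k : Fin n) :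
    ∃ u : ℂ, u ^ (n + 1) = (u - 1) ^ (n + 1) ∧ u - 1 ≠ 0 ∧
      Complex.exp (-(twoPiI * rho n k)) * (u - 1) = u ∧
      IsTransitionColumn n u fun j => PowerSeries.coeff j (transitionSeries n k) / twoPiI ^ j := by
  set ω := Complex.exp (twoPiI * rho n k) with hω
  have hω0 : ω ≠ 0 := Complex.exp_ne_zero _
  have hω1 : 1 - ω ≠ 0 := by
    rw [hω, one_sub_exp_rho]
    exact mul_ne_zero (mul_ne_zero (by simp) (sin_rho_ne_zero n k)) (Complex.exp_ne_zero _)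
  have hωN : ω ^ (n + 1) = 1 := by
    rw [hω, ← Complex.exp_nat_mul, Complex.exp_eq_one_iff]
    refine ⟨(k : ℕ) + 1, ?_⟩
    have : (n : ℂ) + 1 ≠ 0 := by exact_mod_cast n.succ_ne_zero
    rw [rho, twoPiI]
    push_cast
    field_simp
  have hu : (1 - ω)⁻¹ - 1 = ω * (1 - ω)⁻¹ := by field_simp; ring
  refine ⟨(1 - ω)⁻¹, ?_, ?_, ?_, fun j => ?_⟩
  · rw [hu, mul_pow, hωN, one_mul]
  · rw [hu]; exact mul_ne_zero hω0 (inv_ne_zero hω1)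
  · rw [hu, Complex.exp_neg, ← hω, inv_mul_cancel_left₀ hω0]
  · have h := congrArg (PowerSeries.coeff j) (transitionSeries_mul hn k)
    rw [map_sub, PowerSeries.coeff_C_mul, PowerSeries.coeff_C_mul, PowerSeries.coeff_mul,
      Finset.Nat.sum_antidiagonal_eq_sum_range_succ_mk, Finset.sum_range_succ, ← hω] at h
    simp only [coeff_expSeries, Nat.sub_self, pow_zero, Nat.factorial_zero, Nat.cast_one, div_one,
      mul_one] at h
    have hp : twoPiI ^ j ≠ 0 := pow_ne_zero _ twoPiI_ne_zero
    have hs : ∑ p ∈ Finset.range j, PowerSeries.coeff p (transitionSeries n k) / twoPiI ^ p /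
        ((j - p).factorial : ℂ) = (∑ p ∈ Finset.range j,
          PowerSeries.coeff p (transitionSeries n k) *
            (twoPiI ^ (j - p) / ((j - p).factorial : ℂ))) / twoPiI ^ j := by
      rw [Finset.sum_div]
      refine Finset.sum_congr rfl fun p hp => ?_
      have h1 := pow_add twoPiI p (j - p)
      rw [Nat.add_sub_cancel' (Finset.mem_range.mp hp).le] at h1
      have h2 := pow_ne_zero p twoPiI_ne_zero
      have h3 := pow_ne_zero (j - p) twoPiI_ne_zero
      have h4 : ((j - p).factorial : ℂ) ≠ 0 := by exact_mod_cast (j - p).factorial_ne_zero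
      rw [h1]
      field_simp
    rw [hs, connectionEntry, hu]
    generalize ∑ p ∈ Finset.range j, PowerSeries.coeff p (transitionSeries n k) *
      (twoPiI ^ (j - p) / ((j - p).factorial : ℂ)) = B at h ⊢
    field_simp
    linear_combination h

/-- It suffices that `m P = P M_∞`, column by column and cleared of the denominator `u - 1`. All
columns share one shape, so a polynomial identity in `u` treats them together. -/
theorem monodromyInfinity_eq {n : ℕ} (hn : n ≠ 0) {m : Matrix (Fin n) (Fin n) ℂ}
    (h : ∀ (u : ℂ) (v : ℕ → ℂ), u ^ (n + 1) = (u - 1) ^ (n + 1) → IsTransitionColumn n u v →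
      ∀ i : Fin n, (u - 1) * ∑ j : Fin n, m i j * v (j.rev : ℕ) = u * v (i.rev : ℕ)) :
    monodromyInfinity n = m := by
  have h1 : m * transitionMatrix n = transitionMatrix n * localInfinity n := by
    ext i c
    obtain ⟨u, hu, hu1, he, hv⟩ := isTransitionColumn hn c.rev
    have h2 := h u _ hu hv i
    rw [localInfinity, Matrix.mul_diagonal, Matrix.mul_apply]
    simp only [transitionMatrix_apply, coeffVector]
    refine mul_left_cancel₀ hu1 ?_
    rw [h2]
    linear_combination -(PowerSeries.coeff (i.rev : ℕ) (transitionSeries n c.rev) /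
      twoPiI ^ (i.rev : ℕ)) * he
  rw [monodromyInfinity, ← h1, Matrix.mul_nonsing_inv_cancel_right _ _
    (isUnit_det_transitionMatrix hn)]

lemma monodromyConifold_eq {n : ℕ} {m m' : Matrix (Fin n) (Fin n) ℂ}
    (h : monodromyInfinity n = m) (h' : m' * monodromyZero n = m) : monodromyConifold n = m' := by
  rw [monodromyConifold, h, ← h', Matrix.mul_nonsing_inv_cancel_right _ _
    (isUnit_det_monodromyZero n)]

lemma connectionEntry_zero {n : ℕ} (hn : n ≠ 0) : connectionEntry n 0 = 1 := by
  rw [connectionEntry, (coeff_connectionSeries hn).1, pow_zero, div_one]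

lemma connectionEntry_one {n : ℕ} (hn : n ≠ 0) : connectionEntry n 1 = 0 := by
  rw [connectionEntry, (coeff_connectionSeries hn).2.1, zero_div]

lemma connectionEntry_two {n : ℕ} (hn : n ≠ 0) :
    connectionEntry n 2 = ((n : ℂ) + 1) * n / 48 := by
  rw [connectionEntry, (coeff_connectionSeries hn).2.2.1, connectionCoeff_two,
    mul_div_cancel_right₀ _ (pow_ne_zero _ twoPiI_ne_zero)]

lemma connectionEntry_three {n : ℕ} (hn : n ≠ 0) : connectionEntry n 3 =
    (((n : ℂ) + 1) ^ 3 - (n + 1)) / 3 * (riemannZeta 3 / (2 * Real.pi * Complex.I) ^ 3) := by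
  rw [connectionEntry, (coeff_connectionSeries hn).2.2.2.1, connectionCoeff_three, twoPiI]
  ring

lemma connectionEntry_four {n : ℕ} (hn : n ≠ 0) : connectionEntry n 4 =
    -((((n : ℂ) + 1) ^ 4 - (n + 1)) / 5760) + (((n : ℂ) + 1) * n / 48) ^ 2 / 2 := by
  have := twoPiI_ne_zero
  rw [connectionEntry, (coeff_connectionSeries hn).2.2.2.2, connectionCoeff_two,
    connectionCoeff_four]
  field_simp

lemma IsTransitionColumn.values {n : ℕ} (hn : n ≠ 0) {u : ℂ} {v : ℕ → ℂ}
    (h : IsTransitionColumn n u v) : v 0 = 1 ∧ v 1 = u - 1 ∧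
      v 2 = connectionEntry n 2 + (u - 1) * (1 / 2 + v 1) ∧
      v 3 = connectionEntry n 3 + (u - 1) * (1 / 6 + v 1 / 2 + v 2) ∧
      v 4 = connectionEntry n 4 + (u - 1) * (1 / 24 + v 1 / 6 + v 2 / 2 + v 3) := by
  have h0 : v 0 = 1 := by
    have := h 0
    simpa [connectionEntry_zero hn] using this
  refine ⟨h0, ?_, ?_, ?_, ?_⟩
  · have := h 1
    simpa [connectionEntry_one hn, Finset.sum_range_succ, h0] using this
  · have := h 2
    simpa [Finset.sum_range_succ, h0, Nat.factorial] using this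
  · have := h 3
    rw [this]
    simp [Finset.sum_range_succ, h0, Nat.factorial]
  · have := h 4
    rw [this]
    simp [Finset.sum_range_succ, h0, Nat.factorial]

/-! ### The explicit matrices for `n = 2, 3, 4, 5`. -/

theorem monodromyZero_two : monodromyZero 2 = !![1, 1; 0, 1] := by
  ext i j; fin_cases i <;> fin_cases j <;> simp [monodromyZero]

theorem monodromyZero_three : monodromyZero 3 = !![1, 1, 1/2; 0, 1, 1; 0, 0, 1] := by
  ext i j; fin_cases i <;> fin_cases j <;> simp [monodromyZero]

theorem monodromyZero_four :
    monodromyZero 4 = !![1, 1, 1/2, 1/6; 0, 1, 1, 1/2; 0, 0, 1, 1; 0, 0, 0, 1] := by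
  ext i j; fin_cases i <;> fin_cases j <;> simp [monodromyZero, Nat.factorial]

theorem monodromyZero_five : monodromyZero 5 =
    !![1, 1, 1/2, 1/6, 1/24; 0, 1, 1, 1/2, 1/6; 0, 0, 1, 1, 1/2; 0, 0, 0, 1, 1;
      0, 0, 0, 0, 1] := by
  ext i j; fin_cases i <;> fin_cases j <;> simp [monodromyZero, Nat.factorial]

/-- Here and for larger `n` the row belonging to `v j` needs the relation for `u` with the multiple
`-connectionEntry n j`. The degree `1` entry is `0`, so that row is an identity in `u`. -/
theorem monodromyInfinity_two : monodromyInfinity 2 = !![1, 1; -3, -2] := by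
  refine monodromyInfinity_eq two_ne_zero fun u v hu hv => ?_
  obtain ⟨h0, h1, -⟩ := hv.values two_ne_zero
  intro i
  fin_cases i <;> simp [Fin.sum_univ_succ, Fin.rev, h0, h1]
  · linear_combination 0 * hu
  · linear_combination -hu

theorem monodromyInfinity_three : monodromyInfinity 3 = !![0, 0, -1/4; 0, 1, 1; -4, -4, -2] := by
  refine monodromyInfinity_eq three_ne_zero fun u v hu hv => ?_
  obtain ⟨h0, h1, h2, -⟩ := hv.values three_ne_zero
  rw [connectionEntry_two three_ne_zero, h1] at h2
  norm_num at h2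
  intro i
  fin_cases i <;> simp [Fin.sum_univ_succ, Fin.rev, h0, h1, h2]
  · linear_combination (-1 / 4) * hu
  · ring
  · linear_combination -hu

theorem monodromyInfinity_four {κ₄ : ℂ}
    (hκ₄ : κ₄ = -200 * (riemannZeta 3 / (2 * (Real.pi : ℂ) * Complex.I) ^ 3)) :
    monodromyInfinity 4 =
      !![1 + κ₄, 1 + κ₄, 1/2 + 11*κ₄/12, 1/6 + 7*κ₄/12 + κ₄^2/5;
         -25/12, -13/12, -131/144, -103/144 - 5*κ₄/12;
         0, 0, 1, 1;
         -5, -5, -55/12, -23/12 - κ₄] := by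
  refine monodromyInfinity_eq four_ne_zero fun u v hu hv => ?_
  obtain ⟨h0, h1, h2, h3, -⟩ := hv.values four_ne_zero
  -- The factor is `(5³ - 5)/3 = 40`, and `κ₄` carries `-200`.
  have e3 : connectionEntry 4 3 = -κ₄ / 5 := by
    rw [connectionEntry_three four_ne_zero, hκ₄]; push_cast; ring
  rw [connectionEntry_two four_ne_zero, h1] at h2
  rw [e3, h1, h2] at h3
  norm_num at h2 h3
  intro i
  fin_cases i <;> simp [Fin.sum_univ_succ, Fin.rev, h0, h1, h2, h3]
  · linear_combination (κ₄ / 5) * hu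
  · linear_combination (-5 / 12) * hu
  · ring
  · linear_combination -hu

theorem monodromyInfinity_five {κ₅ : ℂ}
    (hκ₅ : κ₅ = 420 * (riemannZeta 3 / (2 * (Real.pi : ℂ) * Complex.I) ^ 3)) :
    monodromyInfinity 5 =
      !![75/64, 75/64, 355/512, -11*κ₅/384 + 155/512, -11*κ₅/384 + 2399/24576;
         -κ₅, -κ₅ + 1, -9*κ₅/8 + 1, (4*κ₅ - 3)*(κ₅ - 4)/24, κ₅^2/6 - 125*κ₅/384 + 1/6;
         -15/4, -15/4, -103/32, 5*κ₅/8 - 63/32, 5*κ₅/8 - 369/512;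
         0, 0, 0, 1, 1;
         -6, -6, -27/4, κ₅ - 19/4, κ₅ - 61/64] := by
  have h5 : (5 : ℕ) ≠ 0 := by norm_num
  refine monodromyInfinity_eq h5 fun u v hu hv => ?_
  obtain ⟨h0, h1, h2, h3, h4⟩ := hv.values h5
  -- The factor is `(6³ - 6)/3 = 70`, and `κ₅` carries `420`.
  have e3 : connectionEntry 5 3 = κ₅ / 6 := by
    rw [connectionEntry_three h5, hκ₅]; push_cast; ring
  have e4 : connectionEntry 5 4 = -11 / 384 := by
    rw [connectionEntry_four h5]; norm_num
  rw [connectionEntry_two h5, h1] at h2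
  rw [e3, h1, h2] at h3
  rw [e4, h1, h2, h3] at h4
  norm_num at h2 h3 h4
  intro i
  fin_cases i <;> simp [Fin.sum_univ_succ, Fin.rev, h0, h1, h2, h3, h4]
  · linear_combination (11 / 384) * hu
  · linear_combination (-κ₅ / 6) * hu
  · linear_combination (-5 / 8) * hu
  · ring
  · linear_combination -hu

theorem monodromyConifold_two : monodromyConifold 2 = !![1, 0; -3, 1] := by
  refine monodromyConifold_eq monodromyInfinity_two ?_
  rw [monodromyZero_two]
  ext i j; fin_cases i <;> fin_cases j <;> norm_num [Matrix.mul_apply, Fin.sum_univ_succ]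

theorem monodromyConifold_three :
    monodromyConifold 3 = !![0, 0, -1/4; 0, 1, 0; -4, 0, 0] := by
  refine monodromyConifold_eq monodromyInfinity_three ?_
  rw [monodromyZero_three]
  ext i j; fin_cases i <;> fin_cases j <;> norm_num [Matrix.mul_apply, Fin.sum_univ_succ]

theorem monodromyConifold_four {κ₄ : ℂ}
    (hκ₄ : κ₄ = -200 * (riemannZeta 3 / (2 * (Real.pi : ℂ) * Complex.I) ^ 3)) :
    monodromyConifold 4 =
      !![1 + κ₄, 0, 5*κ₄/12, κ₄^2/5;
         -25/12, 1, -125/144, -5*κ₄/12;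
         0, 0, 1, 0;
         -5, 0, -25/12, 1 - κ₄] := by
  refine monodromyConifold_eq (monodromyInfinity_four hκ₄) ?_
  rw [monodromyZero_four]
  ext i j; fin_cases i <;> fin_cases j <;> simp [Matrix.mul_apply, Fin.sum_univ_succ] <;> ring

theorem monodromyConifold_five {κ₅ : ℂ}
    (hκ₅ : κ₅ = 420 * (riemannZeta 3 / (2 * (Real.pi : ℂ) * Complex.I) ^ 3)) :
    monodromyConifold 5 =
      !![75/64, 0, 55/512, -11*κ₅/384, -121/24576;
         -κ₅, 1, -5*κ₅/8, κ₅^2/6, 11*κ₅/384;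
         -15/4, 0, -43/32, 5*κ₅/8, 55/512;
         0, 0, 0, 1, 0;
         -6, 0, -15/4, κ₅, 75/64] := by
  refine monodromyConifold_eq (monodromyInfinity_five hκ₅) ?_
  rw [monodromyZero_five]
  ext i j; fin_cases i <;> fin_cases j <;> simp [Matrix.mul_apply, Fin.sum_univ_succ] <;> ring

/-! ### Residues on tori -/

/-- The binomial coefficient of `x^k` in `(1 + x)^(-m)`. -/
def residueCoeff (k m : ℕ) : ℂ := (-1) ^ k * (m.ascFactorial k : ℂ) / (k.factorial : ℂ)

lemma residueCoeff_succ (k m : ℕ) :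
    (k + 1) * residueCoeff (k + 1) m = -(m * residueCoeff k (m + 1)) := by
  have h1 : (k.factorial : ℂ) ≠ 0 := by exact_mod_cast k.factorial_ne_zero
  have h2 : (k : ℂ) + 1 ≠ 0 := by exact_mod_cast k.succ_ne_zero
  have h3 : (m.ascFactorial (k + 1) : ℂ) = m * ((m + 1).ascFactorial k : ℂ) := by
    exact_mod_cast Nat.succ_ascFactorial m k ▸ Nat.ascFactorial_succ
  rw [residueCoeff, residueCoeff, h3, Nat.factorial_succ]
  push_cast
  field_simp
  ring

lemma add_ne_zero_of_norm_lt {c x : ℂ} (h : ‖x‖ < ‖c‖) : c + x ≠ 0 := fun h0 => by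
  rw [eq_neg_of_add_eq_zero_left h0, norm_neg] at h
  exact lt_irrefl _ h

/-- Integration by parts lowers the order of the pole at `0` until Cauchy's formula applies; the
point `-c` lies outside the circle. -/
theorem circleIntegral_residue {r : ℝ} (hr : 0 < r) {c : ℂ} (hc : r < ‖c‖) (k m : ℕ) :
    (∮ x in C(0, r), (x ^ (k + 1))⁻¹ * ((c + x) ^ m)⁻¹) =
      twoPiI * residueCoeff k m * (c ^ (m + k))⁻¹ := by
  have hx : ∀ x ∈ Metric.closedBall (0 : ℂ) r, c + x ≠ 0 := fun x hx =>
    add_ne_zero_of_norm_lt (by rw [mem_closedBall_zero_iff] at hx; linarith)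
  have hx0 : ∀ x ∈ Metric.sphere (0 : ℂ) r, x ≠ 0 ∧ c + x ≠ 0 := fun x h =>
    ⟨Metric.ne_of_mem_sphere h hr.ne', hx x (Metric.sphere_subset_closedBall h)⟩
  have hcont : ∀ (a : ℂ) (k m : ℕ),
      CircleIntegrable (fun x => a * ((x ^ (k + 1))⁻¹ * ((c + x) ^ m)⁻¹)) 0 r :=
    fun a k m => ContinuousOn.circleIntegrable hr.le (continuousOn_const.mul
      (((continuousOn_id.pow _).inv₀ fun x h => pow_ne_zero _ (hx0 x h).1).mul
        (((continuousOn_const.add continuousOn_id).pow _).inv₀ fun x h =>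
          pow_ne_zero _ (hx0 x h).2)))
  induction k generalizing m with
  | zero =>
    have h := Complex.circleIntegral_sub_center_inv_smul_of_differentiable_on_off_countable hr
      (c := 0) (f := fun x => ((c + x) ^ m)⁻¹) Set.countable_empty
      (((continuousOn_const.add continuousOn_id).pow _).inv₀ fun x h => pow_ne_zero _ (hx x h))
      fun x h => (((differentiableAt_const c).add differentiableAt_id).pow m).inv
        (pow_ne_zero _ (hx x (Metric.ball_subset_closedBall h.1)))
    simpa [twoPiI, residueCoeff] using h
  | succ k ih =>
    have hd : ∀ x ∈ Metric.sphere (0 : ℂ) r, HasDerivWithinAt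
        (fun x => (x ^ (k + 1))⁻¹ * ((c + x) ^ m)⁻¹)
        (-((k + 1) * ((x ^ (k + 1 + 1))⁻¹ * ((c + x) ^ m)⁻¹) +
          m * ((x ^ (k + 1))⁻¹ * ((c + x) ^ (m + 1))⁻¹))) (Metric.sphere 0 r) x := by
      intro x h
      obtain ⟨h1, h2⟩ := hx0 x h
      have e1 := ((hasDerivAt_id x).fun_pow (k + 1)).fun_inv (pow_ne_zero _ h1)
      have e2 := (((hasDerivAt_id x).const_add c).fun_pow m).fun_inv (pow_ne_zero m h2)
      convert! (e1.fun_mul e2).hasDerivWithinAt using 1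
      simp only [id, Nat.add_sub_cancel, mul_one]
      -- For `m = 0` the exponent `m - 1` of the derivative is truncated, so this case is separate.
      rcases m with _ | m
      · simp only [Nat.cast_zero, pow_zero, zero_mul]
        push_cast
        field_simp
        ring
      · simp only [Nat.add_sub_cancel]
        push_cast
        field_simp
        ring
    have h0 := circleIntegral.integral_eq_zero_of_hasDerivWithinAt hr.le
      fun x h => (hd x h).fun_neg
    simp only [neg_neg] at h0
    rw [circleIntegral.integral_add
      (hcont _ (k + 1) m) (hcont _ k (m + 1)),
      circleIntegral.integral_const_mul, circleIntegral.integral_const_mul, ih] at h0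
    have hk : (k : ℂ) + 1 ≠ 0 := by exact_mod_cast k.succ_ne_zero
    refine mul_left_cancel₀ hk ?_
    rw [show m + 1 + k = m + (k + 1) by ring] at h0
    linear_combination h0 - twoPiI * (c ^ (m + (k + 1)))⁻¹ * residueCoeff_succ k m

lemma norm_torusMap {n : ℕ} {r : ℝ} (hr : 0 < r) (θ : Fin n → ℝ) (i : Fin n) :
    ‖torusMap 0 (fun _ => r) θ i‖ = r := by
  rw [torusMap, Pi.zero_apply, zero_add, norm_mul, Complex.norm_exp_ofReal_mul_I, mul_one,
    Complex.norm_real, Real.norm_of_nonneg hr.le]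

lemma norm_sum_torusMap_le {n : ℕ} {r : ℝ} (hr : 0 < r) (θ : Fin n → ℝ) :
    ‖∑ i, torusMap 0 (fun _ => r) θ i‖ ≤ n * r := by
  refine (norm_sum_le _ _).trans (le_of_eq ?_)
  simp [norm_torusMap hr]

lemma continuous_torusMap {n : ℕ} (c : Fin n → ℂ) (R : Fin n → ℝ) : Continuous (torusMap c R) := by
  unfold torusMap
  fun_prop

lemma torusIntegrable_of_continuous {n : ℕ} {f : (Fin n → ℂ) → ℂ} {c : Fin n → ℂ} {R : Fin n → ℝ}
    (h : Continuous fun θ => f (torusMap c R θ)) : TorusIntegrable f c R :=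
  h.continuousOn.integrableOn_compact isCompact_Icc

lemma torusIntegrable_residue {n : ℕ} {r : ℝ} (hr : 0 < r) {c : ℂ} (hc : n * r < ‖c‖) (k m : ℕ) :
    TorusIntegrable (fun x : Fin n → ℂ => (∏ i, (x i ^ (k + 1))⁻¹) * ((c + ∑ i, x i) ^ m)⁻¹) 0
      fun _ => r := by
  have hT := continuous_torusMap (0 : Fin n → ℂ) fun _ => r
  have hTi : ∀ i, Continuous fun θ => torusMap (0 : Fin n → ℂ) (fun _ => r) θ i := fun i =>
    (continuous_apply i).comp hT
  refine torusIntegrable_of_continuous ((continuous_finsetProd _ fun i _ => ((hTi i).pow _).inv₀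
    fun θ => pow_ne_zero _ (norm_pos_iff.mp ?_)).mul (((continuous_const.add
      (continuous_finsetSum _ fun i _ => hTi i)).pow m).inv₀ fun θ => pow_ne_zero _
        (add_ne_zero_of_norm_lt ((norm_sum_torusMap_le hr θ).trans_lt hc))))
  rw [norm_torusMap hr]
  exact hr

/-- The inner integral, with `c + x` in place of `c`, is again a power of `c + x`, with exponent
raised by `k` for each variable. The hypothesis on `c` passes to `c + x` because `|x| = r`. -/
theorem torusIntegral_residue {n : ℕ} {r : ℝ} (hr : 0 < r) {c : ℂ} (hc : n * r < ‖c‖) (k m : ℕ) :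
    torusIntegral (fun x : Fin n → ℂ => (∏ i, (x i ^ (k + 1))⁻¹) * ((c + ∑ i, x i) ^ m)⁻¹) 0
      (fun _ => r) = twoPiI ^ n * (∏ j ∈ Finset.range n, residueCoeff k (m + j * k)) *
        (c ^ (m + n * k))⁻¹ := by
  induction n generalizing c with
  | zero => rw [torusIntegral_dim0]; simp
  | succ n ih =>
    push_cast at hc
    have hnr : 0 ≤ n * r := by positivity
    have hc1 : r < ‖c‖ := by linarith
    rw [torusIntegral_succ (torusIntegrable_residue hr (by push_cast; exact hc) k m)]
    have h1 : Set.EqOn (fun x : ℂ => torusIntegral (fun y : Fin n → ℂ =>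
        (∏ i, ((Fin.cons x y : Fin (n + 1) → ℂ) i ^ (k + 1))⁻¹) *
          ((c + ∑ i, (Fin.cons x y : Fin (n + 1) → ℂ) i) ^ m)⁻¹)
        (0 : Fin n → ℂ) fun _ => r)
        (fun x => twoPiI ^ n * (∏ j ∈ Finset.range n, residueCoeff k (m + j * k)) *
          ((x ^ (k + 1))⁻¹ * ((c + x) ^ (m + n * k))⁻¹)) (Metric.sphere 0 r) := by
      intro x hx
      have hxn : ‖x‖ = r := by simpa using hx
      have hcx : n * r < ‖c + x‖ := by
        have := norm_sub_le (c + x) x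
        rw [add_sub_cancel_right] at this
        linarith
      beta_reduce
      simp only [Fin.prod_univ_succ, Fin.sum_univ_succ, Fin.cons_zero, Fin.cons_succ, mul_assoc,
        ← add_assoc c x]
      rw [torusIntegral_const_mul, ih hcx]
      ring
    have h2 := circleIntegral.integral_congr hr.le h1
    rw [circleIntegral.integral_const_mul, circleIntegral_residue hr hc1] at h2
    refine h2.trans ?_
    rw [Finset.prod_range_succ, show m + (n + 1) * k = m + n * k + k by ring]
    ring

/-! ### The holomorphic period -/

lemma ascPochhammer_eval_eq_prod (k : ℕ) (z : ℂ) :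
    (ascPochhammer ℂ k).eval z = ∏ m ∈ Finset.range k, (z + m) := by
  induction k with
  | zero => simp
  | succ k ih => rw [ascPochhammer_succ_eval, ih, Finset.prod_range_succ]

/-- Split the factors of `((n+1)k)!` by residue modulo `n + 1`; the multiples of `n + 1` account for
`k!`. -/
lemma scale_pow_mul_prod (n k : ℕ) :
    (scale n : ℂ) ^ k * ((∏ j, (ascPochhammer ℂ k).eval (rho n j)) * (k.factorial : ℂ)) =
      (((n + 1) * k).factorial : ℂ) := by
  have h1 : (((n + 1) * k).factorial : ℂ) = ∏ l ∈ Finset.range ((n + 1) * k), ((l : ℂ) + 1) := by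
    rw [← Finset.prod_range_add_one_eq_factorial]
    push_cast
    rfl
  have hN : (n : ℂ) + 1 ≠ 0 := by exact_mod_cast n.succ_ne_zero
  rw [h1, prod_range_mul_eq]
  have h2 : ∀ j ∈ Finset.range (n + 1), ∏ m ∈ Finset.range k, (((j + (n + 1) * m : ℕ) : ℂ) + 1) =
      ((n : ℂ) + 1) ^ k * (ascPochhammer ℂ k).eval (((j : ℂ) + 1) / (n + 1)) := by
    intro j _
    have hc : ((n : ℂ) + 1) ^ k = ∏ _m ∈ Finset.range k, ((n : ℂ) + 1) := by simp
    rw [ascPochhammer_eval_eq_prod, hc, ← Finset.prod_mul_distrib]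
    refine Finset.prod_congr rfl fun m _ => ?_
    push_cast
    field_simp
    ring
  rw [Finset.prod_congr rfl h2, Finset.prod_mul_distrib, Finset.prod_const, Finset.card_range,
    Finset.prod_range_succ, div_self hN, ascPochhammer_eval_one,
    ← Fin.prod_univ_eq_prod_range (fun j => (ascPochhammer ℂ k).eval (((j : ℂ) + 1) / (n + 1)))]
  simp only [rho, scale]
  push_cast
  rw [← pow_mul, ← pow_mul, mul_comm k]

lemma prod_residueCoeff (n k : ℕ) :
    ((-1) ^ n) ^ k * (∏ j ∈ Finset.range n, residueCoeff k (k + 1 + j * k)) *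
      (k.factorial : ℂ) ^ (n + 1) = (((n + 1) * k).factorial : ℂ) := by
  induction n with
  | zero => simp
  | succ n ih =>
    have h1 : (k.factorial : ℂ) ≠ 0 := by exact_mod_cast k.factorial_ne_zero
    have h2 : (((n + 1) * k).factorial : ℂ) * ((k + 1 + n * k).ascFactorial k : ℂ) =
        (((n + 1 + 1) * k).factorial : ℂ) := by
      have := Nat.factorial_mul_ascFactorial ((n + 1) * k) k
      rw [show (n + 1) * k + 1 = k + 1 + n * k by ring,
        show (n + 1) * k + k = (n + 1 + 1) * k by ring] at this
      exact_mod_cast this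
    have h3 : ((-1 : ℂ) ^ k) * (-1) ^ k = 1 := by rw [← mul_pow]; norm_num
    have h4 := div_mul_cancel₀ ((-1) ^ k * ((k + 1 + n * k).ascFactorial k : ℂ)) h1
    rw [← h2, ← ih, Finset.prod_range_succ, residueCoeff.eq_1 k (k + 1 + n * k),
      pow_succ (-1 : ℂ) n, mul_pow, pow_succ (k.factorial : ℂ) (n + 1)]
    set P := ∏ j ∈ Finset.range n, residueCoeff k (k + 1 + j * k)
    linear_combination ((-1) ^ n) ^ k * (-1) ^ k * P * (k.factorial : ℂ) ^ (n + 1) * h4 +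
      ((-1) ^ n) ^ k * P * (k.factorial : ℂ) ^ (n + 1) *
        ((k + 1 + n * k).ascFactorial k : ℂ) * h3

lemma prod_residueCoeff_eq (n k : ℕ) (t : ℂ) :
    ((-1) ^ n * t) ^ k * (∏ j ∈ Finset.range n, residueCoeff k (k + 1 + j * k)) =
      (∏ j, (ascPochhammer ℂ k).eval (rho n j + 0)) / ((ascPochhammer ℂ k).eval (1 + 0)) ^ n *
        ((scale n : ℂ) * t) ^ k := by
  have h1 : (k.factorial : ℂ) ≠ 0 := by exact_mod_cast k.factorial_ne_zero
  have h := prod_residueCoeff n k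
  rw [← scale_pow_mul_prod, pow_succ, ← mul_assoc, ← mul_assoc] at h
  have h2 := mul_right_cancel₀ h1 h
  simp only [add_zero, ascPochhammer_eval_one]
  rw [mul_pow, mul_pow, div_mul_eq_mul_div, eq_div_iff (pow_ne_zero _ h1)]
  linear_combination t ^ k * h2

lemma frobenius_zero_eq (n : ℕ) (t : ℂ) : frobenius n 0 t =
    ∑' k : ℕ, (∏ j, (ascPochhammer ℂ k).eval (rho n j + 0)) /
      ((ascPochhammer ℂ k).eval (1 + 0)) ^ n * ((scale n : ℂ) * t) ^ k := by
  simp [frobenius, frobeniusGen]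

section Torus

variable {n : ℕ} {t : ℂ}

/-- The product of the coordinates and `1 + ∑ xᵢ`. -/
def mirrorProduct (x : Fin n → ℂ) : ℂ := (∏ i, x i) * ((∑ i, x i) + 1)

lemma mirrorPoly_scale (n : ℕ) (t : ℂ) (x : Fin n → ℂ) :
    mirrorPoly n (scale n * t) x = mirrorProduct x - (-1) ^ n * t := by
  have := scale_ne_zero n
  rw [mirrorPoly, mirrorProduct]
  field_simp
  ring

/-- Each coordinate has modulus `1/(n+1)`, and `1 + ∑ xᵢ` has modulus at least `1 - n/(n+1)`. This
explains both the radii and the bound on `t`. -/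
lemma one_div_scale_le_norm (θ : Fin n → ℝ) :
    1 / scale n ≤ ‖mirrorProduct (torusMap 0 (torusRadius n) θ)‖ := by
  have hr : (0 : ℝ) < 1 / ((n : ℝ) + 1) := by positivity
  have h1 := norm_sum_torusMap_le hr θ
  have h2 := norm_sub_le ((∑ i, torusMap 0 (torusRadius n) θ i) + 1)
    (∑ i, torusMap 0 (torusRadius n) θ i)
  rw [add_sub_cancel_left, norm_one] at h2
  have h3 : ∏ i, ‖torusMap 0 (torusRadius n) θ i‖ = (1 / ((n : ℝ) + 1)) ^ n := by
    have h : ∀ i, ‖torusMap 0 (torusRadius n) θ i‖ = 1 / ((n : ℝ) + 1) := norm_torusMap hr θ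
    simp [h]
  rw [mirrorProduct, norm_mul, norm_prod, h3, scale, ← one_div_pow, pow_succ]
  refine mul_le_mul_of_nonneg_left ?_ (by positivity)
  have h4 : (n : ℝ) * (1 / (n + 1)) = 1 - 1 / (n + 1) := by field_simp; ring
  change ‖∑ i, torusMap 0 (torusRadius n) θ i‖ ≤ _ at h1
  linarith

lemma continuous_mirrorProduct :
    Continuous fun θ : Fin n → ℝ => mirrorProduct (torusMap 0 (torusRadius n) θ) := by
  have hTi : ∀ i, Continuous fun θ => torusMap (0 : Fin n → ℂ) (torusRadius n) θ i := fun i =>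
    (continuous_apply i).comp (continuous_torusMap _ _)
  exact (continuous_finsetProd _ fun i _ => hTi i).mul
    ((continuous_finsetSum _ fun i _ => hTi i).add continuous_const)

/-- On the torus `1/f` is a geometric series with ratio at most `|t| C < 1`, so dominated
convergence allows integrating term by term. -/
theorem hasSum_period (ht : ‖t‖ < 1 / scale n) :
    TorusIntegrable (fun x => (mirrorPoly n (scale n * t) x)⁻¹) 0 (torusRadius n) ∧
    HasSum (fun k : ℕ => twoPiI ^ n * (((-1) ^ n * t) ^ k *
      ∏ j ∈ Finset.range n, residueCoeff k (k + 1 + j * k)))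
      (torusIntegral (fun x => (mirrorPoly n (scale n * t) x)⁻¹) 0 (torusRadius n)) := by
  have hr : (0 : ℝ) < 1 / ((n : ℝ) + 1) := by positivity
  have hs := inv_scale_pos n
  have hnorm : ‖(-1) ^ n * t‖ = ‖t‖ := by simp
  have hne : ∀ θ : Fin n → ℝ, mirrorProduct (torusMap 0 (torusRadius n) θ) ≠ 0 := fun θ =>
    norm_pos_iff.mp (hs.trans_le (one_div_scale_le_norm θ))
  have hne' : ∀ θ : Fin n → ℝ, mirrorPoly n (scale n * t) (torusMap 0 (torusRadius n) θ) ≠ 0 := by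
    intro θ h0
    have h1 := one_div_scale_le_norm θ
    rw [mirrorPoly_scale, sub_eq_zero] at h0
    rw [h0, hnorm] at h1
    linarith
  refine ⟨torusIntegrable_of_continuous (Continuous.inv₀ ?_ hne'), ?_⟩
  · simp only [mirrorPoly_scale]
    exact continuous_mirrorProduct.sub continuous_const
  have hcirc : Continuous fun θ : Fin n → ℝ =>
      ∏ i, ((torusRadius n i : ℝ) : ℂ) * Complex.exp (θ i * Complex.I) * Complex.I := by fun_prop
  have hq : ‖t‖ * scale n < 1 := (lt_div_iff₀ (scale_pos n)).mp ht
  have hfin : IsFiniteMeasure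
      (volume.restrict (Set.Icc (0 : Fin n → ℝ) fun _ => 2 * Real.pi)) :=
    ⟨by rw [Measure.restrict_apply_univ]; exact isCompact_Icc.measure_lt_top⟩
  have hq0 : 0 ≤ ‖t‖ * scale n := mul_nonneg (norm_nonneg _) (scale_pos n).le
  have hmain := hasSum_integral_of_dominated_convergence
    (μ := volume.restrict (Set.Icc (0 : Fin n → ℝ) fun _ => 2 * Real.pi))
    (F := fun (k : ℕ) θ => (∏ i, ((torusRadius n i : ℝ) : ℂ) * Complex.exp (θ i * Complex.I) *
      Complex.I) • (((-1) ^ n * t) ^ k *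
        ((mirrorProduct (torusMap 0 (torusRadius n) θ)) ^ (k + 1))⁻¹))
    (f := fun θ => (∏ i, ((torusRadius n i : ℝ) : ℂ) * Complex.exp (θ i * Complex.I) *
      Complex.I) • (mirrorPoly n (scale n * t) (torusMap 0 (torusRadius n) θ))⁻¹)
    (fun k _ => (1 / ((n : ℝ) + 1)) ^ n * scale n * (‖t‖ * scale n) ^ k)
    (fun k => (hcirc.smul (continuous_const.mul ((continuous_mirrorProduct.pow (k + 1)).inv₀
      fun θ => pow_ne_zero _ (hne θ)))).aestronglyMeasurable)
    (fun k => .of_forall fun θ => ?_)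
    (.of_forall fun _ => (summable_geometric_of_lt_one hq0 hq).mul_left _)
    (integrable_const _) (.of_forall fun θ => ?_)
  · convert! hmain using 1
    funext k
    change _ = torusIntegral (fun x => ((-1) ^ n * t) ^ k * (mirrorProduct x ^ (k + 1))⁻¹) 0
      (torusRadius n)
    rw [torusIntegral_const_mul]
    have h1 := torusIntegral_residue (n := n) hr (c := 1) (by
      rw [norm_one, mul_one_div, div_lt_one (by positivity)]; linarith) k (k + 1)
    rw [one_pow, inv_one, mul_one] at h1
    have h2 : (fun x : Fin n → ℂ => ((mirrorProduct x) ^ (k + 1))⁻¹) = fun x =>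
        (∏ i, (x i ^ (k + 1))⁻¹) * ((1 + ∑ i, x i) ^ (k + 1))⁻¹ := by
      funext x
      rw [mirrorProduct, mul_pow, mul_inv, Finset.prod_inv_distrib, Finset.prod_pow, add_comm 1]
    rw [h2]
    change _ = _ * torusIntegral _ 0 (fun _ => 1 / ((n : ℝ) + 1))
    rw [h1]
    ring
  · have h1 := one_div_scale_le_norm θ
    have h2 : ‖∏ i, ((torusRadius n i : ℝ) : ℂ) * Complex.exp (θ i * Complex.I) * Complex.I‖ =
        (1 / ((n : ℝ) + 1)) ^ n := by
      rw [norm_prod]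
      simp only [norm_mul, Complex.norm_exp_ofReal_mul_I, Complex.norm_I, mul_one,
        Complex.norm_real, torusRadius, Real.norm_of_nonneg hr.le]
      simp
    rw [norm_smul, h2, norm_mul, norm_pow, hnorm, norm_inv, norm_pow, mul_assoc]
    refine mul_le_mul_of_nonneg_left ?_ (by positivity)
    have h3 : (‖mirrorProduct (torusMap 0 (torusRadius n) θ)‖ ^ (k + 1))⁻¹ ≤ scale n ^ (k + 1) := by
      have h4 := pow_le_pow_left₀ hs.le h1 (k + 1)
      rw [one_div_pow] at h4
      have := inv_anti₀ (by have := scale_pos n; positivity) h4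
      simpa using this
    calc _ ≤ ‖t‖ ^ k * scale n ^ (k + 1) := mul_le_mul_of_nonneg_left h3 (by positivity)
      _ = _ := by rw [mul_pow, pow_succ]; ring
  · refine HasSum.const_smul _ ?_
    set p := mirrorProduct (torusMap 0 (torusRadius n) θ) with hp
    have h1 : ‖((-1) ^ n * t) / p‖ < 1 := by
      rw [norm_div, hnorm, div_lt_one (norm_pos_iff.mpr (hne θ))]
      exact ht.trans_le (one_div_scale_le_norm θ)
    have h2 := (hasSum_geometric_of_norm_lt_one h1).mul_right p⁻¹
    have h3 : (1 - ((-1) ^ n * t) / p)⁻¹ * p⁻¹ =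
        (mirrorPoly n (scale n * t) (torusMap 0 (torusRadius n) θ))⁻¹ := by
      rw [mirrorPoly_scale, ← hp, ← mul_inv, sub_mul, one_mul, div_mul_cancel₀ _ (hne θ)]
    rw [h3] at h2
    convert! h2 using 1
    funext k
    rw [div_pow, div_mul_eq_mul_div, pow_succ, mul_inv, div_eq_mul_inv]
    ring

theorem period_eq_frobenius (hn : n ≠ 0) (ht : ‖t‖ < 1 / scale n) :
    period n (scale n * t) = twoPiI ^ (n - 1) * frobenius n 0 t := by
  have h := (hasSum_period ht).2.tsum_eq
  have hp := twoPiI_ne_zero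
  rw [period, ← h, tsum_mul_left, frobenius_zero_eq]
  simp only [prod_residueCoeff_eq]
  obtain ⟨m, rfl⟩ := Nat.exists_eq_succ_of_ne_zero hn
  rw [Nat.succ_sub_one, pow_succ]
  field_simp

end Torus

/-! ### The monodromy statement for every `n ≥ 1` and its explicit cases. -/

theorem isMonodromyTriple {n : ℕ} (hn : n ≠ 0) : IsMonodromyTriple n (monodromyZero n)
    (monodromyConifold n) (monodromyInfinity n) where
  period_eq _ ht := ⟨(hasSum_period ht).1, period_eq_frobenius hn ht⟩
  holomorphic := differentiableOn_frobeniusBasis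
  basis _ hF := frobeniusBasis_basis hn hF
  transition_invertible := isUnit_det_transitionMatrix hn
  zero_eq := rfl
  conifold_eq := rfl
  infinity_eq := rfl
  hasMonodromy_zero _ h0 h1 := hasMonodromy_loopZero hn h0 h1
  hasMonodromy_conifold _ h0 h1 := hasMonodromy_loopConifold hn h0 h1
  hasMonodromy_infinity _ h0 h1 := hasMonodromy_loopInfinity hn h0 h1

end FermatMirror

end

theorem mainTheorem13 (κ₄ κ₅ : ℂ)
    (hκ₄ : κ₄ = -200 * (riemannZeta 3 / (2 * (Real.pi : ℂ) * Complex.I) ^ 3))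
    (hκ₅ : κ₅ = 420 * (riemannZeta 3 / (2 * (Real.pi : ℂ) * Complex.I) ^ 3)) :
    FermatMirror.IsMonodromyTriple 2
      !![1, 1;
         0, 1]
      !![1, 0;
         -3, 1]
      !![1, 1;
         -3, -2] ∧
    FermatMirror.IsMonodromyTriple 3
      !![1, 1, 1/2;
         0, 1, 1;
         0, 0, 1]
      !![0, 0, -1/4;
         0, 1, 0;
         -4, 0, 0]
      !![0, 0, -1/4;
         0, 1, 1;
         -4, -4, -2] ∧
    FermatMirror.IsMonodromyTriple 4
      !![1, 1, 1/2, 1/6;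
         0, 1, 1, 1/2;
         0, 0, 1, 1;
         0, 0, 0, 1]
      !![1 + κ₄, 0, 5*κ₄/12, κ₄^2/5;
         -25/12, 1, -125/144, -5*κ₄/12;
         0, 0, 1, 0;
         -5, 0, -25/12, 1 - κ₄]
      !![1 + κ₄, 1 + κ₄, 1/2 + 11*κ₄/12, 1/6 + 7*κ₄/12 + κ₄^2/5;
         -25/12, -13/12, -131/144, -103/144 - 5*κ₄/12;
         0, 0, 1, 1;
         -5, -5, -55/12, -23/12 - κ₄] ∧
    FermatMirror.IsMonodromyTriple 5
      !![1, 1, 1/2, 1/6, 1/24;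
         0, 1, 1, 1/2, 1/6;
         0, 0, 1, 1, 1/2;
         0, 0, 0, 1, 1;
         0, 0, 0, 0, 1]
      !![75/64, 0, 55/512, -11*κ₅/384, -121/24576;
         -κ₅, 1, -5*κ₅/8, κ₅^2/6, 11*κ₅/384;
         -15/4, 0, -43/32, 5*κ₅/8, 55/512;
         0, 0, 0, 1, 0;
         -6, 0, -15/4, κ₅, 75/64]
      !![75/64, 75/64, 355/512, -11*κ₅/384 + 155/512, -11*κ₅/384 + 2399/24576;
         -κ₅, -κ₅ + 1, -9*κ₅/8 + 1, (4*κ₅ - 3)*(κ₅ - 4)/24, κ₅^2/6 - 125*κ₅/384 + 1/6;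
         -15/4, -15/4, -103/32, 5*κ₅/8 - 63/32, 5*κ₅/8 - 369/512;
         0, 0, 0, 1, 1;
         -6, -6, -27/4, κ₅ - 19/4, κ₅ - 61/64] := by
  refine ⟨?_, ?_, ?_, ?_⟩
  · have h := FermatMirror.isMonodromyTriple two_ne_zero
    rwa [FermatMirror.monodromyZero_two, FermatMirror.monodromyConifold_two,
      FermatMirror.monodromyInfinity_two] at h
  · have h := FermatMirror.isMonodromyTriple three_ne_zero
    rwa [FermatMirror.monodromyZero_three, FermatMirror.monodromyConifold_three,
      FermatMirror.monodromyInfinity_three] at h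
  · have h := FermatMirror.isMonodromyTriple four_ne_zero
    rwa [FermatMirror.monodromyZero_four, FermatMirror.monodromyConifold_four hκ₄,
      FermatMirror.monodromyInfinity_four hκ₄] at h
  · have h := FermatMirror.isMonodromyTriple (n := 5) (by norm_num)
    rwa [FermatMirror.monodromyZero_five, FermatMirror.monodromyConifold_five hκ₅,
      FermatMirror.monodromyInfinity_five hκ₅] at h
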